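/- **Setting.** Let $\mathfrak h_s,\mathfrak h_e$ be complex Hilbert spaces, $\mathcal B_s\subseteq \mathrm B(\mathfrak h_s)$ and $\mathcal B_e\subseteq \mathrm B(\mathfrak h_e)$ von Neumann algebras, and $\mathcal B_{se}=\mathcal B_s\otimes\mathcal B_e$ their von Neumann tensor product on $\mathfrak h_s\otimes\mathfrak h_e$. Let $\mu_{se}$ be a normal state on $\mathcal B_{se}$ and, for $t\in[0,\infty)$, let $U_t$ be a unitary on $\mathfrak h_s\otimes\mathfrak h_e$ such that $j_t(X)=U_t^*(X\otimes 1)U_t\in\mathcal B_{se}$ for all $X\in\mathcal B_s$. For $0\le t_1<\dots<t_n$, $n\ge1$, and $\mathbf a,\mathbf b\in\mathcal B_s^n$ put $j_{\mathbf t_n}(\mathbf a)=j_{t_n}(a_n)\cdots j_{t_1}(a_1)$. The correlation kernel is $w^{se}_{\mathbf t_n}(\mathbf a,\mathbf b)=\mu_{se}\big(j_{\mathbf t_n}(\mathbf a)^*j_{\mathbf t_n}(\mathbf b)\big)$. **Process tensors.** A *quantum operation* is a completely positive linear map $O$ on $\mathrm B(\mathfrak h_s)$ that maps every positive trace-class $\rho$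 to a positive trace-class operator with $\mathrm{tr}(O\rho)\le\mathrm{tr}(\rho)$. Let $\mathcal O^{\otimes m}$ denote the real vector space of all linear combinations of tensor products $O_1\otimes\dots\otimes O_m$ of quantum operations, completed in the projective norm (the gauge of the absolutely convex hull of these products). Each $v\in\mathcal O^{\otimes m}$ has a Choi kernel, the continuous linear extension of $O_1\otimes\dots\otimes O_m\mapsto\prod_j\langle\psi_j,O_j(|x_j\rangle\langle y_j|)\chi_j\rangle$. A finite sum $\sum_l A_l\otimes v_l$ with complex $k\times k$ matrices $A_l$ and $v_l\in\mathcal O^{\otimes m}$ is *completely positive* if its matrix-valued Choi kernel is positive semidefinite; a single $v$ is completely positive if $1\otimes v$ ($k=1$) is. Call $v$ a *sequential operation* if its Choi kernel is that of a procedure which prepares some ancilla in a density operator, applies at each of the $m$ times a quantum operation to the ancilla and system together (the same ancilla may be used at all times), and finally discards the ancilla. This includes all products $O_1\otimes\dots\otimes O_m$. A *process tensor* for $\mathbf t_n$ is a continuous real linear map $\mathcal T_{\mathbf t_n}:\mathcal O^{\otimes n}\to\mathrm B(\mathfrak h_s)$, together with such maps $\mathcal T_{\mathbf s_m}:\mathcal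 O^{\otimes m}\to\mathrm B(\mathfrak h_s)$ for all sub-tuples $\mathbf s_m\subseteq\mathbf t_n$. Each of them maps completely positive elements to positive trace-class operators, and for all sub-tuples: 1. $\mathrm{tr}\,\mathcal T_{\mathbf s_m}(v)\le1$ for every sequential operation $v$. 2. Complete positivity: if $\sum_l A_l\otimes v_l$ is completely positive, then $\sum_l A_l\otimes\mathcal T_{\mathbf s_m}(v_l)\ge0$. 3. Containment: if $\mathbf r\subseteq\mathbf s$ are sub-tuples of $\mathbf t_n$, then $\mathcal T_{\mathbf r}(\bigotimes_{\tau\in\mathbf r} O_\tau)=\mathcal T_{\mathbf s}(\bigotimes_{\tau\in\mathbf s} O'_\tau)$ for all quantum operations $O_\tau$, where $O'_\tau=O_\tau$ for $\tau\in\mathbf r$ and $O'_\tau=\mathrm{Id}$ otherwise. **Theorem.** For every such process and all $0\le t_1<\dots<t_n$ with $n\ge1$ there is a process tensor $\mathcal T^s_{\mathbf t_n}$ with the following two properties. For $R\in\mathrm B(\mathfrak h_s)$ write $\mathcal R$ for the conjugation $\mathcal R(\cdot)=R(\cdot)R^*$. * On conjugations by elements of $\mathcal B_s$ it gives the unnormalised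 reduced system state at time $t_n$: for all $\mathbf R=(R_1,\dots,R_n)\in\mathcal B_s^n$ and $X\in\mathcal B_s$, $$\mathrm{tr}\big(X\,\mathcal T^s_{\mathbf t_n}(\mathcal R_1\otimes\dots\otimes\mathcal R_n)\big)=\mu_{se}\big(j_{\mathbf t_n}(\mathbf R)^*\,j_{t_n}(X)\,j_{\mathbf t_n}(\mathbf R)\big).$$ * There are a positive integer $\ell$ and $c_1,\dots,c_\ell\in\mathbb C$ such that for all $\mathbf a,\mathbf b\in\mathcal B_s^n$ there are $R_{jk}\in\mathcal B_s$ ($1\le j\le n$, $1\le k\le\ell$) with $$w^{se}_{\mathbf t_n}(\mathbf a,\mathbf b)=\sum_{k=1}^{\ell}c_k\,\mathrm{tr}\big(\mathcal T^s_{\mathbf t_n}(\mathcal R_{1k}\otimes\dots\otimes\mathcal R_{nk})\big),\qquad \mathcal R_{jk}(\cdot)=R_{jk}(\cdot)R_{jk}^*.$$ -/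

import Mathlib

open scoped TensorProduct ComplexOrder NNReal Pointwise

namespace QSP

universe u v

noncomputable section

/-! ### Trace and density operators -/

section Trace

variable {H : Type u} [NormedAddCommGroup H] [InnerProductSpace ℂ H] [CompleteSpace H]

/-- A fixed Hilbert basis of `H`, used to write down the trace. -/
def stdBasis (H : Type u) [NormedAddCommGroup H] [InnerProductSpace ℂ H] [CompleteSpace H] :
    HilbertBasis (exists_hilbertBasis ℂ H).choose ℂ H :=
  (exists_hilbertBasis ℂ H).choose_spec.choose

/-- The trace `∑ ⟨b i, A b i⟩`. It is only used for trace-class operators, for which the sum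
converges absolutely and does not depend on the basis. -/
def opTrace (A : H →L[ℂ] H) : ℂ :=
  ∑' i, inner ℂ (stdBasis H i) (A (stdBasis H i))

/-- Unnormalised density operators: positive operators of finite trace. -/
def IsUnnormalizedDensity (ρ : H →L[ℂ] H) : Prop :=
  0 ≤ ρ ∧ Summable fun i => inner ℂ (stdBasis H i) (ρ (stdBasis H i))

/-- Density operators: positive operators of trace one. -/
def IsDensity (ρ : H →L[ℂ] H) : Prop :=
  IsUnnormalizedDensity ρ ∧ opTrace ρ = 1

/-- Complete positivity of a linear map on `B(H)` (entrywise application to `k × k` matrices is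
positive for every `k`; this is the defining property of Mathlib's `CompletelyPositiveMap`). -/
def IsCompletelyPositive (O : (H →L[ℂ] H) →ₗ[ℂ] (H →L[ℂ] H)) : Prop :=
  ∀ (k : ℕ) (M : CStarMatrix (Fin k) (Fin k) (H →L[ℂ] H)), 0 ≤ M → 0 ≤ M.map O

/-- Quantum operations on `B(H)`: completely positive linear maps that send unnormalised density
operators to unnormalised density operators and do not increase their trace. -/
def IsQuantumOperation (O : (H →L[ℂ] H) →ₗ[ℂ] (H →L[ℂ] H)) : Prop :=
  IsCompletelyPositive O ∧
    ∀ ρ, IsUnnormalizedDensity ρ → IsUnnormalizedDensity (O ρ) ∧ opTrace (O ρ) ≤ opTrace ρ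

/-- The conjugation `X ↦ R X R*`. -/
def conj (R : H →L[ℂ] H) : (H →L[ℂ] H) →ₗ[ℂ] (H →L[ℂ] H) :=
  LinearMap.mulLeft ℂ R ∘ₗ LinearMap.mulRight ℂ (star R)

theorem conj_apply (R X : H →L[ℂ] H) : conj R X = R * (X * star R) := rfl

theorem isQuantumOperation_id : IsQuantumOperation (LinearMap.id : (H →L[ℂ] H) →ₗ[ℂ] _) := by
  refine ⟨fun k M hM => ?_, fun ρ hρ => ⟨hρ, le_rfl⟩⟩
  have : M.map (LinearMap.id : (H →L[ℂ] H) →ₗ[ℂ] _) = M := by ext; rfl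
  rwa [this]

theorem isCompletelyPositive_conj (R : H →L[ℂ] H) : IsCompletelyPositive (conj R) := by
  intro k M hM
  let D : CStarMatrix (Fin k) (Fin k) (H →L[ℂ] H) :=
    CStarMatrix.ofMatrix (Matrix.diagonal fun _ => R)
  have : M.map (conj R) = D * M * star D := by
    ext i j : 2
    simp only [D, CStarMatrix.mul_apply, CStarMatrix.map_apply, CStarMatrix.star_apply,
      CStarMatrix.ofMatrix_apply, Matrix.diagonal_apply, conj_apply, ite_mul, zero_mul,
      Finset.sum_ite_eq, Finset.mem_univ, if_true, apply_ite star, star_zero, mul_ite, mul_zero,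
      mul_assoc]
  rw [this]
  exact star_right_conjugate_nonneg hM D

theorem tsum_nnnorm_inner_sq (x : H) :
    ∑' i, ((‖inner ℂ (stdBasis H i) x‖₊ ^ 2 : ℝ≥0) : ENNReal) = ((‖x‖₊ ^ 2 : ℝ≥0) : ENNReal) := by
  have h := (stdBasis H).hasSum_inner_mul_inner x x
  have h2 : HasSum (fun i => ‖inner ℂ (stdBasis H i) x‖ ^ 2) (‖x‖ ^ 2) := by
    rw [← Complex.hasSum_ofReal]
    have e1 : (((‖x‖ ^ 2 : ℝ)) : ℂ) = inner ℂ x x := by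
      rw [inner_self_eq_norm_sq_to_K]
      push_cast
      rfl
    have e2 : (fun i => ((‖inner ℂ (stdBasis H i) x‖ ^ 2 : ℝ) : ℂ)) =
        fun i => inner ℂ x (stdBasis H i) * inner ℂ (stdBasis H i) x := by
      ext i
      rw [← inner_conj_symm x, Complex.conj_mul']
      push_cast
      rfl
    rw [e1, e2]
    exact h
  have h3 : HasSum (fun i => ‖inner ℂ (stdBasis H i) x‖₊ ^ 2) (‖x‖₊ ^ 2) := by
    rw [← NNReal.hasSum_coe]
    push_cast
    exact h2
  exact (ENNReal.hasSum_coe.2 h3).tsum_eq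

/-- The Hilbert-Schmidt sum of an operator agrees with that of its adjoint. -/
theorem tsum_nnnorm_star (S : H →L[ℂ] H) :
    ∑' i, ((‖star S (stdBasis H i)‖₊ ^ 2 : ℝ≥0) : ENNReal) =
      ∑' i, ((‖S (stdBasis H i)‖₊ ^ 2 : ℝ≥0) : ENNReal) := by
  simp_rw [← tsum_nnnorm_inner_sq (star S _), ← tsum_nnnorm_inner_sq (S _)]
  rw [ENNReal.tsum_comm]
  refine tsum_congr fun i => tsum_congr fun j => ?_
  rw [ContinuousLinearMap.star_eq_adjoint, ContinuousLinearMap.adjoint_inner_right,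
    ← inner_conj_symm, RCLike.nnnorm_conj]

theorem inner_star_mul_self (S : H →L[ℂ] H) (x : H) :
    inner ℂ x ((star S * S) x) = (((‖S x‖₊ ^ 2 : ℝ≥0) : ℝ) : ℂ) := by
  rw [ContinuousLinearMap.star_eq_adjoint, mul_apply_eq_comp,
    ContinuousLinearMap.adjoint_inner_right, inner_self_eq_norm_sq_to_K]
  push_cast
  rfl

theorem isUnnormalizedDensity_star_mul_self (S : H →L[ℂ] H) :
    IsUnnormalizedDensity (star S * S) ↔
      ∑' i, ((‖S (stdBasis H i)‖₊ ^ 2 : ℝ≥0) : ENNReal) ≠ ⊤ := by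
  simp only [IsUnnormalizedDensity, inner_star_mul_self, star_mul_self_nonneg, true_and,
    Complex.summable_ofReal, NNReal.summable_coe, ENNReal.tsum_coe_ne_top_iff_summable]

theorem opTrace_star_mul_self (S : H →L[ℂ] H) :
    opTrace (star S * S) =
      ((∑' i, ((‖S (stdBasis H i)‖₊ ^ 2 : ℝ≥0) : ENNReal)).toReal : ℂ) := by
  rw [opTrace, ENNReal.tsum_toReal_eq (fun _ => ENNReal.coe_ne_top)]
  simp only [inner_star_mul_self, ENNReal.coe_toReal]
  rw [Complex.ofReal_tsum]

theorem isQuantumOperation_conj (R : H →L[ℂ] H) (hR : ‖R‖₊ ≤ 1) :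
    IsQuantumOperation (conj R) := by
  refine ⟨isCompletelyPositive_conj R, fun ρ hρ => ?_⟩
  obtain ⟨S, rfl⟩ := CStarAlgebra.nonneg_iff_eq_star_mul_self.1 hρ.1
  have e : conj R (star S * S) = star (S * star R) * (S * star R) := by
    simp [conj_apply, mul_assoc]
  have hle : ∑' i, ((‖(S * star R) (stdBasis H i)‖₊ ^ 2 : ℝ≥0) : ENNReal) ≤
      ∑' i, ((‖S (stdBasis H i)‖₊ ^ 2 : ℝ≥0) : ENNReal) := by
    rw [← tsum_nnnorm_star, ← tsum_nnnorm_star S]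
    refine ENNReal.tsum_le_tsum fun i => ENNReal.coe_le_coe.2 (pow_le_pow_left' ?_ 2)
    rw [star_mul, star_star, mul_apply_eq_comp]
    exact (R.le_opNNNorm _).trans (mul_le_of_le_one_left' hR)
  have hS := (isUnnormalizedDensity_star_mul_self S).1 hρ
  rw [e]
  refine ⟨(isUnnormalizedDensity_star_mul_self _).2 (ne_top_of_le_ne_top hS hle), ?_⟩
  rw [opTrace_star_mul_self, opTrace_star_mul_self]
  exact_mod_cast ENNReal.toReal_mono hS hle

theorem nnnorm_le_opTrace {ρ : H →L[ℂ] H} (hρ : IsUnnormalizedDensity ρ) :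
    ((‖ρ‖ : ℝ) : ℂ) ≤ opTrace ρ := by
  obtain ⟨S, rfl⟩ := CStarAlgebra.nonneg_iff_eq_star_mul_self.1 hρ.1
  have hS := (isUnnormalizedDensity_star_mul_self S).1 hρ
  rw [opTrace_star_mul_self, CStarRing.norm_star_mul_self, Complex.real_le_real]
  set t := ∑' i, ((‖S (stdBasis H i)‖₊ ^ 2 : ℝ≥0) : ENNReal) with ht
  have key : ∀ x, ‖S x‖ ≤ √t.toReal * ‖x‖ := by
    intro x
    have h1 : ((‖S x‖₊ ^ 2 : ℝ≥0) : ENNReal) ≤ t * ((‖x‖₊ ^ 2 : ℝ≥0) : ENNReal) := by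
      rw [← tsum_nnnorm_inner_sq (S x), ht, ← tsum_nnnorm_star, ← ENNReal.tsum_mul_right]
      refine ENNReal.tsum_le_tsum fun i => ?_
      rw [← ENNReal.coe_mul, ENNReal.coe_le_coe, ← mul_pow]
      refine pow_le_pow_left' ?_ 2
      rw [← ContinuousLinearMap.adjoint_inner_left]
      exact nnnorm_inner_le_nnnorm _ _
    have h2 := ENNReal.toReal_mono (ENNReal.mul_ne_top hS ENNReal.coe_ne_top) h1
    rw [ENNReal.toReal_mul, ENNReal.coe_toReal, ENNReal.coe_toReal] at h2
    push_cast at h2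
    refine (pow_le_pow_iff_left₀ (norm_nonneg _) (by positivity) two_ne_zero).1 ?_
    rwa [mul_pow, Real.sq_sqrt ENNReal.toReal_nonneg]
  have h := S.opNorm_le_bound (Real.sqrt_nonneg _) key
  calc ‖S‖ * ‖S‖ ≤ √t.toReal * √t.toReal := by gcongr
    _ = t.toReal := Real.mul_self_sqrt ENNReal.toReal_nonneg

theorem rankOne_self_density (z : H) :
    IsUnnormalizedDensity (InnerProductSpace.rankOne ℂ z z) ∧
      opTrace (InnerProductSpace.rankOne ℂ z z) = ((‖z‖ ^ 2 : ℝ) : ℂ) := by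
  have h := (stdBasis H).hasSum_inner_mul_inner z z
  have e : (fun i => inner ℂ (stdBasis H i) (InnerProductSpace.rankOne ℂ z z (stdBasis H i))) =
      fun i => inner ℂ z (stdBasis H i) * inner ℂ (stdBasis H i) z := by
    ext i
    simp
  refine ⟨⟨?_, ?_⟩, ?_⟩
  · rw [ContinuousLinearMap.nonneg_iff_isPositive]
    exact InnerProductSpace.isPositive_rankOne_self z
  · rw [e]
    exact h.summable
  · rw [opTrace, e, h.tsum_eq, inner_self_eq_norm_sq_to_K]
    push_cast
    rfl

/-- A quantum operation is bounded on rank-one operators, uniformly over all operations. -/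
theorem norm_apply_rankOne_le {O : (H →L[ℂ] H) →ₗ[ℂ] (H →L[ℂ] H)} (hO : IsQuantumOperation O)
    (x y : H) : ‖O (InnerProductSpace.rankOne ℂ x y)‖ ≤ (‖x‖ + ‖y‖) ^ 2 := by
  have hz : ∀ c : ℂ, ‖c‖ = 1 →
      ‖O (InnerProductSpace.rankOne ℂ (x + c • y) (x + c • y))‖ ≤ (‖x‖ + ‖y‖) ^ 2 := by
    intro c hc
    obtain ⟨h1, h2⟩ := rankOne_self_density (x + c • y)
    obtain ⟨h3, h4⟩ := hO.2 _ h1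
    have h5 := ((nnnorm_le_opTrace h3).trans h4).trans_eq h2
    refine (Complex.real_le_real.1 h5).trans ?_
    gcongr
    refine (norm_add_le _ _).trans ?_
    rw [norm_smul, hc, one_mul]
  have pol : InnerProductSpace.rankOne ℂ x y = (4⁻¹ : ℂ) •
      (InnerProductSpace.rankOne ℂ (x + (1 : ℂ) • y) (x + (1 : ℂ) • y)
      - InnerProductSpace.rankOne ℂ (x + (-1 : ℂ) • y) (x + (-1 : ℂ) • y)
      + Complex.I • InnerProductSpace.rankOne ℂ (x + Complex.I • y) (x + Complex.I • y)
      - Complex.I • InnerProductSpace.rankOne ℂ (x + (-Complex.I) • y) (x + (-Complex.I) • y)) := by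
    ext w
    simp only [smul_apply, sub_apply, add_apply, InnerProductSpace.rankOne_apply, inner_add_left,
      inner_smul_left, map_one, map_neg, Complex.conj_I]
    match_scalars <;> ring_nf <;> simp [Complex.I_sq]
    ring
  have b1 := hz 1 (by simp)
  have b2 := hz (-1) (by simp)
  have b3 := hz Complex.I (by simp)
  have b4 := hz (-Complex.I) (by simp)
  rw [pol, map_smul, map_sub, map_add, map_sub, map_smul, map_smul, norm_smul]
  set A := O (InnerProductSpace.rankOne ℂ (x + (1 : ℂ) • y) (x + (1 : ℂ) • y))
  set B := O (InnerProductSpace.rankOne ℂ (x + (-1 : ℂ) • y) (x + (-1 : ℂ) • y))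
  set C := O (InnerProductSpace.rankOne ℂ (x + Complex.I • y) (x + Complex.I • y))
  set D := O (InnerProductSpace.rankOne ℂ (x + (-Complex.I) • y) (x + (-Complex.I) • y))
  have t1 := norm_sub_le (A - B + Complex.I • C) (Complex.I • D)
  have t2 := norm_add_le (A - B) (Complex.I • C)
  have t3 := norm_sub_le A B
  rw [norm_smul, Complex.norm_I, one_mul] at t1 t2
  have : ‖(4⁻¹ : ℂ)‖ = 4⁻¹ := by norm_num
  rw [this]
  linarith

end Trace

/-! ### Tensor products of quantum operations, and limits of their linear combinations -/

section OpTensor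

variable (H : Type u) [NormedAddCommGroup H] [InnerProductSpace ℂ H] [CompleteSpace H]

/-- The quantum operations on `B(H)`. -/
abbrev QuantumOperation : Type u := {O : (H →L[ℂ] H) →ₗ[ℂ] (H →L[ℂ] H) // IsQuantumOperation O}

/-- The real vector space spanned by the quantum operations. -/
def OpSpace : Type u :=
  ↥(Submodule.span ℝ {O : (H →L[ℂ] H) →ₗ[ℂ] (H →L[ℂ] H) | IsQuantumOperation O})

instance : AddCommGroup (OpSpace H) := inferInstanceAs (AddCommGroup ↥(Submodule.span ℝ _))
instance : Module ℝ (OpSpace H) := inferInstanceAs (Module ℝ ↥(Submodule.span ℝ _))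

variable {H}

/-- The linear map on `B(H)` underlying an element of `OpSpace H`. -/
def OpSpace.toLinear : OpSpace H →ₗ[ℝ] ((H →L[ℂ] H) →ₗ[ℂ] (H →L[ℂ] H)) :=
  Submodule.subtype _

/-- A quantum operation as an element of `OpSpace H`. -/
def OpSpace.of (O : QuantumOperation H) : OpSpace H := ⟨O.1, Submodule.subset_span O.2⟩

variable (H)

/-- The absolutely convex hull of the quantum operations: the unit ball of `OpSpace H`. -/
def opBall : Set (OpSpace H) := absConvexHull ℝ (Set.range OpSpace.of)

theorem absorbent_opBall : Absorbent ℝ (opBall H) := by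
  have hb : Balanced ℝ (opBall H) := balanced_absConvexHull
  have hc : Convex ℝ (opBall H) := convex_absConvexHull
  have key : ∀ O (hO : O ∈ Submodule.span ℝ
      {O : (H →L[ℂ] H) →ₗ[ℂ] (H →L[ℂ] H) | IsQuantumOperation O}),
      ∃ r : ℝ, 0 < r ∧ (⟨O, hO⟩ : OpSpace H) ∈ r • opBall H := by
    intro O hO
    induction hO using Submodule.span_induction with
    | mem O h =>
      exact ⟨1, one_pos, by rw [one_smul]; exact subset_absConvexHull ⟨⟨O, h⟩, rfl⟩⟩
    | zero =>
      refine ⟨1, one_pos, ?_⟩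
      rw [one_smul]
      exact hb.zero_mem ⟨_, subset_absConvexHull ⟨⟨_, isQuantumOperation_id⟩, rfl⟩⟩
    | add O P hO hP ihO ihP =>
      obtain ⟨r, hr, h1⟩ := ihO
      obtain ⟨q, hq, h2⟩ := ihP
      refine ⟨r + q, add_pos hr hq, ?_⟩
      rw [hc.add_smul hr.le hq.le]
      exact Set.add_mem_add h1 h2
    | smul a O hO ih =>
      obtain ⟨r, hr, x, hx, h1⟩ := ih
      refine ⟨r * (|a| + 1), by positivity, (a / (|a| + 1)) • x, ?_, ?_⟩
      · refine hb.smul_mem ?_ hx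
        rw [Real.norm_eq_abs, abs_div, abs_of_pos (by positivity : 0 < |a| + 1)]
        exact div_le_one_of_le₀ (by linarith) (by positivity)
      · have h2 : (⟨a • O, Submodule.smul_mem _ a hO⟩ : OpSpace H) = a • (r • x) := by
          rw [show r • x = (⟨O, hO⟩ : OpSpace H) from h1]
          rfl
        have h3 : |a| + 1 ≠ 0 := by positivity
        change (r * (|a| + 1)) • (a / (|a| + 1)) • x = _
        rw [h2, smul_smul, smul_smul]
        congr 1
        field_simp
  intro O
  obtain ⟨r, hr, h⟩ := key O.1 O.2
  refine Absorbs.of_norm ⟨r, fun c hrc => ?_⟩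
  exact Set.singleton_subset_iff.2 (hb.smul_mono (by rwa [Real.norm_of_nonneg hr.le]) h)

/-- The gauge of `opBall H`. -/
def opSeminorm : Seminorm ℝ (OpSpace H) :=
  gaugeSeminorm balanced_absConvexHull convex_absConvexHull (absorbent_opBall H)

instance : SeminormedAddCommGroup (OpSpace H) :=
  (opSeminorm H).toAddGroupSeminorm.toSeminormedAddCommGroup

instance : NormedSpace ℝ (OpSpace H) := ⟨fun a x => (map_smul_eq_mul (opSeminorm H) a x).le⟩

/-- The `n`-fold tensor power of the quantum operations on `B(H)`: real linear combinations of
`O₁ ⊗ ⋯ ⊗ Oₙ`, together with their limits in the projective tensor norm (the gauge of the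
absolutely convex hull of the products `O₁ ⊗ ⋯ ⊗ Oₙ` of quantum operations). -/
abbrev OpTensor (n : ℕ) : Type u := UniformSpace.Completion (⨂[ℝ] _ : Fin n, OpSpace H)

variable {H}

/-- The elementary tensor `O₁ ⊗ ⋯ ⊗ Oₙ`. -/
def elemTensor {n : ℕ} (O : Fin n → OpSpace H) : OpTensor H n :=
  ((PiTensorProduct.tprod ℝ O : ⨂[ℝ] _ : Fin n, OpSpace H) : OpTensor H n)

/-- The conjugation `X ↦ R X R*` as an element of `OpSpace H`. -/
def conjOp (R : H →L[ℂ] H) : OpSpace H :=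
  ⟨conj R, by
    have h : IsQuantumOperation (conj ((((‖R‖ + 1)⁻¹ : ℝ) : ℂ) • R)) := by
      apply isQuantumOperation_conj
      rw [← NNReal.coe_le_coe, coe_nnnorm, norm_smul, Complex.norm_real, norm_inv,
        Real.norm_of_nonneg (by positivity : 0 ≤ ‖R‖ + 1), NNReal.coe_one, inv_mul_eq_div]
      exact div_le_one_of_le₀ (by linarith) (by positivity)
    have e : conj R = ((‖R‖ + 1) ^ 2) • conj ((((‖R‖ + 1)⁻¹ : ℝ) : ℂ) • R) := by
      ext1 X
      have h0 : ‖R‖ + 1 ≠ 0 := by positivity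
      rw [LinearMap.smul_apply, conj_apply, conj_apply, star_smul, mul_smul_comm, mul_smul_comm,
        smul_mul_assoc, smul_smul, Complex.star_def, Complex.conj_ofReal, ← Complex.ofReal_mul,
        Complex.coe_smul, smul_smul, ← mul_inv, ← sq, mul_inv_cancel₀ (pow_ne_zero 2 h0), one_smul]
    rw [e]
    exact Submodule.smul_mem _ _ (Submodule.subset_span h)⟩

theorem norm_le_of_opBall {f : OpSpace H →ₗ[ℝ] ℂ} {C : ℝ}
    (hf : ∀ O : QuantumOperation H, ‖f (OpSpace.of O)‖ ≤ C) (O : OpSpace H) :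
    ‖f O‖ ≤ C * ‖O‖ := by
  have hC : 0 ≤ C := (norm_nonneg _).trans (hf ⟨_, isQuantumOperation_id⟩)
  have hball : opBall H ⊆ {w | ‖f w‖ ≤ C} := by
    refine absConvexHull_min (Set.range_subset_iff.2 hf) ⟨fun a ha => ?_, ?_⟩
    · rintro _ ⟨w, hw, rfl⟩
      change ‖f (a • w)‖ ≤ C
      rw [map_smul, norm_smul]
      exact (mul_le_mul ha hw (norm_nonneg _) zero_le_one).trans_eq (one_mul C)
    · intro w hw w' hw' a b ha hb hab
      change ‖f (a • w + b • w')‖ ≤ C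
      rw [map_add, map_smul, map_smul]
      refine (norm_add_le _ _).trans ?_
      rw [norm_smul, norm_smul, Real.norm_of_nonneg ha, Real.norm_of_nonneg hb]
      calc a * ‖f w‖ + b * ‖f w'‖ ≤ a * C + b * C := by gcongr <;> assumption
        _ = C := by rw [← add_mul, hab, one_mul]
  refine le_of_forall_pos_le_add fun ε hε => ?_
  have hδ : 0 < ε / (C + 1) := by positivity
  obtain ⟨r, hr, hlt, w, hw, rfl⟩ := exists_lt_of_gauge_lt (absorbent_opBall H)
    (lt_add_of_pos_right (gauge (opBall H) O) hδ)
  have h1 : ‖f (r • w)‖ ≤ r * C := by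
    rw [map_smul, norm_smul, Real.norm_of_nonneg hr.le]
    exact mul_le_mul_of_nonneg_left (hball hw) hr.le
  have h2 : C * (ε / (C + 1)) ≤ ε := by
    rw [mul_div_assoc', div_le_iff₀ (by positivity)]
    nlinarith
  have h3 : r * C ≤ (gauge (opBall H) (r • w) + ε / (C + 1)) * C :=
    mul_le_mul_of_nonneg_right hlt.le hC
  change ‖f (r • w)‖ ≤ C * gauge (opBall H) (r • w) + ε
  linarith

/-- The matrix element `⟨ψ, O(|x⟩⟨y|) χ⟩`, as a functional of `O`. -/
def matrixElement (x y ψ χ : H) : OpSpace H →L[ℝ] ℂ :=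
  LinearMap.mkContinuous
    { toFun := fun O => inner ℂ ψ (OpSpace.toLinear O (InnerProductSpace.rankOne ℂ x y) χ)
      map_add' := fun O P => by simp
      map_smul' := fun r O => by
        simp [inner_smul_right_eq_smul] } ((‖x‖ + ‖y‖) ^ 2 * (‖ψ‖ * ‖χ‖)) <| by
    refine norm_le_of_opBall fun O => ?_
    refine (norm_inner_le_norm _ _).trans ?_
    have h1 := norm_apply_rankOne_le O.2 x y
    have h2 := (O.1 (InnerProductSpace.rankOne ℂ x y)).le_opNorm χ
    calc ‖ψ‖ * ‖O.1 (InnerProductSpace.rankOne ℂ x y) χ‖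
        ≤ ‖ψ‖ * ((‖x‖ + ‖y‖) ^ 2 * ‖χ‖) := by
          gcongr
          exact h2.trans (by gcongr)
      _ = (‖x‖ + ‖y‖) ^ 2 * (‖ψ‖ * ‖χ‖) := by ring

/-- The Choi kernel of an element of the tensor power: on `O₁ ⊗ ⋯ ⊗ Oₙ` it is
`∏ ⟨ψⱼ, Oⱼ(|xⱼ⟩⟨yⱼ|) χⱼ⟩`, and it is extended by linearity and continuity. -/
def choiKernel {n : ℕ} (x y ψ χ : Fin n → H) : OpTensor H n →L[ℝ] ℂ :=
  (PiTensorProduct.liftIsometry ℝ (fun _ : Fin n => OpSpace H) ℂ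
    ((ContinuousMultilinearMap.mkPiAlgebra ℝ (Fin n) ℂ).compContinuousLinearMap
      fun j => matrixElement (x j) (y j) (ψ j) (χ j))).extend
    (UniformSpace.Completion.toComplL (𝕜 := ℝ))

theorem choiKernel_elemTensor {n : ℕ} (x y ψ χ : Fin n → H) (O : Fin n → OpSpace H) :
    choiKernel x y ψ χ (elemTensor O) =
      ∏ j, inner ℂ (ψ j)
        (OpSpace.toLinear (O j) (InnerProductSpace.rankOne ℂ (x j) (y j)) (χ j)) := by
  refine (ContinuousLinearMap.extend_eq _ ?_ ?_ _).trans ?_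
  · exact UniformSpace.Completion.denseRange_coe
  · exact UniformSpace.Completion.isUniformInducing_coe _
  · simp [PiTensorProduct.liftIsometry_apply_apply, matrixElement]

end OpTensor

/-! ### Hilbert space tensor products and von Neumann algebras -/

section HilbertTensor

/-- The Hilbert space tensor product. -/
abbrev HTensor (H : Type u) (K : Type v) [NormedAddCommGroup H] [InnerProductSpace ℂ H]
    [NormedAddCommGroup K] [InnerProductSpace ℂ K] : Type (max u v) :=
  UniformSpace.Completion (H ⊗[ℂ] K)

variable {H : Type u} [NormedAddCommGroup H] [InnerProductSpace ℂ H]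
  {K : Type v} [NormedAddCommGroup K] [InnerProductSpace ℂ K]

/-- The continuous extension of an operator on `H ⊗ K` to the Hilbert space tensor product. -/
def extendOp (A : H ⊗[ℂ] K →L[ℂ] H ⊗[ℂ] K) : HTensor H K →L[ℂ] HTensor H K :=
  ((UniformSpace.Completion.toComplL (𝕜 := ℂ)).comp A).extend
    (UniformSpace.Completion.toComplL (𝕜 := ℂ))

theorem extendOp_coe (A : H ⊗[ℂ] K →L[ℂ] H ⊗[ℂ] K) (z : H ⊗[ℂ] K) :
    extendOp A (z : HTensor H K) = (A z : HTensor H K) :=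
  ContinuousLinearMap.extend_eq _ UniformSpace.Completion.denseRange_coe
    (UniformSpace.Completion.isUniformInducing_coe _) z

/-- The operator `X ⊗ 1`. -/
def ampl (K : Type v) [NormedAddCommGroup K] [InnerProductSpace ℂ K] (X : H →L[ℂ] H) :
    HTensor H K →L[ℂ] HTensor H K :=
  extendOp (X.rTensor K)

/-- The operator `1 ⊗ Y`. -/
def coampl (H : Type u) [NormedAddCommGroup H] [InnerProductSpace ℂ H] (Y : K →L[ℂ] K) :
    HTensor H K →L[ℂ] HTensor H K :=
  extendOp (Y.lTensor H)

/-- The bounded operator `ξ ↦ ξ ⊗ ψ` from `H` to `H ⊗ K`. -/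
def tensorVec (H : Type u) [NormedAddCommGroup H] [InnerProductSpace ℂ H] (ψ : K) :
    H →L[ℂ] HTensor H K :=
  (UniformSpace.Completion.toComplL (𝕜 := ℂ)).comp ((TensorProduct.mkL ℂ H K).flip ψ)

theorem tensorVec_apply (ξ : H) (ψ : K) :
    tensorVec H ψ ξ = ((ξ ⊗ₜ[ℂ] ψ : H ⊗[ℂ] K) : HTensor H K) := rfl

variable [CompleteSpace H] [CompleteSpace K]

/-- The von Neumann algebra generated by a set of operators: the double commutant of the set
together with its adjoints. -/
def vnGenerated (S : Set (H →L[ℂ] H)) : VonNeumannAlgebra H where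
  toStarSubalgebra :=
    StarSubalgebra.centralizer ℂ (StarSubalgebra.centralizer ℂ S : Set (H →L[ℂ] H))
  centralizer_centralizer' := by
    change Set.centralizer (Set.centralizer (SetLike.coe (StarSubalgebra.centralizer ℂ _))) =
      SetLike.coe (StarSubalgebra.centralizer ℂ _)
    rw [StarSubalgebra.coe_centralizer]
    exact Set.centralizer_centralizer_centralizer _

/-- The von Neumann algebra tensor product `A ⊗ B`, generated by the `X ⊗ 1` and `1 ⊗ Y`. -/
def vnTensor (A : VonNeumannAlgebra H) (B : VonNeumannAlgebra K) :
    VonNeumannAlgebra (HTensor H K) :=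
  vnGenerated ((ampl K '' {X | X ∈ A}) ∪ (coampl H '' {Y | Y ∈ B}))

/-- Normal states on a von Neumann algebra: positive unital linear functionals that are continuous
for the ultraweak topology, i.e. of the form `X ↦ ∑ ⟨ξₙ, X ηₙ⟩` with
`∑ ‖ξₙ‖² < ∞` and `∑ ‖ηₙ‖² < ∞`. -/
structure IsNormalState (A : VonNeumannAlgebra H) (μ : A.toStarSubalgebra →ₗ[ℂ] ℂ) : Prop where
  nonneg : ∀ X : A.toStarSubalgebra, 0 ≤ (X : H →L[ℂ] H) → 0 ≤ μ X
  unital : μ 1 = 1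
  normal : ∃ ξ η : ℕ → H, (Summable fun n => ‖ξ n‖ ^ 2) ∧ (Summable fun n => ‖η n‖ ^ 2) ∧
    ∀ X : A.toStarSubalgebra, HasSum (fun n => inner ℂ (ξ n) ((X : H →L[ℂ] H) (η n))) (μ X)

end HilbertTensor

/-! ### Process-tensor axioms -/

section ProcessTensor

variable {H : Type u} [NormedAddCommGroup H] [InnerProductSpace ℂ H] [CompleteSpace H]

/-- The matrix `∑ₗ Aₗ ⊗ vₗ` over the tensor power, read as the map `a ↦ [∑ₗ (Aₗ)_{pq} vₗ(a)]_{pq}`,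
is completely positive: its Choi kernel is positive semidefinite. -/
def IsCompletelyPositiveMatrix {n k L : ℕ} (A : Fin L → Matrix (Fin k) (Fin k) ℂ)
    (v : Fin L → OpTensor H n) : Prop :=
  ∀ (N : ℕ) (z : Fin N → ℂ) (p : Fin N → Fin k) (x ψ : Fin N → Fin n → H),
    0 ≤ ∑ a, ∑ b, star (z a) * z b *
      ∑ l, A l (p a) (p b) * choiKernel (x a) (x b) (ψ a) (ψ b) (v l)

/-- Complete positivity of an element of the tensor power, as a map on `n` systems. -/
def IsCompletelyPositiveElement {n : ℕ} (v : OpTensor H n) : Prop :=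
  IsCompletelyPositiveMatrix (k := 1) (fun _ : Fin 1 => 1) (fun _ => v)

/-- One use of an ancilla: given an operator `ω` on the ancilla, the ancilla operator
`⟨ψ| Φ(ω ⊗ |x⟩⟨y|) |χ⟩`. -/
def ancillaStep {K : Type u} [NormedAddCommGroup K] [InnerProductSpace ℂ K] [CompleteSpace K]
    (Φ : QuantumOperation (HTensor K H)) (x y ψ χ : H) (ω : K →L[ℂ] K) : K →L[ℂ] K :=
  (ContinuousLinearMap.adjoint (tensorVec K ψ)).comp
    ((Φ.1 ((tensorVec K x).comp (ω.comp (ContinuousLinearMap.adjoint (tensorVec K y))))).comp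
      (tensorVec K χ))

/-- The (possibly correlated) sequential quantum operations: those elements of the tensor power
that arise by preparing an ancilla in a state `ρ`, applying at the successive times quantum
operations `Φ₁, …, Φₙ` to ancilla and system, and finally discarding the ancilla. -/
def IsSequentialOperation {n : ℕ} (v : OpTensor H n) : Prop :=
  ∃ (K : Type u) (_ : NormedAddCommGroup K) (_ : InnerProductSpace ℂ K) (_ : CompleteSpace K)
    (ρ : K →L[ℂ] K) (Φ : Fin n → QuantumOperation (HTensor K H)), IsDensity ρ ∧
    ∀ x y ψ χ : Fin n → H, choiKernel x y ψ χ v =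
      opTrace (Fin.foldl n (fun ω j => ancillaStep (Φ j) (x j) (y j) (ψ j) (χ j) ω) ρ)

/-- Given operations at the times of a sub-tuple, insert the identity operation at the others. -/
def insertId {m n : ℕ} (e : Fin m ↪o Fin n) (O : Fin m → QuantumOperation H) :
    Fin n → QuantumOperation H :=
  Function.extend e O fun _ => ⟨LinearMap.id, isQuantumOperation_id⟩

/-- A process tensor for a time tuple `t = (t₁ < ⋯ < tₙ)`, together with the process tensors of all
its sub-tuples `s ⊆ t`. The sub-tuples are indexed by the order embeddings `e : Fin m ↪o Fin n`
(`s = t ∘ e`); `t` itself is the identity embedding. -/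
structure IsProcessTensor {n : ℕ}
    (T : ∀ m : ℕ, (Fin m ↪o Fin n) → OpTensor H m →L[ℝ] (H →L[ℂ] H)) : Prop where
  /-- Completely positive elements are mapped to unnormalised density operators. -/
  density : ∀ (m : ℕ) (e : Fin m ↪o Fin n) (v : OpTensor H m),
    IsCompletelyPositiveElement v → IsUnnormalizedDensity (T m e v)
  /-- The trace bound. -/
  trace_le : ∀ (m : ℕ) (e : Fin m ↪o Fin n) (v : OpTensor H m),
    IsSequentialOperation v → opTrace (T m e v) ≤ 1
  /-- Complete positivity: if `∑ₗ Aₗ ⊗ vₗ` is completely positive, then the operator matrix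
  `∑ₗ Aₗ ⊗ T(vₗ)` is positive. -/
  completelyPositive : ∀ (m : ℕ) (e : Fin m ↪o Fin n) (k L : ℕ)
    (A : Fin L → Matrix (Fin k) (Fin k) ℂ) (v : Fin L → OpTensor H m),
    IsCompletelyPositiveMatrix A v → ∀ φ : Fin k → H,
      0 ≤ ∑ p, ∑ q, ∑ l, A l p q * inner ℂ (φ p) (T m e (v l) (φ q))
  /-- Containment. -/
  containment : ∀ (m l : ℕ) (e : Fin m ↪o Fin n) (f : Fin l ↪o Fin m)
    (O : Fin l → QuantumOperation H),
    T l (f.trans e) (elemTensor fun i => OpSpace.of (O i)) =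
      T m e (elemTensor fun i => OpSpace.of (insertId f O i))

end ProcessTensor

/-! ### Quantum stochastic processes and their correlation kernels -/

section Stoch

variable {Hs : Type u} [NormedAddCommGroup Hs] [InnerProductSpace ℂ Hs] [CompleteSpace Hs]
  {He : Type v} [NormedAddCommGroup He] [InnerProductSpace ℂ He] [CompleteSpace He]

/-- The Heisenberg evolution `V* (X ⊗ 1) V`. -/
def heisenberg (V : HTensor Hs He →L[ℂ] HTensor Hs He) (X : Hs →L[ℂ] Hs) :
    HTensor Hs He →L[ℂ] HTensor Hs He :=
  star V * ampl He X * V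

/-- A system-environment quantum stochastic process over `Bs`, with values in `Bs ⊗ Be`, times
`[0, ∞)`, normal state `μ`, and `j_t(X) = U_t* (X ⊗ 1) U_t` with `U_t` unitary. -/
structure StochasticProc (Bs : VonNeumannAlgebra Hs) (Be : VonNeumannAlgebra He) where
  U : ℝ≥0 → unitary (HTensor Hs He →L[ℂ] HTensor Hs He)
  mem : ∀ t, ∀ X ∈ Bs.toStarSubalgebra, heisenberg (U t).1 X ∈ (vnTensor Bs Be).toStarSubalgebra
  μ : (vnTensor Bs Be).toStarSubalgebra →ₗ[ℂ] ℂ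
  isNormalState : IsNormalState (vnTensor Bs Be) μ

variable {Bs : VonNeumannAlgebra Hs} {Be : VonNeumannAlgebra He}

/-- `j_t(X) = U_t* (X ⊗ 1) U_t`. -/
def StochasticProc.j (Q : StochasticProc Bs Be) (t : ℝ≥0) (X : Bs.toStarSubalgebra) :
    (vnTensor Bs Be).toStarSubalgebra :=
  ⟨heisenberg (Q.U t).1 X.1, Q.mem t X.1 X.2⟩

/-- `j_{tₙ}(aₙ) ⋯ j_{t₁}(a₁)`. -/
def StochasticProc.jProd (Q : StochasticProc Bs Be) {n : ℕ} (t : Fin n → ℝ≥0)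
    (a : Fin n → Bs.toStarSubalgebra) : (vnTensor Bs Be).toStarSubalgebra :=
  (List.ofFn fun i => Q.j (t i) (a i)).reverse.prod

/-- The correlation kernel `μ(j_t(a)* j_t(b))`. -/
def StochasticProc.kernel (Q : StochasticProc Bs Be) {n : ℕ} (t : Fin n → ℝ≥0)
    (a b : Fin n → Bs.toStarSubalgebra) : ℂ :=
  Q.μ (star (Q.jProd t a) * Q.jProd t b)

end Stoch

end
end QSP

/-! The process tensor should let the operations act on the system during the joint unitary
evolution and trace out the environment at the end. To avoid applying an operation to one factor of
an infinite-dimensional product, this is done with finite cut-offs, where everything is a finite sum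
over paths, followed by a weak limit.

The normal state becomes a vector state `z` after tensoring with ℓ² (`IsNormalState.exists_vector`,
resting on the Radon–Nikodym argument `exists_vector_of_nonneg`). The enlarged space `E` is an
orthogonal sum of copies `J γ` of the system space, and the evolution between consecutive times is a
contraction `V k` of `E`. For finite sets of indices γ and of system basis vectors, the projection
onto their span is inserted before and after each operation. The resulting map `cutoff` depends on
an element of `OpTensor` only through finitely many values of its Choi kernel. Complete positivity
is then a congruence of the Choi kernel, and containment holds term by term because all sub-tuples
share the same paths.

The trace bound is the core estimate. In `netOp_posKernel_and_trace_le` the state of ancilla, system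
and environment is an operator matrix indexed by environment and system indices; each operation and
each contraction keeps it positive and does not increase its trace. A one-dimensional ancilla covers
products of operations. As the projective norm is the gauge of these products, the cut-offs are
bounded uniformly, and `exists_weak_limit` gives a limit along an ultrafilter of growing cut-offs.
The axioms survive the limit, the trace bound through finite partial sums.

A weak limit could lose trace, but on conjugations it does not. There the path sums for ket and bra
separate, the cut-off is a reduced vector state, and its vector converges in norm
(`tendsto_pathVec`), so the limit is the exact partial trace. Telescoping the evolutions gives the
formula in terms of μ. Polarization at each time (`StochasticProc.exists_kernel_eq_sum`) writes the
correlation kernel through diagonal terms, which are the traces obtained at X = 1. -/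

namespace QSP

/-! ### Positive functionals as vector functionals -/

section VectorState

variable {A : Type*} [Ring A] [StarRing A] [Algebra ℂ A] [StarModule ℂ A]

/-- The semi-inner product `⟨a, b⟩ = μ (a* b)` of a positive functional. -/
@[reducible] noncomputable def gnsCore (μ : A →ₗ[ℂ] ℂ) (hμ : ∀ a, 0 ≤ μ (star a * a)) :
    PreInnerProductSpace.Core ℂ A where
  inner a b := μ (star a * b)
  conj_inner_symm a b := by
    have h1 := (Complex.le_def.1 (hμ (a + b))).2
    have h2 := (Complex.le_def.1 (hμ (a + Complex.I • b))).2
    have h3 := (Complex.le_def.1 (hμ a)).2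
    have h4 := (Complex.le_def.1 (hμ b)).2
    simp only [star_add, add_mul, mul_add, map_add, star_smul, smul_mul_assoc, mul_smul_comm,
      map_smul, smul_eq_mul, Complex.add_im, Complex.mul_im, Complex.mul_re, Complex.star_def,
      Complex.conj_I, Complex.neg_re, Complex.neg_im, Complex.I_re, Complex.I_im,
      Complex.zero_im] at h1 h2 h3 h4
    apply Complex.ext
    · rw [Complex.conj_re]; linarith
    · rw [Complex.conj_im]; linarith
  re_inner_nonneg a := (Complex.le_def.1 (hμ a)).1
  add_left a b c := by simp [add_mul]
  smul_left a b r := by simp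

variable {E : Type*} [NormedAddCommGroup E] [InnerProductSpace ℂ E] [CompleteSpace E]

/-- A positive functional of the form `a ↦ ⟨ξ, π(a) η⟩` is a vector functional. -/
theorem exists_vector_of_nonneg (π : A →⋆ₐ[ℂ] (E →L[ℂ] E)) (μ : A →ₗ[ℂ] ℂ)
    (hμ : ∀ a, 0 ≤ μ (star a * a)) (ξ η : E) (h : ∀ a, μ a = inner ℂ ξ (π a η)) :
    ∃ z : E, ∀ a, μ a = inner ℂ z (π a z) := by
  have hπ : ∀ a x y, inner ℂ x (π (star a) y) = inner ℂ (π a x) y := fun a x y => by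
    rw [map_star, ContinuousLinearMap.star_eq_adjoint, ContinuousLinearMap.adjoint_inner_right]
  have hπ' : ∀ a x y, inner ℂ (π (star a) x) y = inner ℂ x (π a y) := fun a x y => by
    rw [← hπ, star_star]
  have hmul : ∀ a b x, π (a * b) x = π a (π b x) := fun a b x => by rw [map_mul]; rfl
  -- As μ(a*a) = ⟨π(a)ξ, π(a)η⟩ is real and nonnegative, polarization bounds it by ‖π(a)(ξ + η)‖².
  -- Hence π(a)χ ↦ [a] is a well-defined contraction into the GNS space of μ.
  set χ := ξ + η with hχ
  have hbd : ∀ a, (μ (star a * a)).re ≤ ‖π a χ‖ ^ 2 := by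
    intro a
    rw [h, hmul, hπ, hχ, map_add]
    have h1 := norm_add_sq (𝕜 := ℂ) (π a ξ) (π a η)
    have h2 := norm_sub_sq (𝕜 := ℂ) (π a ξ) (π a η)
    have h3 := hμ a
    rw [h, hmul, hπ, Complex.le_def] at h3
    simp only [RCLike.re_to_complex, Complex.zero_re] at h1 h2 h3
    nlinarith [sq_nonneg ‖π a ξ - π a η‖, h3.1]
  clear_value χ
  let core := gnsCore μ hμ
  let _ : SeminormedAddCommGroup A :=
    @InnerProductSpace.Core.toSeminormedAddCommGroup ℂ A _ _ _ core
  let _ : InnerProductSpace ℂ A := InnerProductSpace.ofCore core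
  have hin : ∀ a b : A, inner ℂ a b = μ (star a * b) := fun a b => rfl
  have hnorm : ∀ a : A, ‖a‖ ^ 2 ≤ ‖π a χ‖ ^ 2 := fun a => by
    rw [← inner_self_eq_norm_sq (𝕜 := ℂ), hin]; exact hbd a
  -- The contraction lives on the cyclic subspace `D` of χ. It is set to zero on the orthogonal
  -- complement, which is also invariant under π, so that its extension `C` is defined on all of
  -- `E`.
  let D : Submodule ℂ E := LinearMap.range
    ((ContinuousLinearMap.apply ℂ E χ).toLinearMap ∘ₗ π.toAlgHom.toLinearMap)
  have hD : ∀ a, π a χ ∈ D := fun a => ⟨a, rfl⟩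
  have hDo : ∀ a, ∀ x ∈ Dᗮ, π a x ∈ Dᗮ := by
    rintro a x hx _ ⟨b, rfl⟩
    change inner ℂ (π b χ) (π a x) = 0
    rw [← hπ', ← hmul]
    exact hx _ (hD _)
  let e : (A × Dᗮ) →ₗ[ℂ] E := LinearMap.coprod
    ((ContinuousLinearMap.apply ℂ E χ).toLinearMap ∘ₗ π.toAlgHom.toLinearMap) Dᗮ.subtype
  have he : ∀ a x, e (a, x) = π a χ + x := fun a x => rfl
  let f : (A × Dᗮ) →ₗ[ℂ] UniformSpace.Completion A :=
    (UniformSpace.Completion.toComplL (𝕜 := ℂ) (E := A)).toLinearMap ∘ₗ LinearMap.fst ℂ A Dᗮ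
  have hf : ∀ a x, f (a, x) = (a : UniformSpace.Completion A) := fun a x => rfl
  have hfe : ∀ p, ‖f p‖ ≤ 1 * ‖e p‖ := by
    rintro ⟨a, x⟩
    rw [hf, he, one_mul, UniformSpace.Completion.norm_coe]
    refine (pow_le_pow_iff_left₀ (norm_nonneg _) (norm_nonneg _) two_ne_zero).1 ?_
    refine (hnorm a).trans ?_
    have := norm_add_sq_eq_norm_sq_add_norm_sq_of_inner_eq_zero (𝕜 := ℂ) (π a χ) (x : E)
      (x.2 _ (hD a))
    nlinarith [norm_nonneg (x : E)]
  have hdense : DenseRange e := by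
    have : (LinearMap.range e).topologicalClosure = ⊤ := by
      rw [Submodule.topologicalClosure_eq_top_iff, LinearMap.range_coprod, Submodule.range_subtype,
        ← Submodule.inf_orthogonal]
      exact Submodule.inf_orthogonal_eq_bot Dᗮ
    exact (Submodule.dense_iff_topologicalClosure_eq_top.2 this)
  let C := f.extendOfNorm e
  have hC : ∀ a x, C (π a χ + (x : Dᗮ)) = (a : UniformSpace.Completion A) := fun a x =>
    LinearMap.extendOfNorm_eq hdense ⟨1, hfe⟩ (a, x)
  -- The Radon–Nikodym derivative of μ. It commutes with π(c), since both orders have matrix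
  -- elements μ(a*cb) on the cyclic subspace; so does its square root `S`, and `S χ` is the vector
  -- sought.
  let T : E →L[ℂ] E := ContinuousLinearMap.adjoint C ∘L C
  have hT : ∀ x y, inner ℂ x (T y) = inner ℂ (C x) (C y) := fun x y =>
    ContinuousLinearMap.adjoint_inner_right C x (C y)
  have hTpos : 0 ≤ T := by
    rw [ContinuousLinearMap.nonneg_iff_isPositive]
    exact ContinuousLinearMap.isPositive_adjoint_comp_self C
  have hcomm : ∀ c, Commute T (π c) := by
    intro c
    have key : ∀ x y, inner ℂ x (T (π c y)) = inner ℂ x (π c (T y)) := by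
      intro x y
      refine hdense.induction_on (p := fun x => inner ℂ x (T (π c y)) = inner ℂ x (π c (T y))) x
        (isClosed_eq (by fun_prop) (by fun_prop)) ?_
      rintro ⟨a, u⟩
      refine hdense.induction_on (p := fun y => inner ℂ (e (a, u)) (T (π c y)) =
        inner ℂ (e (a, u)) (π c (T y))) y (isClosed_eq (by fun_prop) (by fun_prop)) ?_
      rintro ⟨b, v⟩
      rw [← hπ', hT, hT, he, he, map_add (π c), map_add (π (star c)), ← hmul, ← hmul]
      rw [hC, hC b v, hC (c * b) ⟨π c v, hDo _ _ v.2⟩, hC (star c * a) ⟨π (star c) u, hDo _ _ u.2⟩]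
      rw [UniformSpace.Completion.inner_coe, UniformSpace.Completion.inner_coe, hin, hin]
      simp [mul_assoc]
    ext y
    exact ext_inner_left ℂ fun x => key x y
  let S := CFC.sqrt T
  have hS : ∀ c, Commute S (π c) := fun c =>
    (hcomm c).cfcₙ_nnreal NNReal.sqrt
  have hSS : S * S = T := CFC.sqrt_mul_sqrt_self T hTpos
  have hSa : IsSelfAdjoint S := (CFC.sqrt_nonneg T).isSelfAdjoint
  refine ⟨S χ, fun a => ?_⟩
  have h1 : π a (S χ) = S (π a χ) := by
    exact (congrArg (fun B : E →L[ℂ] E => B χ) (hS a).eq).symm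
  rw [h1]
  have h2 : inner ℂ (S χ) (S (π a χ)) = inner ℂ χ (T (π a χ)) := by
    rw [← hSS, mul_apply_eq_comp, ← ContinuousLinearMap.adjoint_inner_right,
      ← ContinuousLinearMap.star_eq_adjoint, hSa.star_eq]
  rw [h2, hT]
  have h3 := hC a 0
  have h4 := hC 1 0
  simp only [map_one, Submodule.coe_zero, add_zero] at h3 h4
  rw [h3]
  erw [h4]
  rw [UniformSpace.Completion.inner_coe, hin, star_one, one_mul]

end VectorState

/-! ### Positive matrices of operators -/

section PosKernel

theorem nonneg_iff_exists_star_mul_self {A : Type*} [CStarAlgebra A] [PartialOrder A]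
    [StarOrderedRing A] {a : A} : 0 ≤ a ↔ ∃ d, a = star d * d :=
  CStarAlgebra.nonneg_iff_eq_star_mul_self

/-- A self-adjoint element of a C⋆-algebra is compressed by its negative part `n` to `-n³`, and it
is positive as soon as `n` vanishes. -/
theorem exists_negPart {A : Type*} [CStarAlgebra A] [PartialOrder A] [StarOrderedRing A]
    {a : A} (ha : IsSelfAdjoint a) :
    ∃ n : A, 0 ≤ n ∧ n * a * n = -(n * n * n) ∧ (n = 0 → 0 ≤ a) := by
  refine ⟨a⁻, CFC.negPart_nonneg a, ?_, fun h => ?_⟩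
  · conv_lhs => enter [1, 2]; rw [← CFC.posPart_sub_negPart a ha]
    rw [mul_sub, CFC.negPart_mul_posPart, zero_sub, neg_mul]
  · exact CStarAlgebra.nonneg_iff_isSelfAdjoint_and_negPart_eq_zero.2 ⟨ha, h⟩

variable {H : Type*} [NormedAddCommGroup H] [InnerProductSpace ℂ H]

/-- Positivity of a matrix of bounded operators. -/
def PosKernel {P : Type*} [Fintype P] (M : P → P → H →L[ℂ] H) : Prop :=
  ∀ g : P → H, 0 ≤ ∑ p, ∑ q, inner ℂ (g p) (M p q (g q))

theorem PosKernel.reindex {P P' : Type*} [Fintype P] [Fintype P'] {M : P → P → H →L[ℂ] H}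
    (hM : PosKernel M) (e : P' ≃ P) : PosKernel fun p q => M (e p) (e q) := by
  intro g
  have := hM (g ∘ e.symm)
  rw [← e.sum_comp] at this
  simp_rw [← e.sum_comp (fun q => inner ℂ ((g ∘ e.symm) (e _)) (M (e _) q ((g ∘ e.symm) q)))] at this
  simpa using this

/-- A complex sesquilinear form with real diagonal is Hermitian, by polarization with 1 and i. This
is applied to columns supported at a single index. -/
theorem PosKernel.inner_symm {P : Type*} [Fintype P] [DecidableEq P] {M : P → P → H →L[ℂ] H}
    (hM : PosKernel M) (p q : P) (x y : H) :
    inner ℂ (M p q x) y = inner ℂ x (M q p y) := by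
  let F : (P → H) → (P → H) → ℂ := fun g h => ∑ p, ∑ q, inner ℂ (g p) (M p q (h q))
  have hl : ∀ g g' h, F (g + g') h = F g h + F g' h := fun g g' h => by
    simp [F, Finset.sum_add_distrib]
  have hr : ∀ g h h', F g (h + h') = F g h + F g h' := fun g h h' => by
    simp [F, Finset.sum_add_distrib]
  have hls : ∀ (c : ℂ) g h, F (c • g) h = (starRingEnd ℂ) c * F g h := fun c g h => by
    simp [F, Finset.sum_mul, mul_comm]
  have hrs : ∀ (c : ℂ) g h, F g (c • h) = c * F g h := fun c g h => by
    simp [F, Finset.mul_sum]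
  have hsymm : ∀ g h, (starRingEnd ℂ) (F g h) = F h g := by
    intro g h
    have h1 := (Complex.le_def.1 (hM (g + h))).2
    have h2 := (Complex.le_def.1 (hM (g + Complex.I • h))).2
    have h3 := (Complex.le_def.1 (hM g)).2
    have h4 := (Complex.le_def.1 (hM h)).2
    change (0 : ℂ).im = (F g g).im at h3
    change (0 : ℂ).im = (F h h).im at h4
    change (0 : ℂ).im = (F (g + h) (g + h)).im at h1
    change (0 : ℂ).im = (F (g + Complex.I • h) (g + Complex.I • h)).im at h2
    simp only [hl, hr, hls, hrs, Complex.add_im, Complex.mul_im, Complex.mul_re,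
      Complex.conj_I, Complex.neg_re, Complex.neg_im, Complex.I_re, Complex.I_im,
      Complex.zero_im] at h1 h2 h3 h4
    apply Complex.ext
    · rw [Complex.conj_re]; linarith
    · rw [Complex.conj_im]; linarith
  have hs : ∀ p q x y, F (Pi.single p x) (Pi.single q y) = inner ℂ x (M p q y) := by
    intro p q x y
    simp only [F]
    rw [Finset.sum_eq_single p, Finset.sum_eq_single q]
    · simp
    · intro b _ hb; simp [Pi.single_eq_of_ne hb]
    · simp
    · intro b _ hb; simp [Pi.single_eq_of_ne hb]
    · simp
  rw [← inner_conj_symm, ← hs, hsymm, hs]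

theorem PosKernel.diag_nonneg {P : Type*} [Fintype P] [DecidableEq P] {M : P → P → H →L[ℂ] H}
    (hM : PosKernel M) (p : P) (x : H) : 0 ≤ inner ℂ x (M p p x) := by
  have := hM (Pi.single p x)
  refine this.trans_eq ?_
  rw [Finset.sum_eq_single p, Finset.sum_eq_single p]
  · simp
  · intro b _ hb; simp [Pi.single_eq_of_ne hb]
  · simp
  · intro b _ hb; simp [Pi.single_eq_of_ne hb]
  · simp

/-- The action of an operator matrix on a column of vectors. -/
def cstarMulVec {P : Type*} [Fintype P] (a : CStarMatrix P P (H →L[ℂ] H)) (g : P → H) : P → H :=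
  fun p => ∑ q, a p q (g q)

theorem cstarMulVec_mul {P : Type*} [Fintype P] (a b : CStarMatrix P P (H →L[ℂ] H)) (g : P → H) :
    cstarMulVec (a * b) g = cstarMulVec a (cstarMulVec b g) := by
  ext p
  simp only [cstarMulVec, CStarMatrix.mul_apply, map_sum, sum_apply]
  rw [Finset.sum_comm]
  rfl

theorem eq_zero_of_cstarMulVec {P : Type*} [Fintype P] [DecidableEq P]
    {a : CStarMatrix P P (H →L[ℂ] H)} (ha : ∀ g, cstarMulVec a g = 0) : a = 0 := by
  ext p q x
  have := congrFun (ha (Pi.single q x)) p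
  simp only [cstarMulVec] at this
  rw [Finset.sum_eq_single q] at this
  · simpa using this
  · intro b _ hb; simp [Pi.single_eq_of_ne hb]
  · simp

theorem sum_inner_cstarMulVec {P : Type*} [Fintype P] (a : CStarMatrix P P (H →L[ℂ] H))
    (g h : P → H) : ∑ p, inner ℂ (g p) (cstarMulVec a h p) =
      ∑ p, ∑ q, inner ℂ (g p) (a p q (h q)) := by
  simp only [cstarMulVec, inner_sum]

variable [CompleteSpace H]

theorem sum_inner_cstarMulVec_star {P : Type*} [Fintype P] (a : CStarMatrix P P (H →L[ℂ] H))
    (g h : P → H) : ∑ p, inner ℂ (g p) (cstarMulVec (star a) h p) =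
      ∑ p, inner ℂ (cstarMulVec a g p) (h p) := by
  simp only [cstarMulVec, inner_sum, sum_inner, CStarMatrix.star_apply,
    ContinuousLinearMap.star_eq_adjoint, ContinuousLinearMap.adjoint_inner_right]
  rw [Finset.sum_comm]

/-- An operator matrix is positive in the C⋆-algebra of matrices iff its quadratic form is. -/
theorem cstarMatrix_nonneg_iff {P : Type*} [Fintype P] [DecidableEq P]
    (a : CStarMatrix P P (H →L[ℂ] H)) : 0 ≤ a ↔ PosKernel fun p q => a p q := by
  have hsq : ∀ (c : CStarMatrix P P (H →L[ℂ] H)) (g : P → H),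
      ∑ p, inner ℂ (g p) (cstarMulVec (star c * c) g p) =
        ((∑ p, ‖cstarMulVec c g p‖ ^ 2 : ℝ) : ℂ) := by
    intro c g
    rw [cstarMulVec_mul, sum_inner_cstarMulVec_star]
    push_cast
    exact Finset.sum_congr rfl fun p _ => inner_self_eq_norm_sq_to_K _
  constructor
  · intro h g
    obtain ⟨c, rfl⟩ := nonneg_iff_exists_star_mul_self.1 h
    rw [← sum_inner_cstarMulVec, hsq]
    exact Complex.zero_le_real.2 (Finset.sum_nonneg fun p _ => sq_nonneg _)
  · intro h
    have hsa : IsSelfAdjoint a := by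
      rw [IsSelfAdjoint]
      ext p q : 2
      rw [CStarMatrix.star_apply, ContinuousLinearMap.star_eq_adjoint]
      congr 1
      refine ((ContinuousLinearMap.eq_adjoint_iff _ _).2 fun x y => ?_).symm
      exact h.inner_symm p q x y
    -- With n = d*d, the form of `a` at `n g` is minus the form of n³ at `g`, that is, minus the
    -- squared norm of `d n g`. Nonnegativity forces d n = 0, so n² = 0.
    obtain ⟨n, hn0, h1, hna⟩ := exists_negPart hsa
    refine hna ?_
    have hnsa : star n = n := hn0.isSelfAdjoint
    obtain ⟨d, hd⟩ := nonneg_iff_exists_star_mul_self.1 hn0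
    have h2 : n * n * n = star (d * n) * (d * n) := by
      rw [star_mul, hnsa, mul_assoc n (star d), ← mul_assoc (star d), ← hd, mul_assoc]
    have h3 : d * n = 0 := by
      refine eq_zero_of_cstarMulVec fun g => ?_
      have h4 := h (cstarMulVec n g)
      rw [← sum_inner_cstarMulVec, ← sum_inner_cstarMulVec_star, hnsa, ← cstarMulVec_mul,
        ← cstarMulVec_mul, h1, h2] at h4
      have h5 : ∑ p, inner ℂ (g p) (cstarMulVec (-(star (d * n) * (d * n))) g p) =
          -((∑ p, ‖cstarMulVec (d * n) g p‖ ^ 2 : ℝ) : ℂ) := by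
        rw [← hsq]
        generalize star (d * n) * (d * n) = m
        simp [cstarMulVec, inner_sum]
      rw [h5] at h4
      have h6 : ∑ p, ‖cstarMulVec (d * n) g p‖ ^ 2 = 0 := by
        refine le_antisymm ?_ (Finset.sum_nonneg fun p _ => sq_nonneg _)
        have := (Complex.le_def.1 h4).1
        simp only [Complex.zero_re, Complex.neg_re, Complex.ofReal_re] at this
        linarith
      ext p
      have := (Finset.sum_eq_zero_iff_of_nonneg fun p _ => sq_nonneg _).1 h6 p (Finset.mem_univ p)
      simpa using this
    have h7 : star n * n = 0 := by
      rw [hnsa]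
      nth_rewrite 1 [hd]
      rw [mul_assoc, h3, mul_zero]
    exact CStarRing.star_mul_self_eq_zero_iff n |>.1 h7

/-- A completely positive map preserves positivity of operator matrices. -/
theorem IsCompletelyPositive.posKernel {O : (H →L[ℂ] H) →ₗ[ℂ] (H →L[ℂ] H)}
    (hO : IsCompletelyPositive O) {P : Type*} [Fintype P] {M : P → P → H →L[ℂ] H}
    (hM : PosKernel M) : PosKernel fun p q => O (M p q) := by
  let e := (Fintype.equivFin P).symm
  have h1 := (cstarMatrix_nonneg_iff
    (CStarMatrix.ofMatrix (Matrix.of fun p q => M (e p) (e q)))).2 (hM.reindex e)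
  have h2 := ((cstarMatrix_nonneg_iff _).1 (hO _ _ h1)).reindex e.symm
  simpa using h2

end PosKernel

/-! ### Extended-valued traces and isometric families -/

section ENNTrace

open scoped MatrixOrder

variable {H : Type*} [NormedAddCommGroup H] [InnerProductSpace ℂ H] [CompleteSpace H]
  {K : Type*} [NormedAddCommGroup K] [InnerProductSpace ℂ K] [CompleteSpace K]
  {G : Type*} [NormedAddCommGroup G] [InnerProductSpace ℂ G] [CompleteSpace G]

/-- The square of the Hilbert-Schmidt norm. -/
noncomputable def hsSq (S : H →L[ℂ] K) : ENNReal :=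
  ∑' i, ((‖S (stdBasis H i)‖₊ ^ 2 : ℝ≥0) : ENNReal)

/-- The trace of a positive operator as an extended nonnegative number. -/
noncomputable def eTrace (A : H →L[ℂ] H) : ENNReal :=
  ∑' i, ENNReal.ofReal (inner ℂ (stdBasis H i) (A (stdBasis H i))).re

/-- Both sides are the double sum of the squared matrix entries of `S`, taken in the two orders. -/
theorem hsSq_adjoint (S : H →L[ℂ] K) : hsSq (ContinuousLinearMap.adjoint S) = hsSq S := by
  simp_rw [hsSq, ← tsum_nnnorm_inner_sq (ContinuousLinearMap.adjoint S _),
    ← tsum_nnnorm_inner_sq (S _)]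
  rw [ENNReal.tsum_comm]
  refine tsum_congr fun i => tsum_congr fun j => ?_
  rw [ContinuousLinearMap.adjoint_inner_right, ← inner_conj_symm, RCLike.nnnorm_conj]

theorem eTrace_adjoint_comp_self (S : H →L[ℂ] K) :
    eTrace (ContinuousLinearMap.adjoint S ∘L S) = hsSq S := by
  refine tsum_congr fun i => ?_
  rw [ContinuousLinearMap.comp_apply, ContinuousLinearMap.adjoint_inner_right,
    inner_self_eq_norm_sq_to_K]
  rw [← ENNReal.ofReal_coe_nnreal]
  congr 1
  norm_cast

theorem eTrace_star_mul_self (S : H →L[ℂ] H) : eTrace (star S * S) = hsSq S :=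
  eTrace_adjoint_comp_self S

theorem exists_eq_adjoint_comp_self {A : H →L[ℂ] H} (hA : 0 ≤ A) :
    ∃ S : H →L[ℂ] H, A = ContinuousLinearMap.adjoint S ∘L S :=
  CStarAlgebra.nonneg_iff_eq_star_mul_self.1 hA

theorem isUnnormalizedDensity_iff {ρ : H →L[ℂ] H} :
    IsUnnormalizedDensity ρ ↔ 0 ≤ ρ ∧ eTrace ρ ≠ ⊤ := by
  refine ⟨fun h => ?_, fun h => ?_⟩
  · obtain ⟨S, rfl⟩ := CStarAlgebra.nonneg_iff_eq_star_mul_self.1 h.1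
    exact ⟨h.1, by rw [eTrace_star_mul_self]; exact (isUnnormalizedDensity_star_mul_self S).1 h⟩
  · obtain ⟨S, rfl⟩ := CStarAlgebra.nonneg_iff_eq_star_mul_self.1 h.1
    rw [eTrace_star_mul_self] at h
    exact (isUnnormalizedDensity_star_mul_self S).2 h.2

theorem IsUnnormalizedDensity.opTrace_eq {ρ : H →L[ℂ] H} (h : IsUnnormalizedDensity ρ) :
    opTrace ρ = ((eTrace ρ).toReal : ℂ) := by
  obtain ⟨S, rfl⟩ := CStarAlgebra.nonneg_iff_eq_star_mul_self.1 h.1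
  rw [eTrace_star_mul_self, opTrace_star_mul_self]
  rfl

/-- In extended values the trace bound also covers positive operators of infinite trace, so no
summability has to be carried through the network. -/
theorem IsQuantumOperation.eTrace_le {O : (H →L[ℂ] H) →ₗ[ℂ] (H →L[ℂ] H)}
    (hO : IsQuantumOperation O) {A : H →L[ℂ] H} (hA : 0 ≤ A) : eTrace (O A) ≤ eTrace A := by
  by_cases h : eTrace A = ⊤
  · rw [h]; exact le_top
  · have hd := isUnnormalizedDensity_iff.2 ⟨hA, h⟩
    obtain ⟨h1, h2⟩ := hO.2 A hd
    rw [h1.opTrace_eq, hd.opTrace_eq, Complex.real_le_real] at h2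
    exact (ENNReal.toReal_le_toReal (isUnnormalizedDensity_iff.1 h1).2 h).1 h2

omit [CompleteSpace H] in
theorem PosKernel.diag_nonneg' {P : Type*} [Fintype P] [DecidableEq P] {M : P → P → H →L[ℂ] H}
    (hM : PosKernel M) (p : P) : 0 ≤ M p p := by
  rw [ContinuousLinearMap.nonneg_iff_isPositive, ContinuousLinearMap.isPositive_iff]
  refine ⟨fun x y => hM.inner_symm p p x y, fun x => ?_⟩
  rw [← inner_conj_symm]
  exact star_nonneg_iff.2 (hM.diag_nonneg p x)

/-- A family of isometries with pairwise orthogonal ranges. -/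
def IsometricFamily {ι : Type*} (L : ι → K →L[ℂ] G) : Prop :=
  (∀ i x y, inner ℂ (L i x) (L i y) = inner ℂ x y) ∧
    ∀ i j, i ≠ j → ∀ x y, inner ℂ (L i x) (L j y) = 0

variable {ι : Type*} {L : ι → K →L[ℂ] G}

theorem IsometricFamily.adjoint_apply [DecidableEq ι] (hL : IsometricFamily L) (i j : ι) (x : K) :
    ContinuousLinearMap.adjoint (L i) (L j x) = if i = j then x else 0 := by
  refine ext_inner_left ℂ fun y => ?_
  rw [ContinuousLinearMap.adjoint_inner_right]
  split_ifs with h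
  · subst h; exact hL.1 i y x
  · rw [hL.2 i j h, inner_zero_right]

variable [Fintype ι]

theorem IsometricFamily.norm_sum_sq [DecidableEq ι] (hL : IsometricFamily L) (x : ι → K) :
    ‖∑ i, L i (x i)‖ ^ 2 = ∑ i, ‖x i‖ ^ 2 := by
  rw [← inner_self_eq_norm_sq (𝕜 := ℂ), sum_inner]
  simp_rw [inner_sum, ← ContinuousLinearMap.adjoint_inner_right, hL.adjoint_apply]
  rw [map_sum]
  refine Finset.sum_congr rfl fun i _ => ?_
  rw [Finset.sum_eq_single i (fun j _ hj => by rw [if_neg hj.symm, inner_zero_right]) (by simp),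
    if_pos rfl, inner_self_eq_norm_sq]

theorem IsometricFamily.inner_sum_adjoint (z : G) :
    inner ℂ z (∑ i, L i (ContinuousLinearMap.adjoint (L i) z)) =
      ((∑ i, ‖ContinuousLinearMap.adjoint (L i) z‖ ^ 2 : ℝ) : ℂ) := by
  rw [inner_sum]
  push_cast
  refine Finset.sum_congr rfl fun i _ => ?_
  rw [← ContinuousLinearMap.adjoint_inner_left]
  exact inner_self_eq_norm_sq_to_K _

/-- Bessel's inequality. -/
theorem IsometricFamily.sum_norm_adjoint_sq_le [DecidableEq ι] (hL : IsometricFamily L) (z : G) :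
    ∑ i, ‖ContinuousLinearMap.adjoint (L i) z‖ ^ 2 ≤ ‖z‖ ^ 2 := by
  have h1 := IsometricFamily.inner_sum_adjoint (L := L) z
  have h2 := hL.norm_sum_sq fun i => ContinuousLinearMap.adjoint (L i) z
  have h3 := norm_inner_le_norm (𝕜 := ℂ) z (∑ i, L i (ContinuousLinearMap.adjoint (L i) z))
  rw [h1, Complex.norm_real, Real.norm_of_nonneg (Finset.sum_nonneg fun i _ => sq_nonneg _),
    ← h2] at h3
  rw [← h2]
  nlinarith [norm_nonneg z, norm_nonneg (∑ i, L i (ContinuousLinearMap.adjoint (L i) z)),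
    sq_nonneg (‖z‖ - ‖∑ i, L i (ContinuousLinearMap.adjoint (L i) z)‖)]

/-- Each trace is the squared Hilbert–Schmidt norm of (L i)* S*. The sum over `i` thus moves inside
a sum over a basis of `G` and can be compared with ‖S* y‖² vector by vector. -/
theorem sum_eTrace_compression (L : ι → K →L[ℂ] G) (S : G →L[ℂ] G) :
    ∑ i, eTrace (ContinuousLinearMap.adjoint (L i) ∘L
      (ContinuousLinearMap.adjoint S ∘L S) ∘L L i) =
    ∑' y, ∑ i, ((‖ContinuousLinearMap.adjoint (L i)
      (ContinuousLinearMap.adjoint S (stdBasis G y))‖₊ ^ 2 : ℝ≥0) : ENNReal) := by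
  rw [Summable.tsum_finsetSum fun _ _ => ENNReal.summable]
  refine Finset.sum_congr rfl fun i _ => ?_
  have : ContinuousLinearMap.adjoint (L i) ∘L (ContinuousLinearMap.adjoint S ∘L S) ∘L L i =
      ContinuousLinearMap.adjoint (S ∘L L i) ∘L (S ∘L L i) := by
    rw [ContinuousLinearMap.adjoint_comp]; rfl
  rw [this, eTrace_adjoint_comp_self, ← hsSq_adjoint, ContinuousLinearMap.adjoint_comp]
  rfl

/-- Compressing a positive operator does not increase the trace. -/
theorem IsometricFamily.sum_eTrace_compression_le [DecidableEq ι] (hL : IsometricFamily L)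
    {N : G →L[ℂ] G} (hN : 0 ≤ N) :
    ∑ i, eTrace (ContinuousLinearMap.adjoint (L i) ∘L N ∘L L i) ≤ eTrace N := by
  obtain ⟨S, rfl⟩ := exists_eq_adjoint_comp_self hN
  rw [sum_eTrace_compression, eTrace_adjoint_comp_self, ← hsSq_adjoint]
  refine ENNReal.tsum_le_tsum fun y => ?_
  rw [← ENNReal.ofNNReal_finsetSum, ENNReal.coe_le_coe, ← NNReal.coe_le_coe]
  push_cast
  exact hL.sum_norm_adjoint_sq_le _

/-- The trace of a positive operator supported on the ranges of the isometries. -/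
theorem IsometricFamily.eTrace_sum_le [DecidableEq ι] (hL : IsometricFamily L)
    {A : ι → ι → K →L[ℂ] K} (hA : 0 ≤ ∑ i, ∑ j, L i ∘L A i j ∘L ContinuousLinearMap.adjoint (L j)) :
    eTrace (∑ i, ∑ j, L i ∘L A i j ∘L ContinuousLinearMap.adjoint (L j)) ≤
      ∑ i, eTrace (A i i) := by
  set N := ∑ i, ∑ j, L i ∘L A i j ∘L ContinuousLinearMap.adjoint (L j) with hN
  have hAN : ∀ i, A i i = ContinuousLinearMap.adjoint (L i) ∘L N ∘L L i := by
    intro i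
    ext x
    simp [hN, hL.adjoint_apply, apply_ite]
  simp_rw [hAN]
  obtain ⟨S, hS⟩ := exists_eq_adjoint_comp_self hA
  -- Since ⟨x, N x⟩ = ‖S x‖², `S` vanishes on vectors orthogonal to all ranges. So S* takes values
  -- in the span of the ranges, where the coordinates (L i)* preserve the norm.
  have hN0 : ∀ x, (∀ i, ContinuousLinearMap.adjoint (L i) x = 0) → S x = 0 := by
    intro x hx
    have h1 : N x = 0 := by simp [hN, hx]
    have h2 : inner ℂ x (N x) = inner ℂ (S x) (S x) := by
      rw [hS, ContinuousLinearMap.comp_apply, ContinuousLinearMap.adjoint_inner_right]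
    rw [h1, inner_zero_right] at h2
    exact inner_self_eq_zero.1 h2.symm
  have hSL : ∀ x, S x = S (∑ i, L i (ContinuousLinearMap.adjoint (L i) x)) := by
    intro x
    rw [← sub_eq_zero, ← map_sub]
    refine hN0 _ fun i => ?_
    simp [hL.adjoint_apply]
  have hz : ∀ y, ContinuousLinearMap.adjoint S y =
      ∑ i, L i (ContinuousLinearMap.adjoint (L i) (ContinuousLinearMap.adjoint S y)) := by
    intro y
    refine ext_inner_left ℂ fun x => ?_
    rw [ContinuousLinearMap.adjoint_inner_right, hSL, map_sum, sum_inner, inner_sum]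
    refine Finset.sum_congr rfl fun i _ => ?_
    rw [← ContinuousLinearMap.adjoint_inner_right, ← ContinuousLinearMap.adjoint_inner_right,
      ContinuousLinearMap.adjoint_inner_left]
  rw [hS, sum_eTrace_compression, eTrace_adjoint_comp_self, ← hsSq_adjoint]
  refine ENNReal.tsum_le_tsum fun y => ?_
  rw [← ENNReal.ofNNReal_finsetSum, ENNReal.coe_le_coe, ← NNReal.coe_le_coe]
  push_cast
  conv_lhs => rw [hz]
  rw [hL.norm_sum_sq]

/-- A contractive scalar matrix does not increase the trace of a positive operator matrix. -/
theorem PosKernel.sum_eTrace_le {P Q : Type*} [Fintype P] [Fintype Q] [DecidableEq P]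
    {A : P → P → K →L[ℂ] K} (hA : PosKernel A) (v : Q → P → ℂ)
    (hv : ∀ c : P → ℂ, ∑ q, ‖∑ p, v q p * c p‖ ^ 2 ≤ ∑ p, ‖c p‖ ^ 2) :
    ∑ q, eTrace (∑ p, ∑ p', (v q p * star (v q p')) • A p p') ≤ ∑ p, eTrace (A p p) := by
  simp only [eTrace]
  rw [← Summable.tsum_finsetSum fun _ _ => ENNReal.summable,
    ← Summable.tsum_finsetSum fun _ _ => ENNReal.summable]
  refine ENNReal.tsum_le_tsum fun m => ?_
  set b := stdBasis K m
  -- The comparison is made for each basis vector `b` separately. Factoring the positive scalar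
  -- matrix as C*C reduces it to `hv` for the conjugated rows of `C`.
  let B : Matrix P P ℂ := Matrix.of fun p p' => inner ℂ b (A p p' b)
  have hB : B.PosSemidef := by
    refine Matrix.PosSemidef.of_dotProduct_mulVec_nonneg ?_ fun x => ?_
    · ext p p'
      simp only [B, Matrix.conjTranspose_apply, Matrix.of_apply, RCLike.star_def, inner_conj_symm]
      exact hA.inner_symm _ _ _ _
    · refine (hA fun p => x p • b).trans_eq ?_
      simp only [B, dotProduct, Matrix.mulVec, Matrix.of_apply, Finset.mul_sum, Pi.star_apply,
        map_smul, inner_smul_left, inner_smul_right, RCLike.star_def]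
      refine Finset.sum_congr rfl fun p _ => Finset.sum_congr rfl fun p' _ => ?_
      ring
  obtain ⟨C, hC⟩ := CStarAlgebra.nonneg_iff_eq_star_mul_self.1 hB.nonneg
  have hBC : ∀ p p', inner ℂ b (A p p' b) = ∑ l, star (C l p) * C l p' := by
    intro p p'
    change B p p' = _
    rw [hC, Matrix.mul_apply]
    rfl
  have h1 : ∀ p, (inner ℂ b (A p p b)).re = ∑ l, ‖C l p‖ ^ 2 := by
    intro p
    rw [hBC, Complex.re_sum]
    refine Finset.sum_congr rfl fun l _ => ?_
    rw [RCLike.star_def, Complex.conj_mul']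
    norm_cast
  have h2 : ∀ q, (inner ℂ b ((∑ p, ∑ p', (v q p * star (v q p')) • A p p') b)).re =
      ∑ l, ‖∑ p, v q p * star (C l p)‖ ^ 2 := by
    intro q
    have : inner ℂ b ((∑ p, ∑ p', (v q p * star (v q p')) • A p p') b) =
        ∑ l, (∑ p, v q p * star (C l p)) * star (∑ p, v q p * star (C l p)) := by
      calc _ = ∑ p, ∑ p', ∑ l, (v q p * star (v q p')) * (star (C l p) * C l p') := by
            simp only [sum_apply, smul_apply, inner_sum, inner_smul_right, hBC, Finset.mul_sum]
        _ = ∑ p, ∑ l, ∑ p', (v q p * star (v q p')) * (star (C l p) * C l p') :=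
            Finset.sum_congr rfl fun p _ => Finset.sum_comm
        _ = ∑ l, ∑ p, ∑ p', (v q p * star (v q p')) * (star (C l p) * C l p') :=
            Finset.sum_comm
        _ = _ := by
            refine Finset.sum_congr rfl fun l _ => ?_
            rw [star_sum, Finset.sum_mul_sum]
            refine Finset.sum_congr rfl fun p _ => Finset.sum_congr rfl fun p' _ => ?_
            rw [star_mul', star_star]
            ring
    rw [this, Complex.re_sum]
    refine Finset.sum_congr rfl fun l _ => ?_
    rw [RCLike.star_def, Complex.mul_conj']
    norm_cast
  simp_rw [h1, h2]
  rw [← ENNReal.ofReal_sum_of_nonneg fun _ _ => by positivity,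
    ← ENNReal.ofReal_sum_of_nonneg fun _ _ => by positivity]
  refine ENNReal.ofReal_le_ofReal ?_
  rw [Finset.sum_comm]
  refine le_of_le_of_eq ?_ Finset.sum_comm
  refine Finset.sum_le_sum fun l _ => (hv fun p => star (C l p)).trans_eq ?_
  simp

end ENNTrace

/-! ### Trace-class operators and linearity of the trace -/

section TraceClass

variable {H : Type*} [NormedAddCommGroup H] [InnerProductSpace ℂ H] [CompleteSpace H]
  {K : Type*} [NormedAddCommGroup K] [InnerProductSpace ℂ K] [CompleteSpace K]

/-- Linear combinations of unnormalised density operators. -/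
def IsTraceClass (A : H →L[ℂ] H) : Prop :=
  A ∈ Submodule.span ℂ {ρ : H →L[ℂ] H | IsUnnormalizedDensity ρ}

theorem IsTraceClass.summable {A : H →L[ℂ] H} (hA : IsTraceClass A) :
    Summable fun i => inner ℂ (stdBasis H i) (A (stdBasis H i)) := by
  induction hA using Submodule.span_induction with
  | mem A h => exact h.2
  | zero => simp
  | add A B _ _ h1 h2 => simpa only [add_apply, inner_add_right] using h1.add h2
  | smul c A _ h => simpa only [smul_apply, inner_smul_right] using h.mul_left c

theorem opTrace_sum_smul {ι : Type*} (s : Finset ι) (c : ι → ℂ) {A : ι → H →L[ℂ] H}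
    (hA : ∀ i, IsTraceClass (A i)) :
    opTrace (∑ i ∈ s, c i • A i) = ∑ i ∈ s, c i * opTrace (A i) := by
  have h := hasSum_sum (s := s) fun i _ => ((hA i).summable.hasSum.mul_left (c i))
  rw [opTrace]
  refine Eq.trans (tsum_congr fun j => ?_) h.tsum_eq
  simp only [sum_apply, smul_apply, inner_sum, inner_smul_right]

theorem IsUnnormalizedDensity.conj {ρ : H →L[ℂ] H} (hρ : IsUnnormalizedDensity ρ)
    (C : H →L[ℂ] K) :
    IsUnnormalizedDensity (C ∘L ρ ∘L ContinuousLinearMap.adjoint C) := by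
  obtain ⟨S, rfl⟩ := exists_eq_adjoint_comp_self hρ.1
  have h1 := (isUnnormalizedDensity_iff.1 hρ).2
  rw [eTrace_adjoint_comp_self, ← hsSq_adjoint] at h1
  have e : C ∘L (ContinuousLinearMap.adjoint S ∘L S) ∘L ContinuousLinearMap.adjoint C =
      ContinuousLinearMap.adjoint (S ∘L ContinuousLinearMap.adjoint C) ∘L
        (S ∘L ContinuousLinearMap.adjoint C) := by
    rw [ContinuousLinearMap.adjoint_comp, ContinuousLinearMap.adjoint_adjoint]; rfl
  rw [e, isUnnormalizedDensity_iff]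
  refine ⟨(ContinuousLinearMap.nonneg_iff_isPositive _).2
    (ContinuousLinearMap.isPositive_adjoint_comp_self _), ?_⟩
  rw [eTrace_adjoint_comp_self, ← hsSq_adjoint, ContinuousLinearMap.adjoint_comp,
    ContinuousLinearMap.adjoint_adjoint]
  refine ne_top_of_le_ne_top
    (ENNReal.mul_ne_top (ENNReal.coe_ne_top (r := ‖C‖₊ ^ 2)) h1) ?_
  rw [hsSq, hsSq, ← ENNReal.tsum_mul_left]
  refine ENNReal.tsum_le_tsum fun i => ?_
  rw [← ENNReal.coe_mul, ENNReal.coe_le_coe, ← mul_pow]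
  exact pow_le_pow_left' (C.le_opNNNorm _) 2

/-- Polarization writes C ρ D* through four operators E ρ E*, each an unnormalised density. -/
theorem IsTraceClass.comp_adjoint {A : H →L[ℂ] H} (hA : IsTraceClass A) (C D : H →L[ℂ] K) :
    IsTraceClass (C ∘L A ∘L ContinuousLinearMap.adjoint D) := by
  induction hA using Submodule.span_induction with
  | mem ρ h =>
    have h4 : C ∘L ρ ∘L ContinuousLinearMap.adjoint D = (4⁻¹ : ℂ) •
        ((C + D) ∘L ρ ∘L ContinuousLinearMap.adjoint (C + D)
        - (C - D) ∘L ρ ∘L ContinuousLinearMap.adjoint (C - D)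
        + Complex.I • ((C + Complex.I • D) ∘L ρ ∘L ContinuousLinearMap.adjoint (C + Complex.I • D))
        - Complex.I • ((C - Complex.I • D) ∘L ρ ∘L
          ContinuousLinearMap.adjoint (C - Complex.I • D))) := by
      ext x
      simp only [map_add, map_sub, map_smulₛₗ, ContinuousLinearMap.comp_apply, smul_apply,
        sub_apply, add_apply, Complex.conj_I, smul_add, smul_sub, smul_smul, neg_smul,
        map_neg, neg_apply]
      match_scalars <;> ring_nf <;> simp [Complex.I_sq]
      all_goals ring_nf
    rw [h4]
    have h5 : ∀ E : H →L[ℂ] K, (E ∘L ρ ∘L ContinuousLinearMap.adjoint E) ∈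
        Submodule.span ℂ {ρ : K →L[ℂ] K | IsUnnormalizedDensity ρ} :=
      fun E => Submodule.subset_span (h.conj E)
    exact Submodule.smul_mem _ _ (Submodule.sub_mem _ (Submodule.add_mem _ (Submodule.sub_mem _
      (h5 _) (h5 _)) (Submodule.smul_mem _ _ (h5 _))) (Submodule.smul_mem _ _ (h5 _)))
  | zero => simp [IsTraceClass]
  | add A B _ _ h1 h2 =>
    simp only [ContinuousLinearMap.add_comp, ContinuousLinearMap.comp_add]
    exact Submodule.add_mem _ h1 h2
  | smul c A _ h =>
    simp only [ContinuousLinearMap.smul_comp, ContinuousLinearMap.comp_smul]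
    exact Submodule.smul_mem _ _ h

theorem IsQuantumOperation.isTraceClass {O : (H →L[ℂ] H) →ₗ[ℂ] (H →L[ℂ] H)}
    (hO : IsQuantumOperation O) {A : H →L[ℂ] H} (hA : IsTraceClass A) : IsTraceClass (O A) := by
  induction hA using Submodule.span_induction with
  | mem ρ h => exact Submodule.subset_span (hO.2 ρ h).1
  | zero => rw [map_zero]; exact Submodule.zero_mem _
  | add A B _ _ h1 h2 => rw [map_add]; exact Submodule.add_mem _ h1 h2
  | smul c A _ h => rw [map_smul]; exact Submodule.smul_mem _ _ h

end TraceClass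

/-! ### One use of an ancilla -/

section Step

variable {H : Type*}
  {K : Type*} [NormedAddCommGroup K] [InnerProductSpace ℂ K] [CompleteSpace K]
  {G : Type*} [NormedAddCommGroup G] [InnerProductSpace ℂ G] [CompleteSpace G]

/-- The ancilla operator `⟨ψ| Φ(ω ⊗ |x⟩⟨y|) |χ⟩` as a function of `ω`, where the Hilbert space `G`
of ancilla and system together is described by the maps `L x : ω ↦ ω ⊗ x`. -/
noncomputable def step (L : H → K →L[ℂ] G) (Φ : QuantumOperation G) (x y ψ χ : H) :
    (K →L[ℂ] K) →ₗ[ℂ] (K →L[ℂ] K) where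
  toFun ω := ContinuousLinearMap.adjoint (L ψ) ∘L
    (Φ.1 (L x ∘L (ω ∘L ContinuousLinearMap.adjoint (L y))) ∘L L χ)
  map_add' ω ω' := by
    simp only [ContinuousLinearMap.add_comp, ContinuousLinearMap.comp_add, map_add]
  map_smul' c ω := by
    simp only [ContinuousLinearMap.smul_comp, ContinuousLinearMap.comp_smul, map_smul,
      RingHom.id_apply]

theorem step_apply (L : H → K →L[ℂ] G) (Φ : QuantumOperation G) (x y ψ χ : H) (ω : K →L[ℂ] K) :
    step L Φ x y ψ χ ω = ContinuousLinearMap.adjoint (L ψ) ∘L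
    (Φ.1 (L x ∘L (ω ∘L ContinuousLinearMap.adjoint (L y))) ∘L L χ) := rfl

theorem IsTraceClass.step {ω : K →L[ℂ] K} (hω : IsTraceClass ω) (L : H → K →L[ℂ] G)
    (Φ : QuantumOperation G) (x y ψ χ : H) : IsTraceClass (step L Φ x y ψ χ ω) := by
  have h := (Φ.2.isTraceClass (hω.comp_adjoint (L x) (L y))).comp_adjoint
    (ContinuousLinearMap.adjoint (L ψ)) (ContinuousLinearMap.adjoint (L χ))
  rwa [ContinuousLinearMap.adjoint_adjoint] at h

theorem isTraceClass_foldl_step {n : ℕ} {ρ : K →L[ℂ] K} (hρ : IsTraceClass ρ)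
    (L : H → K →L[ℂ] G) (Φ : Fin n → QuantumOperation G) (x y ψ χ : Fin n → H) :
    IsTraceClass (Fin.foldl n (fun ω j => QSP.step L (Φ j) (x j) (y j) (ψ j) (χ j) ω) ρ) := by
  induction n with
  | zero => simpa using hρ
  | succ n ih =>
    rw [Fin.foldl_succ_last]
    exact (ih (fun j => Φ j.castSucc) (fun j => x j.castSucc) (fun j => y j.castSucc)
      (fun j => ψ j.castSucc) (fun j => χ j.castSucc)).step _ _ _ _ _ _

end Step

/-! ### Operations on positive operator matrices -/

section PosKernelStep

variable {K : Type*} [NormedAddCommGroup K] [InnerProductSpace ℂ K] [CompleteSpace K]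
  {G : Type*} [NormedAddCommGroup G] [InnerProductSpace ℂ G] [CompleteSpace G]
  {Γ F : Type*} [Fintype Γ] [Fintype F]

omit [Fintype Γ] [Fintype F] in
theorem sum_comm_four {α β M : Type*} [AddCommMonoid M] (s s' : Finset α) (t t' : Finset β)
    (f : α → α → β → β → M) : ∑ a ∈ s, ∑ a' ∈ s', ∑ b ∈ t, ∑ b' ∈ t', f a a' b b' =
      ∑ b ∈ t, ∑ b' ∈ t', ∑ a ∈ s, ∑ a' ∈ s', f a a' b b' := by
  calc _ = ∑ a ∈ s, ∑ b ∈ t, ∑ a' ∈ s', ∑ b' ∈ t', f a a' b b' :=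
        Finset.sum_congr rfl fun a _ => Finset.sum_comm
    _ = ∑ b ∈ t, ∑ a ∈ s, ∑ a' ∈ s', ∑ b' ∈ t', f a a' b b' := Finset.sum_comm
    _ = ∑ b ∈ t, ∑ a ∈ s, ∑ b' ∈ t', ∑ a' ∈ s', f a a' b b' :=
        Finset.sum_congr rfl fun b _ => Finset.sum_congr rfl fun a _ => Finset.sum_comm
    _ = _ := Finset.sum_congr rfl fun b _ => Finset.sum_comm

/-- Here and in the next two lemmas, the form of the new matrix at `g` is the form of the old one at
a linearly transformed column. -/
theorem PosKernel.sum_conj {A : Γ × F → Γ × F → K →L[ℂ] K} (hA : PosKernel A)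
    (L : F → K →L[ℂ] G) : PosKernel fun γ δ => ∑ i, ∑ j,
      L i ∘L A (γ, i) (δ, j) ∘L ContinuousLinearMap.adjoint (L j) := by
  intro g
  refine (hA fun p => ContinuousLinearMap.adjoint (L p.2) (g p.1)).trans_eq ?_
  simp only [Fintype.sum_prod_type, sum_apply, inner_sum, ContinuousLinearMap.comp_apply,
    ContinuousLinearMap.adjoint_inner_left]
  exact Finset.sum_congr rfl fun γ _ => Finset.sum_comm

theorem PosKernel.compression {N : Γ → Γ → G →L[ℂ] G} (hN : PosKernel N) (L : F → K →L[ℂ] G) :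
    PosKernel fun p q : Γ × F => ContinuousLinearMap.adjoint (L p.2) ∘L (N p.1 q.1 ∘L L q.2) := by
  intro g
  refine (hN fun γ => ∑ i, L i (g (γ, i))).trans_eq ?_
  simp only [Fintype.sum_prod_type, sum_inner, inner_sum, map_sum, ContinuousLinearMap.comp_apply,
    ContinuousLinearMap.adjoint_inner_right]
  exact Finset.sum_congr rfl fun γ _ =>
    (Finset.sum_congr rfl fun _ _ => Finset.sum_comm).trans Finset.sum_comm

omit [CompleteSpace K] in
theorem PosKernel.smul_sum {P Q : Type*} [Fintype P] [Fintype Q] {A : P → P → K →L[ℂ] K}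
    (hA : PosKernel A) (v : Q → P → ℂ) :
    PosKernel fun q q' => ∑ p, ∑ p', (v q p * star (v q' p')) • A p p' := by
  intro g
  refine (hA fun p => ∑ q, star (v q p) • g q).trans_eq ?_
  simp only [sum_inner, inner_sum, map_sum, sum_apply, smul_apply, map_smul, inner_smul_left,
    inner_smul_right, RCLike.star_def, RingHomCompTriple.comp_apply, RingHom.id_apply, Finset.mul_sum]
  rw [sum_comm_four, Finset.sum_comm]
  refine Finset.sum_congr rfl fun q _ => Finset.sum_congr rfl fun q' _ =>
    Finset.sum_congr rfl fun p _ => Finset.sum_congr rfl fun p' _ => ?_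
  ring

end PosKernelStep

/-! ### Sums over paths and the trace estimate -/

section Network

universe w₁ w₂

variable {H : Type*} [NormedAddCommGroup H] [InnerProductSpace ℂ H]
  {E : Type*} [NormedAddCommGroup E] [InnerProductSpace ℂ E]
  {Γ F : Type*}

/-- The vector at the end of a path. A path records at each time the environment index and the
system indices before and after the operation. -/
def endVec (J : Γ → H →L[ℂ] E) (e : F → H) (ζ : E) : (n : ℕ) → (Fin n → Γ × F × F) → E
  | 0, _ => ζ
  | n + 1, a => J (a (Fin.last n)).1 (e (a (Fin.last n)).2.2)

/-- The amplitude of a path. -/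
noncomputable def amp (J : Γ → H →L[ℂ] E) (e : F → H) (V : ℕ → E →L[ℂ] E) (ζ : E) :
    (n : ℕ) → (Fin n → Γ × F × F) → ℂ
  | 0, _ => 1
  | n + 1, a => amp J e V ζ n (fun j => a j.castSucc) *
      inner ℂ (J (a (Fin.last n)).1 (e (a (Fin.last n)).2.1))
        (V n (endVec J e ζ n fun j => a j.castSucc))

theorem sum_snoc {S M : Type*} [Fintype S] [AddCommMonoid M] (n : ℕ) (f : (Fin (n + 1) → S) → M) :
    ∑ a, f a = ∑ s, ∑ a : Fin n → S, f (Fin.snoc (α := fun _ => S) a s) := by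
  rw [← (Fin.snocEquiv fun _ => S).sum_comp, Fintype.sum_prod_type]
  rfl

theorem sum_comm_path {Γ F A M : Type*} [AddCommMonoid M] {g : Finset Γ} {s : Finset F}
    {t : Finset A} (f : Γ → F → F → A → Γ → F → F → A → M) :
    ∑ γ ∈ g, ∑ i ∈ s, ∑ i' ∈ s, ∑ a ∈ t, ∑ δ ∈ g, ∑ j ∈ s, ∑ j' ∈ s, ∑ b ∈ t,
      f γ i i' a δ j j' b =
    ∑ γ ∈ g, ∑ i' ∈ s, ∑ δ ∈ g, ∑ j' ∈ s, ∑ i ∈ s, ∑ j ∈ s, ∑ a ∈ t, ∑ b ∈ t,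
      f γ i i' a δ j j' b := by
  refine Finset.sum_congr rfl fun γ _ => ?_
  rw [Finset.sum_comm]
  refine Finset.sum_congr rfl fun i' _ => ?_
  refine (Finset.sum_congr rfl fun i _ => Finset.sum_comm).trans ?_
  rw [Finset.sum_comm]
  refine Finset.sum_congr rfl fun δ _ => ?_
  refine Eq.trans ?_ Finset.sum_comm
  refine Finset.sum_congr rfl fun i _ => ?_
  refine Finset.sum_comm.trans (Eq.trans ?_ Finset.sum_comm)
  exact Finset.sum_congr rfl fun j _ => Finset.sum_comm

/-- A finite family of vectors satisfying Bessel's inequality. -/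
def IsBessel {P : Type*} [Fintype P] (η : P → E) : Prop :=
  ∀ w, ∑ p, ‖inner ℂ (η p) w‖ ^ 2 ≤ ‖w‖ ^ 2

theorem isBessel_of_orthonormal {P : Type*} [Fintype P] {η : P → E} (hη : Orthonormal ℂ η) :
    IsBessel η := fun w => hη.sum_inner_products_le w

/-- Orthonormality is not preserved by the adjoint of a contraction, but Bessel's inequality is;
this lets the test vectors be pulled back through the evolution. -/
theorem IsBessel.adjoint [CompleteSpace E] {P : Type*} [Fintype P] {η : P → E} (hη : IsBessel η)
    {V : E →L[ℂ] E} (hV : ‖V‖ ≤ 1) :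
    IsBessel fun p => ContinuousLinearMap.adjoint V (η p) := by
  intro w
  simp only [ContinuousLinearMap.adjoint_inner_left]
  refine (hη (V w)).trans ?_
  have : ‖V w‖ ≤ ‖w‖ := (V.le_opNorm w).trans (mul_le_of_le_one_left (norm_nonneg _) hV)
  gcongr

theorem orthonormal_prod [DecidableEq Γ] {J : Γ → H →L[ℂ] E} (hJ : IsometricFamily J) {e : F → H}
    (he : Orthonormal ℂ e) : Orthonormal ℂ fun p : Γ × F => J p.1 (e p.2) := by
  classical
  rw [orthonormal_iff_ite]
  rintro ⟨γ, i⟩ ⟨δ, j⟩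
  by_cases h : γ = δ
  · subst h
    simp [hJ.1, orthonormal_iff_ite.1 he i j]
  · simp [hJ.2 γ δ h, h]

variable [Fintype Γ] [Fintype F]
  {K : Type*} [NormedAddCommGroup K] [InnerProductSpace ℂ K] [CompleteSpace K]
  {G : Type*} [NormedAddCommGroup G] [InnerProductSpace ℂ G] [CompleteSpace G]

/-- The ancilla operator that remains after the operations `Φ` are applied along the paths `a`
(ket side) and `b` (bra side). -/
noncomputable def pathOp (e : F → H) (L : H → K →L[ℂ] G) (ρ : K →L[ℂ] K) {n : ℕ}
    (Φ : Fin n → QuantumOperation G) (a b : Fin n → Γ × F × F) : K →L[ℂ] K :=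
  Fin.foldl n (fun ω j => step L (Φ j) (e (a j).2.1) (e (b j).2.1) (e (a j).2.2) (e (b j).2.2) ω) ρ

/-- The state of ancilla, system and environment, compressed to the span of the vectors `η p`. -/
noncomputable def netOp (J : Γ → H →L[ℂ] E) (e : F → H) (V : ℕ → E →L[ℂ] E) (ζ : E)
    (L : H → K →L[ℂ] G) (ρ : K →L[ℂ] K) {n : ℕ} (Φ : Fin n → QuantumOperation G)
    {P : Type*} (η : P → E) (p q : P) : K →L[ℂ] K :=
  ∑ a, ∑ b, ((amp J e V ζ n a * inner ℂ (η p) (endVec J e ζ n a)) *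
    star (amp J e V ζ n b * inner ℂ (η q) (endVec J e ζ n b))) • pathOp e L ρ Φ a b

variable (J : Γ → H →L[ℂ] E) (e : F → H) (V : ℕ → E →L[ℂ] E) (ζ : E) (L : H → K →L[ℂ] G)
  (ρ : K →L[ℂ] K)

omit [CompleteSpace K] in
theorem eTrace_mul_star_smul [CompleteSpace K] (z : ℂ) (ρ : K →L[ℂ] K) :
    eTrace ((z * star z) • ρ) = ENNReal.ofReal (‖z‖ ^ 2) * eTrace ρ := by
  rw [eTrace, eTrace, ← ENNReal.tsum_mul_left]
  refine tsum_congr fun i => ?_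
  rw [← ENNReal.ofReal_mul (by positivity), smul_apply, inner_smul_right, RCLike.star_def,
    Complex.mul_conj']
  congr 1
  rw [← Complex.ofReal_pow, Complex.re_ofReal_mul]

/-- Splitting off the last letter of both paths. The evolution passes to the test vectors as its
adjoint, the last operation acts on the earlier network tested on V*J(e), and the outcome is mixed
by the scalars ⟨η p, J(e)⟩. -/
theorem netOp_succ [CompleteSpace E] {n : ℕ} (Φ : Fin (n + 1) → QuantumOperation G) {P : Type*}
    (η : P → E) (p q : P) :
    netOp J e V ζ L ρ Φ η p q = ∑ s : Γ × F, ∑ r : Γ × F,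
      (inner ℂ (η p) (J s.1 (e s.2)) * star (inner ℂ (η q) (J r.1 (e r.2)))) •
      (ContinuousLinearMap.adjoint (L (e s.2)) ∘L ((Φ (Fin.last n)).1 (∑ i, ∑ j, L (e i) ∘L
        netOp J e V ζ L ρ (fun j => Φ j.castSucc)
          (fun t : Γ × F => ContinuousLinearMap.adjoint (V n) (J t.1 (e t.2))) (s.1, i) (r.1, j) ∘L
        ContinuousLinearMap.adjoint (L (e j))) ∘L L (e r.2))) := by
  have hB : ∀ (s r : Γ × F) (A : F → F → K →L[ℂ] K),
      (ContinuousLinearMap.adjoint (L (e s.2)) ∘L ((Φ (Fin.last n)).1 (∑ i, ∑ j, L (e i) ∘L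
        A i j ∘L ContinuousLinearMap.adjoint (L (e j))) ∘L L (e r.2))) =
      ∑ i, ∑ j, step L (Φ (Fin.last n)) (e i) (e j) (e s.2) (e r.2) (A i j) := by
    intro s r A
    simp only [step_apply, map_sum, ContinuousLinearMap.finsetSum_comp,
      ContinuousLinearMap.comp_finsetSum]
  refine Eq.trans ?_ (Finset.sum_congr rfl fun s _ => Finset.sum_congr rfl fun r _ =>
    congrArg _ (hB s r fun i j => netOp J e V ζ L ρ (fun j => Φ j.castSucc)
      (fun t : Γ × F => ContinuousLinearMap.adjoint (V n) (J t.1 (e t.2))) (s.1, i) (r.1, j)).symm)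
  simp only [netOp, map_sum, map_smul]
  rw [sum_snoc]
  simp only [sum_snoc n (S := Γ × F × F) (M := K →L[ℂ] K)]
  simp only [Fintype.sum_prod_type, Finset.smul_sum]
  rw [sum_comm_path]
  refine Finset.sum_congr rfl fun γ _ => Finset.sum_congr rfl fun i' _ =>
    Finset.sum_congr rfl fun δ _ => Finset.sum_congr rfl fun j' _ =>
    Finset.sum_congr rfl fun i _ => Finset.sum_congr rfl fun j _ =>
    Finset.sum_congr rfl fun a _ => Finset.sum_congr rfl fun b _ => ?_
  rw [smul_smul]
  congr 1
  · simp only [amp, endVec, Fin.snoc_castSucc, Fin.snoc_last,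
      ContinuousLinearMap.adjoint_inner_left, star_mul']
    ring
  · rw [pathOp, Fin.foldl_succ_last]
    simp only [Fin.snoc_castSucc, Fin.snoc_last]
    rfl

variable {J e V L ρ}

omit [Fintype Γ] [Fintype F] in
/-- One use of an operation preserves positivity and does not increase the trace. -/
theorem posKernel_step_and_trace_le [Fintype Γ] [Fintype F] [DecidableEq Γ] [DecidableEq F]
    {L : F → K →L[ℂ] G} (hL : IsometricFamily L) {O : (G →L[ℂ] G) →ₗ[ℂ] (G →L[ℂ] G)}
    (hO : IsQuantumOperation O) {A : Γ × F → Γ × F → K →L[ℂ] K} (hA : PosKernel A)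
    {B : Γ × F → Γ × F → K →L[ℂ] K} (hB : B = fun p q => ContinuousLinearMap.adjoint (L p.2) ∘L
      (O (∑ i, ∑ j, L i ∘L A (p.1, i) (q.1, j) ∘L ContinuousLinearMap.adjoint (L j)) ∘L L q.2)) :
    PosKernel B ∧ ∑ p, eTrace (B p p) ≤ ∑ p, eTrace (A p p) := by
  have hM := hA.sum_conj L
  have hN := hO.1.posKernel hM
  subst hB
  refine ⟨hN.compression L, ?_⟩
  rw [Fintype.sum_prod_type, Fintype.sum_prod_type]
  refine Finset.sum_le_sum fun γ _ => ?_
  -- For each environment index the trace is compared in three stages: compression after the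
  -- operation, the operation itself, and the embedding before it.
  have h1 := hL.sum_eTrace_compression_le (hN.diag_nonneg' γ)
  have h2 := hO.eTrace_le (hM.diag_nonneg' γ)
  have h3 := hL.eTrace_sum_le (A := fun i j => A (γ, i) (γ, j)) (hM.diag_nonneg' γ)
  exact h1.trans (h2.trans h3)

/-- Induction on the number of operations, for all Bessel families at once, because the earlier
network is tested on a different family. `P` is kept in the universe of Γ × F, which indexes that
family. -/
theorem netOp_posKernel_and_trace_le_aux {Γ : Type w₁} {F : Type w₂} [Fintype Γ] [Fintype F]
    {J : Γ → H →L[ℂ] E} {e : F → H} [CompleteSpace E] [DecidableEq Γ] [DecidableEq F]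
    (hJ : IsometricFamily J) (he : Orthonormal ℂ e) (hV : ∀ n, ‖V n‖ ≤ 1)
    (hL : ∀ x y u v, inner ℂ (L x u) (L y v) = inner ℂ x y * inner ℂ u v)
    (hρ : 0 ≤ ρ) {n : ℕ} (Φ : Fin n → QuantumOperation G) {P : Type (max w₁ w₂)} [Fintype P]
    {η : P → E} (hη : IsBessel η) :
    PosKernel (netOp J e V ζ L ρ Φ η) ∧
      ∑ p, eTrace (netOp J e V ζ L ρ Φ η p p) ≤ ENNReal.ofReal (‖ζ‖ ^ 2) * eTrace ρ := by
  have hLe : IsometricFamily fun i => L (e i) := by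
    refine ⟨fun i x y => ?_, fun i j hij x y => ?_⟩
    · rw [hL, orthonormal_iff_ite.1 he, if_pos rfl, one_mul]
    · rw [hL, orthonormal_iff_ite.1 he, if_neg hij, zero_mul]
  induction n generalizing P with
  | zero =>
    have hU : PosKernel fun _ _ : Unit => ρ := fun g => by
      simpa using ((ContinuousLinearMap.nonneg_iff_isPositive ρ).1 hρ).inner_nonneg_right (g ())
    have h0 : netOp J e V ζ L ρ Φ η = fun p q => ∑ _s : Unit, ∑ _r : Unit,
        (inner ℂ (η p) ζ * star (inner ℂ (η q) ζ)) • ρ := by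
      ext1 p; ext1 q
      simp [netOp, amp, endVec, pathOp]
    rw [h0]
    refine ⟨hU.smul_sum fun p _ => inner ℂ (η p) ζ, ?_⟩
    simp only [Finset.univ_unique, Finset.sum_const, Finset.card_singleton, one_smul,
      eTrace_mul_star_smul]
    rw [← Finset.sum_mul, ← ENNReal.ofReal_sum_of_nonneg fun _ _ => by positivity]
    gcongr
    exact hη ζ
  | succ n ih =>
    have hε : IsBessel fun t : Γ × F => ContinuousLinearMap.adjoint (V n) (J t.1 (e t.2)) :=
      (isBessel_of_orthonormal (orthonormal_prod hJ he)).adjoint (hV n)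
    obtain ⟨hA, hAt⟩ := ih (fun j => Φ j.castSucc) hε
    obtain ⟨hB, hBt⟩ := posKernel_step_and_trace_le hLe (Φ (Fin.last n)).2 hA rfl
    have hC := hB.smul_sum fun p s => inner ℂ (η p) (J s.1 (e s.2))
    rw [show netOp J e V ζ L ρ Φ η = _ from
      funext fun q => funext fun q' => netOp_succ J e V ζ L ρ Φ η q q']
    refine ⟨hC, le_trans ?_ (hBt.trans hAt)⟩
    -- The mixing coefficients form a contraction: Bessel's inequality for η is applied to a
    -- combination of the orthonormal vectors J(e), whose norm is that of the coefficients.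
    refine hB.sum_eTrace_le _ fun c => ?_
    have h1 := hη (∑ s : Γ × F, c s • J s.1 (e s.2))
    have h2 : ‖∑ s : Γ × F, c s • J s.1 (e s.2)‖ ^ 2 = ∑ s, ‖c s‖ ^ 2 := by
      rw [← inner_self_eq_norm_sq (𝕜 := ℂ), (orthonormal_prod hJ he).inner_sum, map_sum]
      refine Finset.sum_congr rfl fun s _ => ?_
      rw [RCLike.conj_mul]
      norm_cast
    rw [h2] at h1
    refine le_trans (le_of_eq ?_) h1
    refine Finset.sum_congr rfl fun q _ => ?_
    simp only [inner_sum, inner_smul_right, mul_comm]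

/-- The compressed states are positive, and their trace is at most the trace of the input. -/
theorem netOp_posKernel_and_trace_le [CompleteSpace E] [DecidableEq Γ] [DecidableEq F]
    (hJ : IsometricFamily J) (he : Orthonormal ℂ e) (hV : ∀ n, ‖V n‖ ≤ 1)
    (hL : ∀ x y u v, inner ℂ (L x u) (L y v) = inner ℂ x y * inner ℂ u v)
    (hρ : 0 ≤ ρ) {n : ℕ} (Φ : Fin n → QuantumOperation G) {P : Type*} [Fintype P] {η : P → E}
    (hη : IsBessel η) :
    PosKernel (netOp J e V ζ L ρ Φ η) ∧
      ∑ p, eTrace (netOp J e V ζ L ρ Φ η p p) ≤ ENNReal.ofReal (‖ζ‖ ^ 2) * eTrace ρ := by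
  let f : ULift (Fin (Fintype.card P)) ≃ P := Equiv.ulift.trans (Fintype.equivFin P).symm
  have hη' : IsBessel (η ∘ f) := fun w =>
    (f.sum_comp fun p => ‖inner ℂ (η p) w‖ ^ 2).trans_le (hη w)
  obtain ⟨h1, h2⟩ := netOp_posKernel_and_trace_le_aux ζ hJ he hV hL hρ Φ hη'
  refine ⟨?_, ?_⟩
  · have h3 : (fun p q => netOp J e V ζ L ρ Φ (η ∘ f) (f.symm p) (f.symm q)) =
        netOp J e V ζ L ρ Φ η := by
      ext1 p; ext1 q
      simp only [netOp, Function.comp_apply, Equiv.apply_symm_apply]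
    exact h3 ▸ h1.reindex f.symm
  · rw [← f.sum_comp]
    exact h2

end Network

/-! ### Iterated maps that are scalar outside a sub-tuple -/

section Insert

theorem foldl_smul_start {S W : Type*} [AddCommGroup W] [Module ℂ W] (f : S → W →ₗ[ℂ] W)
    (l : List S) (z : ℂ) (w : W) :
    l.foldl (fun w s => f s w) (z • w) = z • l.foldl (fun w s => f s w) w := by
  induction l generalizing w with
  | nil => rfl
  | cons s l ih => rw [List.foldl_cons, List.foldl_cons, map_smul, ih]

theorem foldl_filter_smul {S W : Type*} [AddCommGroup W] [Module ℂ W] (f : S → W →ₗ[ℂ] W)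
    (p : S → Prop) [DecidablePred p] (c : S → ℂ) (hc : ∀ s, ¬ p s → ∀ w, f s w = c s • w)
    (l : List S) (w : W) :
    l.foldl (fun w s => f s w) w = (l.map fun s => if p s then 1 else c s).prod •
      (l.filter p).foldl (fun w s => f s w) w := by
  induction l generalizing w with
  | nil => simp
  | cons s l ih =>
    by_cases h : p s
    · simp [h, ih]
    · rw [List.foldl_cons, hc s h, foldl_smul_start, ih]
      simp [h, smul_smul]

theorem filter_finRange_mem_range {m n : ℕ} (ε : Fin m ↪o Fin n)
    [DecidablePred fun j => j ∈ Set.range ε] :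
    (List.finRange n).filter (fun j => j ∈ Set.range ε) = (List.finRange m).map ε := by
  refine List.Perm.eq_of_pairwise' (r := (· < ·)) ?_ ?_ ?_
  · exact (List.pairwise_lt_finRange n).filter _
  · exact (List.pairwise_map.2 ((List.pairwise_lt_finRange m).imp fun h => ε.lt_iff_lt.2 h))
  · refine (List.perm_ext_iff_of_nodup ((List.nodup_finRange n).filter _)
      ((List.nodup_finRange m).map ε.injective)).2 fun j => ?_
    simp

/-- Scalar factors may be pulled out of an iterated application of linear maps. -/
theorem fin_foldl_eq_smul {m n : ℕ} (ε : Fin m ↪o Fin n) [DecidablePred fun j => j ∈ Set.range ε]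
    {W : Type*} [AddCommGroup W] [Module ℂ W]
    (f : Fin n → W →ₗ[ℂ] W) (c : Fin n → ℂ)
    (hc : ∀ j, j ∉ Set.range ε → ∀ w, f j w = c j • w) (w : W) :
    Fin.foldl n (fun w j => f j w) w = (∏ j, if j ∈ Set.range ε then 1 else c j) •
      Fin.foldl m (fun w i => f (ε i) w) w := by
  rw [Fin.foldl_eq_foldl_finRange, Fin.foldl_eq_foldl_finRange,
    foldl_filter_smul f (fun j => j ∈ Set.range ε) c hc, filter_finRange_mem_range, List.foldl_map,
    ← List.ofFn_eq_map, List.prod_ofFn]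

end Insert

/-! ### Insertion of identity operations -/

section InsertWeight

variable {H : Type*} [NormedAddCommGroup H] [InnerProductSpace ℂ H]

open Classical in
/-- The contribution of the times outside a sub-tuple to the amplitude of a path. -/
noncomputable def insertWeight {m n : ℕ} (ε : Fin m ↪o Fin n) (x ψ : Fin n → H) : ℂ :=
  ∏ j, if j ∈ Set.range ε then 1 else inner ℂ (ψ j) (x j)

-- The identity has Choi kernel ⟨ψ, x⟩⟨y, χ⟩, a ket factor times a bra factor. Inserting it
-- therefore only reweights each path separately.
open Classical in
theorem insertWeight_mul_star {m n : ℕ} (ε : Fin m ↪o Fin n) (x y ψ χ : Fin n → H) :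
    insertWeight ε x ψ * star (insertWeight ε y χ) =
      ∏ j, if j ∈ Set.range ε then 1 else inner ℂ (ψ j) (x j) * inner ℂ (y j) (χ j) := by
  rw [insertWeight, insertWeight, star_prod, ← Finset.prod_mul_distrib]
  refine Finset.prod_congr rfl fun j _ => ?_
  split_ifs <;> simp

/-- The case of `fin_foldl_eq_smul` in which the maps are multiplications by scalars on ℂ. -/
theorem prod_insert {m n : ℕ} (ε : Fin m ↪o Fin n) [DecidablePred fun j => j ∈ Set.range ε]
    (c : Fin n → ℂ) :
    (∏ j, if j ∈ Set.range ε then 1 else c j) * ∏ i, c (ε i) = ∏ j, c j := by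
  have := fin_foldl_eq_smul ε (fun j => LinearMap.mulLeft ℂ (c j)) c (fun j _ w => rfl) (1 : ℂ)
  have h : ∀ (k : ℕ) (d : Fin k → ℂ),
      Fin.foldl k (fun w j => LinearMap.mulLeft ℂ (d j) w) (1 : ℂ) = ∏ j, d j := by
    intro k d
    induction k with
    | zero => simp
    | succ k ih =>
      rw [Fin.foldl_succ_last, ih (fun j => d j.castSucc), Fin.prod_univ_castSucc]
      simp [mul_comm]
  rw [h m fun i => c (ε i)] at this
  exact this.symm.trans (h n c)

variable [CompleteSpace H]

theorem insertId_apply {m n : ℕ} (ε : Fin m ↪o Fin n) (O : Fin m → QuantumOperation H) (i : Fin m) :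
    insertId ε O (ε i) = O i :=
  ε.injective.extend_apply O _ i

theorem insertId_of_notMem {m n : ℕ} (ε : Fin m ↪o Fin n) (O : Fin m → QuantumOperation H)
    {j : Fin n} (hj : j ∉ Set.range ε) : insertId ε O j = ⟨LinearMap.id, isQuantumOperation_id⟩ :=
  Function.extend_apply' _ _ _ hj

theorem insertId_trans {l m n : ℕ} (f : Fin l ↪o Fin m) (ε : Fin m ↪o Fin n)
    (O : Fin l → QuantumOperation H) :
    insertId (f.trans ε) O = insertId ε (insertId f O) := by
  funext j
  by_cases h : j ∈ Set.range ε
  · obtain ⟨i, rfl⟩ := h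
    rw [insertId_apply]
    by_cases h' : i ∈ Set.range f
    · obtain ⟨k, rfl⟩ := h'
      rw [insertId_apply]
      exact insertId_apply (f.trans ε) O k
    · rw [insertId_of_notMem f O h', insertId_of_notMem]
      rintro ⟨k, hk⟩
      exact h' ⟨k, ε.injective hk⟩
  · rw [insertId_of_notMem ε _ h, insertId_of_notMem]
    rintro ⟨k, hk⟩
    exact h ⟨f k, hk⟩

/-- The Choi kernel of a product of operations, with identity operations inserted. -/
theorem insertWeight_mul_choiKernel {m n : ℕ} (ε : Fin m ↪o Fin n) (O : Fin m → QuantumOperation H)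
    (x y ψ χ : Fin n → H) :
    insertWeight ε x ψ * star (insertWeight ε y χ) *
      choiKernel (x ∘ ε) (y ∘ ε) (ψ ∘ ε) (χ ∘ ε) (elemTensor fun i => OpSpace.of (O i)) =
    ∏ j, inner ℂ (ψ j) ((insertId ε O j).1 (InnerProductSpace.rankOne ℂ (x j) (y j)) (χ j)) := by
  classical
  rw [insertWeight_mul_star, choiKernel_elemTensor, ← prod_insert ε fun j => inner ℂ (ψ j)
    ((insertId ε O j).1 (InnerProductSpace.rankOne ℂ (x j) (y j)) (χ j))]
  congr 1
  · refine Finset.prod_congr rfl fun j _ => ?_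
    split_ifs with h
    · rfl
    · rw [insertId_of_notMem ε O h]
      simp [mul_comm]
  · refine Finset.prod_congr rfl fun i _ => ?_
    rw [insertId_apply]
    rfl

end InsertWeight

/-! ### Trivial ancillas, and ancillas with idle times -/

section PathOp

variable {H : Type*} [NormedAddCommGroup H] [InnerProductSpace ℂ H] [CompleteSpace H]

theorem adjoint_toSpanSingleton_apply (y w : H) :
    ContinuousLinearMap.adjoint (ContinuousLinearMap.toSpanSingleton ℂ y) w = inner ℂ y w := by
  refine ext_inner_left ℂ fun v => ?_
  rw [ContinuousLinearMap.adjoint_inner_right]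
  simp [inner_smul_left, mul_comm]

/-- With ancilla ℂ, joint space `H` and embeddings c ↦ c x, one step multiplies by a matrix element
of the operation. Products of operations thus fall under the same estimate as sequential operations.
-/
theorem step_toSpanSingleton (Φ : QuantumOperation H) (x y ψ χ : H) (c : ℂ) :
    step (fun x : H => ContinuousLinearMap.toSpanSingleton ℂ x) Φ x y ψ χ
      (c • ContinuousLinearMap.id ℂ ℂ) =
    (c * inner ℂ ψ (Φ.1 (InnerProductSpace.rankOne ℂ x y) χ)) • ContinuousLinearMap.id ℂ ℂ := by
  have h1 : ContinuousLinearMap.toSpanSingleton ℂ x ∘L ((ContinuousLinearMap.id ℂ ℂ) ∘L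
      ContinuousLinearMap.adjoint (ContinuousLinearMap.toSpanSingleton ℂ y)) =
      InnerProductSpace.rankOne ℂ x y := by
    ext w
    simp [adjoint_toSpanSingleton_apply]
  rw [map_smul, step_apply, h1]
  ext
  simp [adjoint_toSpanSingleton_apply]

theorem foldl_step_toSpanSingleton {n : ℕ} (Φ : Fin n → QuantumOperation H)
    (x y ψ χ : Fin n → H) :
    Fin.foldl n (fun ω j => step (fun x : H => ContinuousLinearMap.toSpanSingleton ℂ x) (Φ j)
      (x j) (y j) (ψ j) (χ j) ω) (ContinuousLinearMap.id ℂ ℂ) =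
    (∏ j, inner ℂ (ψ j) ((Φ j).1 (InnerProductSpace.rankOne ℂ (x j) (y j)) (χ j))) •
      ContinuousLinearMap.id ℂ ℂ := by
  induction n with
  | zero => simp
  | succ n ih =>
    rw [Fin.foldl_succ_last, ih (fun j => Φ j.castSucc) (fun j => x j.castSucc)
      (fun j => y j.castSucc) (fun j => ψ j.castSucc) (fun j => χ j.castSucc),
      step_toSpanSingleton, Fin.prod_univ_castSucc]

theorem isDensity_id_complex : IsDensity (ContinuousLinearMap.id ℂ ℂ) := by
  have h : InnerProductSpace.rankOne ℂ (1 : ℂ) (1 : ℂ) = ContinuousLinearMap.id ℂ ℂ := by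
    ext; simp
  obtain ⟨h1, h2⟩ := rankOne_self_density (1 : ℂ)
  rw [h] at h1 h2
  exact ⟨h1, by simpa using h2⟩

omit [CompleteSpace H] in
theorem foldl_step_insertId {K : Type*} [NormedAddCommGroup K] [InnerProductSpace ℂ K]
    [CompleteSpace K] {G : Type*} [NormedAddCommGroup G] [InnerProductSpace ℂ G] [CompleteSpace G]
    {L : H → K →L[ℂ] G}
    (hL : ∀ x y u v, inner ℂ (L x u) (L y v) = inner ℂ x y * inner ℂ u v)
    {m n : ℕ} (ε : Fin m ↪o Fin n) (Φ : Fin m → QuantumOperation G) (x y ψ χ : Fin n → H)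
    (ρ : K →L[ℂ] K) :
    Fin.foldl n (fun ω j => step L (insertId ε Φ j) (x j) (y j) (ψ j) (χ j) ω) ρ =
      (insertWeight ε x ψ * star (insertWeight ε y χ)) •
      Fin.foldl m (fun ω i => step L (Φ i) (x (ε i)) (y (ε i)) (ψ (ε i)) (χ (ε i)) ω) ρ := by
  classical
  have hadj : ∀ x y u, ContinuousLinearMap.adjoint (L x) (L y u) = (inner ℂ x y : ℂ) • u := by
    intro x y u
    refine ext_inner_left ℂ fun v => ?_
    rw [ContinuousLinearMap.adjoint_inner_right, hL, inner_smul_right]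
  rw [insertWeight_mul_star, fin_foldl_eq_smul ε _
    (fun j => inner ℂ (ψ j) (x j) * inner ℂ (y j) (χ j))]
  · simp only [insertId_apply]
  · intro j hj ω
    rw [insertId_of_notMem ε Φ hj, step_apply]
    ext u
    simp [hadj, smul_smul, mul_comm]

end PathOp

/-! ### The cut-off process tensor -/

section Approx

variable {H : Type*} [NormedAddCommGroup H] [InnerProductSpace ℂ H] [CompleteSpace H]
  {E : Type*} [NormedAddCommGroup E] [InnerProductSpace ℂ E] [CompleteSpace E]
  {Γ F : Type*} [Fintype Γ] [Fintype F]

/-- The weight of a path, with identity operations inserted outside a sub-tuple. -/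
noncomputable def pathWeight (J : Γ → H →L[ℂ] E) (e : F → H) (V : ℕ → E →L[ℂ] E) (ζ : E) {m n : ℕ}
    (ε : Fin m ↪o Fin n) (a : Fin n → Γ × F × F) : ℂ :=
  amp J e V ζ n a * insertWeight ε (fun j => e (a j).2.1) (fun j => e (a j).2.2)

/-- The Choi kernel along a pair of paths. -/
noncomputable def pathChoi (e : F → H) {m n : ℕ} (ε : Fin m ↪o Fin n) (a b : Fin n → Γ × F × F) :
    OpTensor H m →L[ℝ] ℂ :=
  choiKernel (fun i => e (a (ε i)).2.1) (fun i => e (b (ε i)).2.1)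
    (fun i => e (a (ε i)).2.2) (fun i => e (b (ε i)).2.2)

/-- The process tensor cut off to finitely many basis vectors, as a sum over paths. -/
noncomputable def cutoff (J : Γ → H →L[ℂ] E) (e : F → H) (V : ℕ → E →L[ℂ] E) (ζ : E) {m n : ℕ}
    (ε : Fin m ↪o Fin n) : OpTensor H m →L[ℝ] (H →L[ℂ] H) :=
  ∑ γ, ∑ a, ∑ b, (pathChoi e ε a b).smulRight
    ((pathWeight J e V ζ ε a * star (pathWeight J e V ζ ε b)) •
      InnerProductSpace.rankOne ℂ (ContinuousLinearMap.adjoint (J γ) (endVec J e ζ n a))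
        (ContinuousLinearMap.adjoint (J γ) (endVec J e ζ n b)))

variable (J : Γ → H →L[ℂ] E) (e : F → H) (V : ℕ → E →L[ℂ] E) (ζ : E) {m n : ℕ}
  (ε : Fin m ↪o Fin n)

theorem cutoff_apply (v : OpTensor H m) : cutoff J e V ζ ε v =
    ∑ γ, ∑ a, ∑ b, (pathChoi e ε a b v *
    (pathWeight J e V ζ ε a * star (pathWeight J e V ζ ε b))) •
      InnerProductSpace.rankOne ℂ (ContinuousLinearMap.adjoint (J γ) (endVec J e ζ n a))
        (ContinuousLinearMap.adjoint (J γ) (endVec J e ζ n b)) := by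
  simp [cutoff, smul_smul, sum_apply]

theorem inner_cutoff (v : OpTensor H m) (φ φ' : H) : inner ℂ φ (cutoff J e V ζ ε v φ') =
    ∑ γ, ∑ a, ∑ b, (pathWeight J e V ζ ε a * inner ℂ (J γ φ) (endVec J e ζ n a)) *
      star (pathWeight J e V ζ ε b * inner ℂ (J γ φ') (endVec J e ζ n b)) * pathChoi e ε a b v := by
  rw [cutoff_apply]
  simp only [sum_apply, smul_apply, inner_sum, inner_smul_right, InnerProductSpace.rankOne_apply,
    ContinuousLinearMap.adjoint_inner_left, ContinuousLinearMap.adjoint_inner_right]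
  refine Finset.sum_congr rfl fun γ _ => Finset.sum_congr rfl fun a _ =>
    Finset.sum_congr rfl fun b _ => ?_
  simp only [star_mul', RCLike.star_def, inner_conj_symm]
  ring

omit [Fintype F] [Fintype Γ] in
theorem IsCompletelyPositiveMatrix.sum_nonneg {k M : ℕ} {A : Fin M → Matrix (Fin k) (Fin k) ℂ}
    {v : Fin M → OpTensor H m} (hA : IsCompletelyPositiveMatrix A v) {X : Type*} [Fintype X]
    (z : X → ℂ) (p : X → Fin k) (x ψ : X → Fin m → H) :
    0 ≤ ∑ a, ∑ b, star (z a) * z b *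
      ∑ l, A l (p a) (p b) * choiKernel (x a) (x b) (ψ a) (ψ b) (v l) := by
  let f := (Fintype.equivFin X).symm
  refine (hA _ (z ∘ f) (p ∘ f) (x ∘ f) (ψ ∘ f)).trans_eq ?_
  rw [← f.sum_comp]
  refine Finset.sum_congr rfl fun a _ => ?_
  rw [← f.sum_comp]
  rfl

/-- Complete positivity of the cut-off process tensor. -/
theorem cutoff_completelyPositive {k M : ℕ} {A : Fin M → Matrix (Fin k) (Fin k) ℂ}
    {v : Fin M → OpTensor H m} (hA : IsCompletelyPositiveMatrix A v) (φ : Fin k → H) :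
    0 ≤ ∑ p, ∑ q, ∑ l, A l p q * inner ℂ (φ p) (cutoff J e V ζ ε (v l) (φ q)) := by
  have h : ∀ γ, 0 ≤ ∑ p, ∑ q, ∑ l, ∑ a, ∑ b, A l p q *
      ((pathWeight J e V ζ ε a * inner ℂ (J γ (φ p)) (endVec J e ζ n a)) *
      star (pathWeight J e V ζ ε b * inner ℂ (J γ (φ q)) (endVec J e ζ n b)) *
      pathChoi e ε a b (v l)) := by
    intro γ
    -- For fixed γ this is the Choi form at points (row index, path), with the conjugated path
    -- amplitudes as coefficients.
    refine (hA.sum_nonneg (X := Fin k × (Fin n → Γ × F × F))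
      (fun s => star (pathWeight J e V ζ ε s.2 * inner ℂ (J γ (φ s.1)) (endVec J e ζ n s.2)))
      (fun s => s.1) (fun s i => e (s.2 (ε i)).2.1) (fun s i => e (s.2 (ε i)).2.2)).trans_eq ?_
    simp only [Fintype.sum_prod_type, star_star, Finset.mul_sum]
    refine Finset.sum_congr rfl fun p _ => ?_
    rw [Finset.sum_comm]
    refine Finset.sum_congr rfl fun q _ => ?_
    calc _ = ∑ a, ∑ l, ∑ b, _ := Finset.sum_congr rfl fun a _ => Finset.sum_comm
      _ = ∑ l, ∑ a, ∑ b, _ := Finset.sum_comm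
      _ = _ := by
        refine Finset.sum_congr rfl fun l _ => Finset.sum_congr rfl fun a _ =>
          Finset.sum_congr rfl fun b _ => ?_
        rw [pathChoi]
        ring
  refine (Finset.sum_nonneg (s := Finset.univ) fun γ _ => h γ).trans_eq ?_
  simp only [inner_cutoff, Finset.mul_sum]
  rw [Finset.sum_comm]
  refine Finset.sum_congr rfl fun p _ => ?_
  rw [Finset.sum_comm]
  refine Finset.sum_congr rfl fun q _ => ?_
  rw [Finset.sum_comm]

variable {J e V}

/-- The cut-off process tensor is positive and does not increase the trace, for elements whose Choi
kernel arises from operations on an ancilla and the system. -/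
theorem sum_inner_cutoff_mem [DecidableEq Γ] [DecidableEq F]
    {K : Type*} [NormedAddCommGroup K] [InnerProductSpace ℂ K] [CompleteSpace K]
    {G : Type*} [NormedAddCommGroup G] [InnerProductSpace ℂ G] [CompleteSpace G]
    {L : H → K →L[ℂ] G} {ρ : K →L[ℂ] K}
    (hJ : IsometricFamily J) (he : Orthonormal ℂ e) (hV : ∀ n, ‖V n‖ ≤ 1)
    (hL : ∀ x y u v, inner ℂ (L x u) (L y v) = inner ℂ x y * inner ℂ u v)
    (hρ : IsDensity ρ) (Φ : Fin n → QuantumOperation G) {v : OpTensor H m}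
    (hv : ∀ a b : Fin n → Γ × F × F,
      insertWeight ε (fun j => e (a j).2.1) (fun j => e (a j).2.2) *
      star (insertWeight ε (fun j => e (b j).2.1) (fun j => e (b j).2.2)) *
      pathChoi e ε a b v = opTrace (pathOp e L ρ Φ a b))
    {I : Type*} [Fintype I] [DecidableEq I] {φ : I → H} (hφ : Orthonormal ℂ φ) :
    ∃ r : ℝ, 0 ≤ r ∧ r ≤ ‖ζ‖ ^ 2 ∧ ∑ i, inner ℂ (φ i) (cutoff J e V ζ ε v (φ i)) = r := by
  -- Testing on the vectors `J γ (φ i)`, the sum over γ traces out the environment and the sum over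
  -- `i` the system; the remaining ancilla trace is the Choi kernel.
  have hη := isBessel_of_orthonormal (orthonormal_prod hJ hφ)
  obtain ⟨h1, h2⟩ := netOp_posKernel_and_trace_le ζ hJ he hV hL hρ.1.1 Φ hη
  have hρ1 : eTrace ρ = 1 := by
    have h3 := hρ.1.opTrace_eq
    rw [hρ.2] at h3
    have h4 : (eTrace ρ).toReal = 1 := by exact_mod_cast h3.symm
    rw [← ENNReal.toReal_one] at h4
    exact (ENNReal.toReal_eq_toReal_iff' (isUnnormalizedDensity_iff.1 hρ.1).2 ENNReal.one_ne_top).1 h4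
  rw [hρ1, mul_one] at h2
  have htop : ∀ p, eTrace (netOp J e V ζ L ρ Φ (fun p : Γ × I => J p.1 (φ p.2)) p p) ≠ ⊤ :=
    fun p => ne_top_of_le_ne_top ENNReal.ofReal_ne_top
      ((Finset.single_le_sum (fun _ _ => zero_le) (Finset.mem_univ p)).trans h2)
  have htr : ∀ p : Γ × I, ((eTrace (netOp J e V ζ L ρ Φ
      (fun p : Γ × I => J p.1 (φ p.2)) p p)).toReal : ℂ) =
      ∑ a, ∑ b, ((amp J e V ζ n a * inner ℂ (J p.1 (φ p.2)) (endVec J e ζ n a)) *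
      star (amp J e V ζ n b * inner ℂ (J p.1 (φ p.2)) (endVec J e ζ n b))) *
        opTrace (pathOp e L ρ Φ a b) := by
    intro p
    have hd := isUnnormalizedDensity_iff.2 ⟨h1.diag_nonneg' p, htop p⟩
    rw [← hd.opTrace_eq, netOp, ← Fintype.sum_prod_type', ← Fintype.sum_prod_type',
      opTrace_sum_smul]
    exact fun s => isTraceClass_foldl_step (Submodule.subset_span hρ.1) _ _ _ _ _ _
  refine ⟨(∑ p, eTrace (netOp J e V ζ L ρ Φ (fun p : Γ × I => J p.1 (φ p.2)) p p)).toReal,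
    ENNReal.toReal_nonneg, ENNReal.toReal_le_of_le_ofReal (by positivity) h2, ?_⟩
  rw [ENNReal.toReal_sum fun p _ => htop p]
  push_cast
  simp only [htr, inner_cutoff, Fintype.sum_prod_type]
  rw [Finset.sum_comm]
  refine Finset.sum_congr rfl fun γ _ => Finset.sum_congr rfl fun i _ =>
    Finset.sum_congr rfl fun a _ => Finset.sum_congr rfl fun b _ => ?_
  rw [← hv]
  simp only [pathWeight, star_mul']
  ring

end Approx

/-! ### Norm bounds from products of operations -/

section Gauge

variable {H : Type*} [NormedAddCommGroup H] [InnerProductSpace ℂ H] [CompleteSpace H]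

/-- The slots are freed one at a time: with the others fixed, `norm_le_of_opBall` passes from
operations to all of `OpSpace`. The set `s` holds the slots already freed. -/
theorem MultilinearMap.norm_le_of_quantumOperation {m : ℕ}
    (g : MultilinearMap ℝ (fun _ : Fin m => OpSpace H) ℂ) {C : ℝ}
    (hg : ∀ O : Fin m → QuantumOperation H, ‖g fun i => OpSpace.of (O i)‖ ≤ C)
    (w : Fin m → OpSpace H) : ‖g w‖ ≤ C * ∏ i, ‖w i‖ := by
  have key : ∀ (s : Finset (Fin m)) (O : Fin m → QuantumOperation H),
      ‖g (s.piecewise w fun i => OpSpace.of (O i))‖ ≤ C * ∏ i ∈ s, ‖w i‖ := by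
    intro s
    induction s using Finset.induction_on with
    | empty => intro O; simpa using hg O
    | insert i s hi ih =>
      intro O
      have h := norm_le_of_opBall (f := g.toLinearMap
        (s.piecewise w fun i => OpSpace.of (O i)) i) (C := C * ∏ i ∈ s, ‖w i‖) (fun P => ?_) (w i)
      · rw [Finset.prod_insert hi, Finset.piecewise_insert, mul_comm ‖w i‖, ← mul_assoc]
        exact h
      · refine le_trans (le_of_eq ?_) (ih (Function.update O i P))
        rw [MultilinearMap.toLinearMap_apply]
        congr 2
        funext j
        rcases eq_or_ne j i with rfl | hj
        · simp [hi]
        · rw [Function.update_of_ne hj]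
          by_cases hjs : j ∈ s <;> simp [hjs, hj]
  have h := key Finset.univ fun _ => ⟨_, isQuantumOperation_id⟩
  rwa [Finset.piecewise_univ] at h

/-- A functional that is bounded on products of quantum operations is bounded. -/
theorem norm_le_of_elemTensor {m : ℕ} {f : OpTensor H m →L[ℝ] ℂ} {C : ℝ}
    (hf : ∀ O : Fin m → QuantumOperation H, ‖f (elemTensor fun i => OpSpace.of (O i))‖ ≤ C)
    (v : OpTensor H m) : ‖f v‖ ≤ C * ‖v‖ := by
  have hC : 0 ≤ C := (norm_nonneg _).trans (hf fun _ => ⟨_, isQuantumOperation_id⟩)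
  induction v using UniformSpace.Completion.induction_on with
  | hp => exact isClosed_le (by fun_prop) (by fun_prop)
  | ih t =>
    let f' : (⨂[ℝ] _ : Fin m, OpSpace H) →ₗ[ℝ] ℂ :=
      (f.comp (UniformSpace.Completion.toComplL (𝕜 := ℝ))).toLinearMap
    let g := (PiTensorProduct.lift (R := ℝ) (s := fun _ : Fin m => OpSpace H)).symm f'
    have hg : ∀ w, ‖g w‖ ≤ C * ∏ i, ‖w i‖ := by
      refine MultilinearMap.norm_le_of_quantumOperation g fun O => ?_
      exact hf O
    have h1 := PiTensorProduct.norm_eval_le_projectiveSeminorm (g.mkContinuous C hg) t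
    have h2 : PiTensorProduct.lift (g.mkContinuous C hg).toMultilinearMap t = f t := by
      have : (g.mkContinuous C hg).toMultilinearMap = g := rfl
      rw [this, LinearEquiv.apply_symm_apply]
      rfl
    rw [h2] at h1
    refine h1.trans ?_
    rw [UniformSpace.Completion.norm_coe]
    exact mul_le_mul_of_nonneg_right (g.mkContinuous_norm_le hC hg) (norm_nonneg _)

/-- The matrix entry `⟨φ, A φ'⟩` of an operator. -/
noncomputable def matrixEntry (φ φ' : H) : (H →L[ℂ] H) →L[ℝ] ℂ :=
  ((innerSL ℂ φ).comp (ContinuousLinearMap.apply ℂ H φ')).restrictScalars ℝ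

omit [CompleteSpace H] in
theorem matrixEntry_apply (φ φ' : H) (A : H →L[ℂ] H) : matrixEntry φ φ' A = inner ℂ φ (A φ') := rfl

theorem nonneg_and_norm_le_of_inner_mem {T : H →L[ℂ] H} {C : ℝ} (hC : 0 ≤ C)
    (h : ∀ x : H, ‖x‖ = 1 → ∃ r : ℝ, 0 ≤ r ∧ r ≤ C ∧ inner ℂ x (T x) = r) : 0 ≤ T ∧ ‖T‖ ≤ C := by
  have h' : ∀ x : H, ∃ r : ℝ, 0 ≤ r ∧ r ≤ C * ‖x‖ ^ 2 ∧ inner ℂ x (T x) = r := by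
    intro x
    rcases eq_or_ne x 0 with rfl | hx
    · exact ⟨0, le_rfl, by simp, by simp⟩
    · obtain ⟨r, h0, h1, h2⟩ := h (((‖x‖⁻¹ : ℝ) : ℂ) • x) (by
        rw [norm_smul, Complex.norm_real, norm_inv, norm_norm,
          inv_mul_cancel₀ (norm_ne_zero_iff.2 hx)])
      have hx' : ‖x‖ ≠ 0 := norm_ne_zero_iff.2 hx
      refine ⟨r * ‖x‖ ^ 2, by positivity, by gcongr, ?_⟩
      push_cast
      rw [← h2, map_smul, inner_smul_left, inner_smul_right, Complex.conj_ofReal]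
      push_cast
      field_simp
  have hpos : ∀ {S : H →L[ℂ] H}, (∀ x, ∃ r : ℝ, 0 ≤ r ∧ inner ℂ x (S x) = r) → 0 ≤ S := by
    intro S hS
    rw [ContinuousLinearMap.nonneg_iff_isPositive, ContinuousLinearMap.isPositive_iff_complex]
    intro x
    obtain ⟨r, h0, h1⟩ := hS x
    rw [← inner_conj_symm, h1]
    simpa using h0
  have hT : 0 ≤ T := hpos fun x => by
    obtain ⟨r, h0, -, h2⟩ := h' x
    exact ⟨r, h0, h2⟩
  refine ⟨hT, (CStarAlgebra.norm_le_iff_le_algebraMap T hC hT).2 (sub_nonneg.1 (hpos fun x => ?_))⟩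
  obtain ⟨r, h0, h1, h2⟩ := h' x
  refine ⟨C * ‖x‖ ^ 2 - r, sub_nonneg.2 h1, ?_⟩
  rw [sub_apply, inner_sub_right, h2, Algebra.algebraMap_eq_smul_one, smul_apply, one_apply_eq_self,
    inner_smul_right_eq_smul, inner_self_eq_norm_sq_to_K]
  simp

omit [CompleteSpace H] in
theorem inner_tensorVec {K : Type*} [NormedAddCommGroup K] [InnerProductSpace ℂ K] (x y : H)
    (u v : K) : inner ℂ (tensorVec K x u) (tensorVec K y v) = inner ℂ x y * inner ℂ u v := by
  rw [tensorVec_apply, tensorVec_apply, UniformSpace.Completion.inner_coe,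
    TensorProduct.inner_tmul, mul_comm]

end Gauge

theorem IsTraceClass.opTrace_smul {H : Type*} [NormedAddCommGroup H] [InnerProductSpace ℂ H]
    [CompleteSpace H] {A : H →L[ℂ] H} (hA : IsTraceClass A) (c : ℂ) :
    opTrace (c • A) = c * opTrace A := by
  simpa using opTrace_sum_smul {()} (fun _ : Unit => c) fun _ => hA

/-! ### Bounds uniform in the cut-off -/

section Bounds

universe u

variable {H : Type u} [NormedAddCommGroup H] [InnerProductSpace ℂ H] [CompleteSpace H]
  {E : Type*} [NormedAddCommGroup E] [InnerProductSpace ℂ E] [CompleteSpace E]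
  {Γ F : Type*} [Fintype Γ] [Fintype F] [DecidableEq Γ] [DecidableEq F]
  {J : Γ → H →L[ℂ] E} {e : F → H} {V : ℕ → E →L[ℂ] E} (ζ : E) {m n : ℕ} (ε : Fin m ↪o Fin n)

theorem sum_inner_cutoff_elemTensor_mem (hJ : IsometricFamily J) (he : Orthonormal ℂ e)
    (hV : ∀ n, ‖V n‖ ≤ 1) (O : Fin m → QuantumOperation H)
    {I : Type*} [Fintype I] [DecidableEq I] {φ : I → H} (hφ : Orthonormal ℂ φ) :
    ∃ r : ℝ, 0 ≤ r ∧ r ≤ ‖ζ‖ ^ 2 ∧ ∑ i, inner ℂ (φ i)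
      (cutoff J e V ζ ε (elemTensor fun i => OpSpace.of (O i)) (φ i)) = r := by
  refine sum_inner_cutoff_mem (L := fun x : H => ContinuousLinearMap.toSpanSingleton ℂ x) ζ ε
    hJ he hV (fun x y u v => ?_) isDensity_id_complex (insertId ε O) (fun a b => ?_) hφ
  · simp
    ring
  · rw [pathOp, foldl_step_toSpanSingleton,
      IsTraceClass.opTrace_smul (Submodule.subset_span isDensity_id_complex.1),
      isDensity_id_complex.2, mul_one]
    exact insertWeight_mul_choiKernel ε O _ _ _ _

theorem sum_inner_cutoff_sequential_mem (hJ : IsometricFamily J) (he : Orthonormal ℂ e)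
    (hV : ∀ n, ‖V n‖ ≤ 1) {v : OpTensor H m} (hv : IsSequentialOperation v)
    {I : Type*} [Fintype I] [DecidableEq I] {φ : I → H} (hφ : Orthonormal ℂ φ) :
    ∃ r : ℝ, 0 ≤ r ∧ r ≤ ‖ζ‖ ^ 2 ∧ ∑ i, inner ℂ (φ i) (cutoff J e V ζ ε v (φ i)) = r := by
  obtain ⟨K, _, _, _, ρ, Φ, hρ, hΦ⟩ := hv
  refine sum_inner_cutoff_mem (L := fun x : H => tensorVec K x) ζ ε
    hJ he hV inner_tensorVec hρ (insertId ε Φ) (fun a b => ?_) hφ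
  rw [pathOp, foldl_step_insertId inner_tensorVec]
  rw [IsTraceClass.opTrace_smul
    (isTraceClass_foldl_step (Submodule.subset_span hρ.1) _ _ _ _ _ _), pathChoi, hΦ]
  rfl

/-- The bound involves only ζ and `v`, neither the cut-off nor the number of vectors φ. It is what
makes the trace finite in the limit. -/
theorem norm_sum_inner_cutoff_le (hJ : IsometricFamily J) (he : Orthonormal ℂ e)
    (hV : ∀ n, ‖V n‖ ≤ 1) (v : OpTensor H m)
    {I : Type*} [Fintype I] [DecidableEq I] {φ : I → H} (hφ : Orthonormal ℂ φ) :
    ‖∑ i, inner ℂ (φ i) (cutoff J e V ζ ε v (φ i))‖ ≤ ‖ζ‖ ^ 2 * ‖v‖ := by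
  have h := norm_le_of_elemTensor (C := ‖ζ‖ ^ 2)
    (f := ∑ i, (matrixEntry (φ i) (φ i)).comp (cutoff J e V ζ ε)) (fun O => ?_) v
  · simpa [sum_apply, matrixEntry_apply] using h
  · obtain ⟨r, h0, h1, h2⟩ := sum_inner_cutoff_elemTensor_mem ζ ε hJ he hV O hφ
    simp only [sum_apply, ContinuousLinearMap.comp_apply, matrixEntry_apply, h2,
      Complex.norm_real, Real.norm_of_nonneg h0, h1]

/-- On products the cut-off is a positive operator, so testing on single unit vectors bounds its
norm by ‖ζ‖²; the gauge extends this to all `v`. -/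
theorem norm_inner_cutoff_le (hJ : IsometricFamily J) (he : Orthonormal ℂ e)
    (hV : ∀ n, ‖V n‖ ≤ 1) (v : OpTensor H m) (φ φ' : H) :
    ‖inner ℂ φ (cutoff J e V ζ ε v φ')‖ ≤ ‖ζ‖ ^ 2 * ‖v‖ * ‖φ‖ * ‖φ'‖ := by
  have h := norm_le_of_elemTensor (C := ‖φ‖ * (‖ζ‖ ^ 2 * ‖φ'‖))
    (f := (matrixEntry φ φ').comp (cutoff J e V ζ ε)) (fun O => ?_) v
  · exact h.trans_eq (by ring)
  · refine (norm_inner_le_norm _ _).trans ?_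
    refine mul_le_mul_of_nonneg_left ?_ (norm_nonneg φ)
    refine (ContinuousLinearMap.le_opNorm (cutoff J e V ζ ε _) φ').trans ?_
    refine mul_le_mul_of_nonneg_right ?_ (norm_nonneg φ')
    refine (nonneg_and_norm_le_of_inner_mem (sq_nonneg ‖ζ‖) fun x hx => ?_).2
    obtain ⟨r, h0, h1, h2⟩ := sum_inner_cutoff_elemTensor_mem ζ ε hJ he hV O
      (φ := fun _ : Unit => x) (by simp [hx])
    exact ⟨r, h0, h1, by simpa using h2⟩

-- All sub-tuples use paths over the full `n` times, with the identities absorbed into the path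
-- weights. Containment hence holds exactly for each cut-off, term by term.
omit [DecidableEq Γ] [DecidableEq F] in
theorem cutoff_insertId (J : Γ → H →L[ℂ] E) (e : F → H) (V : ℕ → E →L[ℂ] E) (ζ : E) {l : ℕ}
    (f : Fin l ↪o Fin m) (O : Fin l → QuantumOperation H) :
    cutoff J e V ζ (f.trans ε) (elemTensor fun i => OpSpace.of (O i)) =
      cutoff J e V ζ ε (elemTensor fun i => OpSpace.of (insertId f O i)) := by
  rw [cutoff_apply, cutoff_apply]
  refine Finset.sum_congr rfl fun γ _ => Finset.sum_congr rfl fun a _ =>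
    Finset.sum_congr rfl fun b _ => ?_
  congr 1
  have h1 := insertWeight_mul_choiKernel (f.trans ε) O (fun j => e (a j).2.1) (fun j => e (b j).2.1)
    (fun j => e (a j).2.2) (fun j => e (b j).2.2)
  have h2 := insertWeight_mul_choiKernel ε (insertId f O) (fun j => e (a j).2.1)
    (fun j => e (b j).2.1) (fun j => e (a j).2.2) (fun j => e (b j).2.2)
  rw [insertId_trans, ← h2] at h1
  have h3 := congrArg (fun z => z * (amp J e V ζ n a * star (amp J e V ζ n b))) h1
  simp only [pathWeight, star_mul', pathChoi]
  refine Eq.trans ?_ (h3.trans ?_)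
  · simp only [Function.comp_def]
    ring
  · simp only [Function.comp_def]
    ring

end Bounds

/-! ### Weak operator limits along ultrafilters -/

section WeakLimit

variable {H : Type*} [NormedAddCommGroup H] [InnerProductSpace ℂ H] [CompleteSpace H]

theorem exists_tendsto_ultrafilter {ι : Type*} (𝒰 : Ultrafilter ι) {f : ι → ℂ} {C : ℝ}
    (hf : ∀ i, ‖f i‖ ≤ C) : ∃ l, Filter.Tendsto f 𝒰 (nhds l) := by
  obtain ⟨l, -, hl⟩ := (isCompact_closedBall (0 : ℂ) C).ultrafilter_le_nhds (𝒰.map f)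
    (Filter.le_principal_iff.2 (Filter.mem_map.2 (Filter.Eventually.of_forall fun i => by simpa using hf i)))
  exact ⟨l, hl⟩

/-- Weak operator compactness, for bounded families of maps into `B(H)`. -/
theorem exists_weak_limit {ι : Type*} (𝒰 : Ultrafilter ι) {W : Type*} [SeminormedAddCommGroup W]
    [NormedSpace ℝ W] (T : ι → W →L[ℝ] (H →L[ℂ] H)) {C : ℝ}
    (hT : ∀ i v φ φ', ‖inner ℂ φ (T i v φ')‖ ≤ C * ‖v‖ * ‖φ‖ * ‖φ'‖) :
    ∃ S : W →L[ℝ] (H →L[ℂ] H), ∀ v φ φ',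
      Filter.Tendsto (fun i => inner ℂ φ (T i v φ')) 𝒰 (nhds (inner ℂ φ (S v φ'))) := by
  choose l hl using fun v φ φ' => exists_tendsto_ultrafilter 𝒰 fun i => hT i v φ φ'
  have hu : ∀ {f : ι → ℂ} {a b : ℂ}, Filter.Tendsto f 𝒰 (nhds a) →
      Filter.Tendsto f 𝒰 (nhds b) → a = b := fun h h' => tendsto_nhds_unique h h'
  have hn : ∀ v φ φ', ‖l v φ φ'‖ ≤ C * ‖v‖ * ‖φ‖ * ‖φ'‖ := fun v φ φ' =>
    le_of_tendsto' (hl v φ φ').norm fun i => hT i v φ φ'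
  let B : W → (H →L⋆[ℂ] H →L[ℂ] ℂ) := fun v => LinearMap.mkContinuous₂
    (LinearMap.mk₂'ₛₗ (starRingEnd ℂ) (RingHom.id ℂ) (l v)
      (fun x y z => hu (hl _ _ _) (by simpa only [inner_add_left] using (hl v x z).add (hl v y z)))
      (fun c x z => hu (hl _ _ _)
        (by simpa only [inner_smul_left, smul_eq_mul] using (hl v x z).const_mul (starRingEnd ℂ c)))
      (fun x y z => hu (hl _ _ _)
        (by simpa only [map_add, inner_add_right] using (hl v x y).add (hl v x z)))
      (fun c x z => hu (hl _ _ _)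
        (by simpa only [map_smul, inner_smul_right, smul_eq_mul, RingHom.id_apply] using
          (hl v x z).const_mul c)))
    (C * ‖v‖) (hn v)
  let A : W → H →L[ℂ] H := fun v =>
    ContinuousLinearMap.adjoint (InnerProductSpace.continuousLinearMapOfBilin (B v))
  have hA : ∀ v φ φ', inner ℂ φ (A v φ') = l v φ φ' := fun v φ φ' => by
    rw [ContinuousLinearMap.adjoint_inner_right,
      InnerProductSpace.continuousLinearMapOfBilin_apply]
    rfl
  let S : W →ₗ[ℝ] (H →L[ℂ] H) :=
    { toFun := A
      map_add' := fun v w => by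
        ext φ'
        refine ext_inner_left ℂ fun φ => ?_
        rw [add_apply, inner_add_right, hA, hA, hA]
        exact hu (hl _ _ _) (by
          simpa only [map_add, add_apply, inner_add_right] using (hl v φ φ').add (hl w φ φ'))
      map_smul' := fun r v => by
        ext φ'
        refine ext_inner_left ℂ fun φ => ?_
        rw [RingHom.id_apply, smul_apply, inner_smul_right_eq_smul, hA, hA]
        exact hu (hl _ _ _) (by
          simpa only [map_smul, smul_apply, inner_smul_right_eq_smul] using
            (hl v φ φ').const_smul r) }
  have hS : ∀ v, ‖S v‖ ≤ |C| * ‖v‖ := by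
    intro v
    refine ContinuousLinearMap.opNorm_le_bound _ (by positivity) fun φ' => ?_
    rcases eq_or_ne (A v φ') 0 with h | h
    · change ‖A v φ'‖ ≤ _
      rw [h, norm_zero]
      positivity
    · have h1 := hn v (A v φ') φ'
      rw [← hA, inner_self_eq_norm_sq_to_K, norm_pow, RCLike.norm_ofReal, abs_norm] at h1
      have h2 : 0 < ‖A v φ'‖ := norm_pos_iff.2 h
      change ‖A v φ'‖ ≤ _
      refine le_of_mul_le_mul_right ?_ h2
      calc ‖A v φ'‖ * ‖A v φ'‖ = ‖A v φ'‖ ^ 2 := (sq _).symm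
        _ ≤ C * ‖v‖ * ‖A v φ'‖ * ‖φ'‖ := h1
        _ ≤ |C| * ‖v‖ * ‖A v φ'‖ * ‖φ'‖ := by gcongr; exact le_abs_self C
        _ = |C| * ‖v‖ * ‖φ'‖ * ‖A v φ'‖ := by ring
  exact ⟨S.mkContinuous |C| hS, fun v φ φ' => (hA v φ φ').symm ▸ hl v φ φ'⟩

end WeakLimit

/-! ### The process-tensor axioms in the limit -/

section Limit

variable {H : Type*} [NormedAddCommGroup H] [InnerProductSpace ℂ H] [CompleteSpace H]
  {E : Type*} [NormedAddCommGroup E] [InnerProductSpace ℂ E] [CompleteSpace E]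
  {κ : Type*}

/-- The process tensor cut off to finite sets of system and environment indices. -/
noncomputable def approx (J : κ → H →L[ℂ] E) (V : ℕ → E →L[ℂ] E) (ζ : E)
    (P : Finset ↥(exists_hilbertBasis ℂ H).choose × Finset κ) {m n : ℕ} (ε : Fin m ↪o Fin n) :
    OpTensor H m →L[ℝ] (H →L[ℂ] H) :=
  cutoff (fun γ : P.2 => J γ) (fun i : P.1 => stdBasis H i) V ζ ε

omit [CompleteSpace H] [CompleteSpace E] in
theorem IsometricFamily.subtype {J : κ → H →L[ℂ] E} (hJ : IsometricFamily J) (G : Finset κ) :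
    IsometricFamily fun γ : G => J γ :=
  ⟨fun γ => hJ.1 γ, fun γ δ h => hJ.2 γ δ fun h' => h (Subtype.ext h')⟩

theorem orthonormal_stdBasis_subtype (F : Finset ↥(exists_hilbertBasis ℂ H).choose) :
    Orthonormal ℂ fun i : F => stdBasis H i :=
  (stdBasis H).orthonormal.comp _ Subtype.val_injective

variable {J : κ → H →L[ℂ] E} {V : ℕ → E →L[ℂ] E} {ζ : E} {n : ℕ}
  (𝒰 : Ultrafilter (Finset ↥(exists_hilbertBasis ℂ H).choose × Finset κ))

theorem exists_tendsto_approx (hJ : IsometricFamily J) (hV : ∀ n, ‖V n‖ ≤ 1) (ζ : E) :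
    ∃ T : ∀ m : ℕ, (Fin m ↪o Fin n) → OpTensor H m →L[ℝ] (H →L[ℂ] H), ∀ m ε v φ φ',
      Filter.Tendsto (fun P => inner ℂ φ (approx J V ζ P ε v φ')) 𝒰
        (nhds (inner ℂ φ (T m ε v φ'))) := by
  classical
  choose T hT using fun (m : ℕ) (ε : Fin m ↪o Fin n) =>
    exists_weak_limit 𝒰 (fun P => approx J V ζ P ε) (C := ‖ζ‖ ^ 2) fun P v φ φ' =>
      norm_inner_cutoff_le ζ ε (hJ.subtype P.2) (orthonormal_stdBasis_subtype P.1) hV v φ φ'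
  exact ⟨T, hT⟩

variable {T : ∀ m : ℕ, (Fin m ↪o Fin n) → OpTensor H m →L[ℝ] (H →L[ℂ] H)}

/-- Weak limits of cut-off process tensors are process tensors. -/
theorem isProcessTensor_of_tendsto (hJ : IsometricFamily J) (hV : ∀ n, ‖V n‖ ≤ 1)
    (hζ : ‖ζ‖ = 1) (hT : ∀ m ε v φ φ',
      Filter.Tendsto (fun P => inner ℂ φ (approx J V ζ P ε v φ')) 𝒰
        (nhds (inner ℂ φ (T m ε v φ')))) : IsProcessTensor T := by
  classical
  have hCP : ∀ (m : ℕ) (e : Fin m ↪o Fin n) (k L : ℕ)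
      (A : Fin L → Matrix (Fin k) (Fin k) ℂ) (v : Fin L → OpTensor H m),
      IsCompletelyPositiveMatrix A v → ∀ φ : Fin k → H,
        0 ≤ ∑ p, ∑ q, ∑ l, A l p q * inner ℂ (φ p) (T m e (v l) (φ q)) := by
    intro m e k L A v hA φ
    refine ge_of_tendsto' (tendsto_finsetSum _ fun p _ => tendsto_finsetSum _ fun q _ =>
      tendsto_finsetSum _ fun l _ => (hT m e (v l) (φ p) (φ q)).const_mul (A l p q)) fun P => ?_
    exact cutoff_completelyPositive _ _ V ζ e hA φ
  refine ⟨fun m e v hv => ?_, fun m e v hv => ?_, hCP, fun m l e f O => ?_⟩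
  · have hpos : ∀ x, 0 ≤ inner ℂ x (T m e v x) := fun x => by
      simpa using hCP m e 1 1 _ _ hv fun _ => x
    refine ⟨?_, ?_⟩
    · rw [ContinuousLinearMap.nonneg_iff_isPositive, ContinuousLinearMap.isPositive_iff_complex]
      intro x
      obtain ⟨h0, h1⟩ := Complex.nonneg_iff.1 (hpos x)
      rw [← inner_conj_symm, Complex.conj_eq_iff_im.2 h1.symm]
      exact ⟨Complex.ext rfl h1, h0⟩
    · have hre : (fun i => inner ℂ (stdBasis H i) (T m e v (stdBasis H i))) =
          fun i => (((inner ℂ (stdBasis H i) (T m e v (stdBasis H i)) : ℂ).re : ℝ) : ℂ) :=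
        funext fun i => (Complex.eq_re_of_ofReal_le (r := 0) (by simpa using hpos _))
      rw [hre, Complex.summable_ofReal]
      -- The trace is not weakly continuous, but each finite partial sum is, and these are bounded
      -- by ‖v‖ for every cut-off.
      refine summable_of_sum_le (c := ‖v‖) (fun i => (Complex.nonneg_iff.1 (hpos _)).1) fun I => ?_
      rw [← Complex.re_sum]
      refine (Complex.re_le_norm _).trans ?_
      refine le_of_tendsto' (tendsto_finsetSum _ fun i _ => hT m e v _ _).norm fun P => ?_
      rw [← Finset.sum_coe_sort]
      simpa [hζ, approx] using norm_sum_inner_cutoff_le ζ e (hJ.subtype P.2)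
        (orthonormal_stdBasis_subtype P.1) hV v (orthonormal_stdBasis_subtype I)
  · by_cases hs : Summable fun i => inner ℂ (stdBasis H i) (T m e v (stdBasis H i))
    · refine le_of_tendsto' hs.hasSum fun I => ?_
      refine le_of_tendsto' (tendsto_finsetSum _ fun i _ => hT m e v _ _) fun P => ?_
      rw [← Finset.sum_coe_sort]
      obtain ⟨r, -, h1, h2⟩ := sum_inner_cutoff_sequential_mem ζ e (hJ.subtype P.2)
        (orthonormal_stdBasis_subtype P.1) hV hv (orthonormal_stdBasis_subtype I)
      refine h2.trans_le ?_
      rw [hζ, one_pow] at h1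
      exact_mod_cast h1
    -- A divergent `opTrace` has the default value 0, so the bound needs no prior summability.
    · rw [opTrace, tsum_eq_zero_of_not_summable hs]
      exact zero_le_one
  · ext φ'
    refine ext_inner_left ℂ fun φ => ?_
    refine tendsto_nhds_unique (hT _ _ _ φ φ') ?_
    simp only [approx, cutoff_insertId]
    exact hT _ _ _ φ φ'

end Limit

/-! ### Exact values on conjugations -/

section Conjugations

variable {H : Type*} [NormedAddCommGroup H] [InnerProductSpace ℂ H] [CompleteSpace H]
  {E : Type*} [NormedAddCommGroup E] [InnerProductSpace ℂ E] [CompleteSpace E]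

omit [CompleteSpace H] [CompleteSpace E] in
theorem IsometricFamily.inner_apply {κ : Type*} [DecidableEq κ] {J : κ → H →L[ℂ] E}
    (hJ : IsometricFamily J) (γ δ : κ) (x y : H) :
    inner ℂ (J γ x) (J δ y) = if γ = δ then inner ℂ x y else 0 := by
  split_ifs with h
  · rw [h, hJ.1]
  · exact hJ.2 γ δ h x y

section Cutoff

variable {Γ F : Type*} [Fintype Γ] [Fintype F] (J : Γ → H →L[ℂ] E) (e : F → H)
  (V : ℕ → E →L[ℂ] E) (ζ : E)

/-- The projection to the span of the vectors `J γ (e i)`. -/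
noncomputable def spanProj : E →L[ℂ] E :=
  ∑ γ, ∑ i, InnerProductSpace.rankOne ℂ (J γ (e i)) (J γ (e i))

/-- The unnormalised system-environment vector after conjugations, as a sum over paths. -/
noncomputable def pathVec {n : ℕ} (R : Fin n → H →L[ℂ] H) : E :=
  ∑ a, (amp J e V ζ n a * ∏ j, inner ℂ (e (a j).2.2) (R j (e (a j).2.1))) • endVec J e ζ n a

omit [CompleteSpace H] [CompleteSpace E] in
theorem spanProj_apply (u : E) :
    spanProj J e u = ∑ γ, ∑ i, inner ℂ (J γ (e i)) u • J γ (e i) := by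
  simp [spanProj, sum_apply]

omit [CompleteSpace H] [CompleteSpace E] in
theorem pathVec_zero (R : Fin 0 → H →L[ℂ] H) : pathVec J e V ζ R = ζ := by
  simp [pathVec, amp, endVec]

variable {J}

-- Summing the last letter over all paths amounts to inserting the finite projection both before and
-- after the last operator.
omit [CompleteSpace H] [CompleteSpace E] in
theorem pathVec_succ [DecidableEq Γ] (hJ : IsometricFamily J) {α : (H →L[ℂ] H) → E →L[ℂ] E}
    (hα : ∀ X γ x, α X (J γ x) = J γ (X x)) {n : ℕ} (R : Fin (n + 1) → H →L[ℂ] H) :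
    pathVec J e V ζ R = spanProj J e (α (R (Fin.last n))
      (spanProj J e (V n (pathVec J e V ζ fun j : Fin n => R j.castSucc)))) := by
  set u := V n (pathVec J e V ζ fun j : Fin n => R j.castSucc) with hu
  have h1 : α (R (Fin.last n)) (spanProj J e u) =
      ∑ γ, ∑ i, inner ℂ (J γ (e i)) u • J γ (R (Fin.last n) (e i)) := by
    simp only [spanProj_apply, map_sum, map_smul, hα]
  rw [h1, spanProj_apply, pathVec, sum_snoc, Fintype.sum_prod_type]
  refine Finset.sum_congr rfl fun γ _ => ?_
  rw [Fintype.sum_prod_type, Finset.sum_comm]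
  refine Finset.sum_congr rfl fun i' _ => ?_
  simp only [inner_sum, inner_smul_right, hJ.inner_apply, mul_ite, mul_zero]
  simp only [Finset.sum_ite_irrel, Finset.sum_const_zero, Finset.sum_ite_eq, Finset.mem_univ,
    if_true]
  rw [Finset.sum_smul]
  refine Finset.sum_congr rfl fun i _ => ?_
  rw [hu, pathVec, map_sum, inner_sum, Finset.sum_mul, Finset.sum_smul]
  refine Finset.sum_congr rfl fun a _ => ?_
  simp only [amp, endVec, Fin.snoc_castSucc, Fin.snoc_last, Fin.prod_univ_castSucc, map_smul,
    inner_smul_right]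
  congr 1
  ring

-- On the span of the copies `J γ`, the operator α(|φ'⟩⟨φ|) is Σ |J γ φ'⟩⟨J γ φ|. Finitely many γ
-- need not exhaust `E`, hence the projection on the right.
omit [CompleteSpace H] [CompleteSpace E] in
theorem sum_inner_spanProj {α : (H →L[ℂ] H) → E →L[ℂ] E} [DecidableEq Γ] (hJ : IsometricFamily J)
    (hα : ∀ X γ x, α X (J γ x) = J γ (X x)) (z u : E) (φ φ' : H) :
    ∑ γ, inner ℂ (J γ φ) (spanProj J e u) * inner ℂ z (J γ φ') =
      inner ℂ z (α (InnerProductSpace.rankOne ℂ φ' φ) (spanProj J e u)) := by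
  simp only [spanProj_apply, map_sum, map_smul, hα, inner_sum, inner_smul_right,
    InnerProductSpace.rankOne_apply, hJ.inner_apply, mul_ite, mul_zero, Finset.sum_mul]
  refine Finset.sum_congr rfl fun γ _ => ?_
  rw [Finset.sum_comm]
  simp [mul_assoc]

variable (J)

/-- The Choi kernel of a conjugation is a ket factor times a conjugated bra factor, so the double
sum over paths separates into two copies of one vector. -/
theorem inner_cutoff_conjOp {n : ℕ} (R : Fin n → H →L[ℂ] H) (φ φ' : H) :
    inner ℂ φ (cutoff J e V ζ (RelEmbedding.refl _) (elemTensor fun j => conjOp (R j)) φ') =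
    ∑ γ, inner ℂ (J γ φ) (pathVec J e V ζ R) * inner ℂ (pathVec J e V ζ R) (J γ φ') := by
  rw [inner_cutoff]
  refine Finset.sum_congr rfl fun γ _ => ?_
  rw [pathVec, inner_sum, sum_inner, Finset.sum_mul_sum]
  refine Finset.sum_congr rfl fun a _ => Finset.sum_congr rfl fun b _ => ?_
  have hw : ∀ x ψ : Fin n → H,
      insertWeight (RelEmbedding.refl ((· ≤ ·) : Fin n → Fin n → Prop)) x ψ = 1 := fun x ψ =>
    Finset.prod_eq_one fun j _ => if_pos ⟨j, rfl⟩
  have hc : pathChoi e (RelEmbedding.refl ((· ≤ ·) : Fin n → Fin n → Prop)) a b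
      (elemTensor fun j => conjOp (R j)) =
      (∏ j, inner ℂ (e (a j).2.2) (R j (e (a j).2.1))) *
        star (∏ j, inner ℂ (e (b j).2.2) (R j (e (b j).2.1))) := by
    rw [pathChoi, choiKernel_elemTensor, star_prod, ← Finset.prod_mul_distrib]
    refine Finset.prod_congr rfl fun j _ => ?_
    have h : OpSpace.toLinear (conjOp (R j)) = conj (R j) := rfl
    rw [h, conj_apply]
    simp only [RelEmbedding.refl_apply, mul_apply_eq_comp, InnerProductSpace.rankOne_apply, map_smul,
      inner_smul_right, ContinuousLinearMap.star_eq_adjoint,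
      ContinuousLinearMap.adjoint_inner_right, RCLike.star_def, inner_conj_symm]
    ring
  rw [hc, pathWeight, pathWeight, hw, hw]
  simp only [inner_smul_right, inner_smul_left, star_mul', RCLike.star_def, inner_conj_symm, map_mul,
    mul_one]
  ring

end Cutoff

section Limit

variable {κ : Type*} {J : κ → H →L[ℂ] E}

/-- The ranges of a family of operators have a dense span. -/
def IsTotalFamily (J : κ → H →L[ℂ] E) : Prop :=
  ∀ u : E, (∀ γ x, inner ℂ (J γ x) u = 0) → u = 0

omit [CompleteSpace H] [CompleteSpace E] in
theorem IsTotalFamily.ext (hd : IsTotalFamily J) {u v : E}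
    (h : ∀ γ x, inner ℂ (J γ x) u = inner ℂ (J γ x) v) : u = v :=
  sub_eq_zero.1 (hd _ fun γ x => by rw [inner_sub_right, h, sub_self])

/-- The Hilbert basis composed of the images of the standard basis. -/
theorem IsometricFamily.exists_hilbertBasis (hJ : IsometricFamily J) (hd : IsTotalFamily J) :
    ∃ b : HilbertBasis (κ × ↥(exists_hilbertBasis ℂ H).choose) ℂ E,
      ∀ p, b p = J p.1 (stdBasis H p.2) := by
  classical
  have ho := orthonormal_prod hJ (stdBasis H).orthonormal
  refine ⟨HilbertBasis.mkOfOrthogonalEqBot ho ?_, fun p =>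
    congrFun (HilbertBasis.coe_mkOfOrthogonalEqBot ho _) p⟩
  rw [Submodule.eq_bot_iff]
  intro u hu
  refine hd u fun γ x => ?_
  rw [← ContinuousLinearMap.adjoint_inner_right]
  have h0 : ContinuousLinearMap.adjoint (J γ) u = 0 := by
    refine (stdBasis H).repr.injective (lp.ext (funext fun i => ?_))
    rw [HilbertBasis.repr_apply_apply, ContinuousLinearMap.adjoint_inner_right, map_zero]
    exact (Submodule.mem_orthogonal _ _).1 hu _ (Submodule.subset_span ⟨(γ, i), rfl⟩)
  rw [h0, inner_zero_right]

theorem adjoint_apply_of_intertwines (hJ : IsometricFamily J) (hd : IsTotalFamily J)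
    {X : H →L[ℂ] H} {A : E →L[ℂ] E} (hA : ∀ γ x, A (J γ x) = J γ (X x)) (γ : κ) (x : H) :
    ContinuousLinearMap.adjoint A (J γ x) = J γ (ContinuousLinearMap.adjoint X x) := by
  classical
  refine hd.ext fun δ y => ?_
  rw [ContinuousLinearMap.adjoint_inner_right, hA, hJ.inner_apply, hJ.inner_apply,
    ContinuousLinearMap.adjoint_inner_right]

omit [CompleteSpace H] [CompleteSpace E] in
theorem norm_spanProj_apply_le {Γ F : Type*} [Fintype Γ] [Fintype F] {J : Γ → H →L[ℂ] E} {e : F → H}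
    (hJ : IsometricFamily J) (he : Orthonormal ℂ e) (u : E) : ‖spanProj J e u‖ ≤ ‖u‖ := by
  classical
  have ho := orthonormal_prod hJ he
  rw [← sq_le_sq₀ (norm_nonneg _) (norm_nonneg _)]
  refine le_trans (le_of_eq ?_) (ho.sum_inner_products_le (s := Finset.univ) u)
  have h : spanProj J e u = ∑ p : Γ × F, inner ℂ (J p.1 (e p.2)) u • J p.1 (e p.2) := by
    rw [spanProj_apply, Fintype.sum_prod_type]
  rw [h, ← inner_self_eq_norm_sq (𝕜 := ℂ), ho.inner_sum, map_sum]
  refine Finset.sum_congr rfl fun s _ => ?_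
  rw [RCLike.conj_mul]
  norm_cast

variable (J) in
/-- The projections `spanProj` for finite sets of system and environment indices. -/
noncomputable def finProj (P : Finset ↥(exists_hilbertBasis ℂ H).choose × Finset κ) : E →L[ℂ] E :=
  spanProj (fun γ : P.2 => J γ) (fun i : P.1 => stdBasis H i)

theorem tendsto_finProj_self (hJ : IsometricFamily J) (hd : IsTotalFamily J) (u : E) :
    Filter.Tendsto (fun P => finProj J P u) Filter.atTop (nhds u) := by
  classical
  obtain ⟨b, hb⟩ := hJ.exists_hilbertBasis hd
  have h1 : Filter.Tendsto (fun P : Finset ↥(exists_hilbertBasis ℂ H).choose × Finset κ =>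
      P.2 ×ˢ P.1) Filter.atTop Filter.atTop :=
    Filter.tendsto_finsetProd_atTop.comp
      (Filter.tendsto_atTop_atTop.2 fun b => ⟨b.swap, fun a h => Prod.swap_le_swap.1 h⟩ :
        Filter.Tendsto Prod.swap Filter.atTop Filter.atTop)
  have h2 := (show Filter.Tendsto _ Filter.atTop _ from b.hasSum_repr u).comp h1
  refine h2.congr fun P => ?_
  rw [finProj, spanProj_apply, Function.comp_apply, Finset.sum_product,
    ← Finset.sum_coe_sort]
  refine Finset.sum_congr rfl fun γ _ => ?_
  rw [← Finset.sum_coe_sort]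
  simp only [hb, HilbertBasis.repr_apply_apply]

/-- The projections are contractions and tend strongly to the identity, so they may be applied to
convergent nets. -/
theorem tendsto_finProj (hJ : IsometricFamily J) (hd : IsTotalFamily J)
    {l : Filter (Finset ↥(exists_hilbertBasis ℂ H).choose × Finset κ)} (hl : l ≤ Filter.atTop)
    {x : Finset ↥(exists_hilbertBasis ℂ H).choose × Finset κ → E} {u : E}
    (hx : Filter.Tendsto x l (nhds u)) :
    Filter.Tendsto (fun P => finProj J P (x P)) l (nhds u) := by
  have h1 : Filter.Tendsto (fun P => finProj J P (x P - u)) l (nhds 0) := by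
    refine squeeze_zero_norm (fun P => norm_spanProj_apply_le (hJ.subtype P.2)
      (orthonormal_stdBasis_subtype P.1) (x P - u)) ?_
    simpa using (hx.sub_const u).norm
  have h2 := h1.add ((tendsto_finProj_self hJ hd u).mono_left hl)
  simpa only [map_sub, sub_add_cancel, zero_add] using h2

/-- The unnormalised system-environment vector after conjugations. -/
noncomputable def stateVec (α : (H →L[ℂ] H) → E →L[ℂ] E) (V : ℕ → E →L[ℂ] E) (ζ : E) :
    (n : ℕ) → (Fin n → H →L[ℂ] H) → E
  | 0, _ => ζ
  | n + 1, R => α (R (Fin.last n)) (V n (stateVec α V ζ n fun j => R j.castSucc))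

variable {α : (H →L[ℂ] H) → E →L[ℂ] E} {V : ℕ → E →L[ℂ] E} {ζ : E}

/-- Each step is a fixed bounded operator interlaced with projections. The convergence is in norm,
which prevents trace from escaping in the weak limit. -/
theorem tendsto_pathVec (hJ : IsometricFamily J) (hd : IsTotalFamily J)
    (hα : ∀ X γ x, α X (J γ x) = J γ (X x))
    {l : Filter (Finset ↥(exists_hilbertBasis ℂ H).choose × Finset κ)} (hl : l ≤ Filter.atTop)
    {n : ℕ} (R : Fin n → H →L[ℂ] H) :
    Filter.Tendsto (fun P : Finset ↥(exists_hilbertBasis ℂ H).choose × Finset κ =>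
      pathVec (fun γ : P.2 => J γ) (fun i : P.1 => stdBasis H i) V ζ R) l
      (nhds (stateVec α V ζ n R)) := by
  classical
  induction n with
  | zero => simp only [pathVec_zero]; exact tendsto_const_nhds
  | succ n ih =>
    have h := tendsto_finProj hJ hd hl (((α (R (Fin.last n))).continuous.tendsto _).comp
      (tendsto_finProj hJ hd hl (((V n).continuous.tendsto _).comp (ih fun j => R j.castSucc))))
    refine h.congr fun P => ?_
    exact (pathVec_succ _ V ζ (hJ.subtype P.2) (fun X γ x => hα X γ x) R).symm

/-- Weak limits of the cut-off process tensors on conjugations. -/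
theorem inner_limit_conjOp (hJ : IsometricFamily J) (hd : IsTotalFamily J)
    (hα : ∀ X γ x, α X (J γ x) = J γ (X x))
    {l : Filter (Finset ↥(exists_hilbertBasis ℂ H).choose × Finset κ)} [l.NeBot]
    (hl : l ≤ Filter.atTop) {n : ℕ} (R : Fin (n + 1) → H →L[ℂ] H) {S : H →L[ℂ] H}
    (hS : ∀ φ φ', Filter.Tendsto (fun P => inner ℂ φ (approx J V ζ P (RelEmbedding.refl _)
      (elemTensor fun j => conjOp (R j)) φ')) l (nhds (inner ℂ φ (S φ')))) (φ φ' : H) :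
    inner ℂ φ (S φ') = inner ℂ (stateVec α V ζ (n + 1) R)
      (α (InnerProductSpace.rankOne ℂ φ' φ) (stateVec α V ζ (n + 1) R)) := by
  classical
  have h := tendsto_pathVec (V := V) (ζ := ζ) hJ hd hα hl R
  refine tendsto_nhds_unique (hS φ φ')
    ((h.inner (((α (InnerProductSpace.rankOne ℂ φ' φ)).continuous.tendsto _).comp h)).congr
      fun P => ?_)
  rw [approx, inner_cutoff_conjOp, Function.comp_apply]
  -- As at least one operation is present, the path vector lies in the range of the projection,
  -- which `sum_inner_spanProj` requires.
  have h1 := pathVec_succ (fun i : P.1 => stdBasis H i) V ζ (hJ.subtype P.2)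
    (fun X γ x => hα X γ x) R
  rw [h1]
  exact (sum_inner_spanProj _ (hJ.subtype P.2) (fun X γ x => hα X γ x) _ _ φ φ').symm

/-- Expand ⟨w, α(X) w⟩ in the basis `J γ (e i)` and group by `i`. With Y = |e i⟩⟨X* e i|, the entry
⟨X* e i, S e i⟩ is ⟨w, α(Y) w⟩, whose expansion retains exactly the terms of group `i`, since Y*
kills every other basis vector. -/
theorem opTrace_mul_of_inner (hJ : IsometricFamily J) (hd : IsTotalFamily J)
    (hα : ∀ X γ x, α X (J γ x) = J γ (X x)) {S : H →L[ℂ] H} {w : E}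
    (hS : ∀ φ φ', inner ℂ φ (S φ') = inner ℂ w (α (InnerProductSpace.rankOne ℂ φ' φ) w))
    (X : H →L[ℂ] H) : opTrace (X * S) = inner ℂ w (α X w) := by
  classical
  obtain ⟨b, hb⟩ := hJ.exists_hilbertBasis hd
  have h1 := b.hasSum_inner_mul_inner w (α X w)
  rw [← (Equiv.prodComm _ _).hasSum_iff] at h1
  refine (h1.prod_fiberwise fun i => ?_).tsum_eq
  rw [mul_apply_eq_comp, ← ContinuousLinearMap.adjoint_inner_left, hS]
  have h2 := b.hasSum_inner_mul_inner w
    (α (InnerProductSpace.rankOne ℂ (stdBasis H i) (ContinuousLinearMap.adjoint X (stdBasis H i))) w)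
  have hin : ∀ (Y : H →L[ℂ] H) p, inner ℂ (b p) (α Y w) =
      inner ℂ (J p.1 (ContinuousLinearMap.adjoint Y (stdBasis H p.2))) w := fun Y p => by
    rw [hb, ← adjoint_apply_of_intertwines hJ hd (hα Y), ContinuousLinearMap.adjoint_inner_left]
  have ho := orthonormal_iff_ite.1 (stdBasis H).orthonormal i
  have hi : Function.Injective fun γ : κ => (γ, i) := fun γ δ h => congrArg Prod.fst h
  rw [← hi.hasSum_iff] at h2
  · convert h2 using 2 with γ
    simp only [Function.comp_apply, Equiv.prodComm_apply, Prod.swap, hin,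
      InnerProductSpace.adjoint_rankOne, InnerProductSpace.rankOne_apply, ho, if_true, one_smul]
  · rintro ⟨γ, k⟩ hk
    have hik : i ≠ k := fun h => hk ⟨γ, by rw [h]⟩
    simp only [hin, InnerProductSpace.adjoint_rankOne, InnerProductSpace.rankOne_apply, ho,
      if_neg hik, zero_smul, map_zero, inner_zero_left, mul_zero]

end Limit

end Conjugations

/-! ### Existence for vector states -/

section Existence

variable {H : Type*} [NormedAddCommGroup H] [InnerProductSpace ℂ H] [CompleteSpace H]
  {E : Type*} [NormedAddCommGroup E] [InnerProductSpace ℂ E] [CompleteSpace E]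
  {κ : Type*} {J : κ → H →L[ℂ] E}

/-- Existence of the process tensor for a system-environment evolution from a vector state. -/
theorem exists_isProcessTensor (hJ : IsometricFamily J) (hd : IsTotalFamily J)
    {α : (H →L[ℂ] H) → E →L[ℂ] E} (hα : ∀ X γ x, α X (J γ x) = J γ (X x))
    {V : ℕ → E →L[ℂ] E} (hV : ∀ n, ‖V n‖ ≤ 1) {ζ : E} (hζ : ‖ζ‖ = 1) (n : ℕ) :
    ∃ T : ∀ m : ℕ, (Fin m ↪o Fin (n + 1)) → OpTensor H m →L[ℝ] (H →L[ℂ] H),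
      IsProcessTensor T ∧ ∀ (R : Fin (n + 1) → H →L[ℂ] H) (X : H →L[ℂ] H),
        opTrace (X * T (n + 1) (RelEmbedding.refl _) (elemTensor fun j => conjOp (R j))) =
          inner ℂ (stateVec α V ζ (n + 1) R) (α X (stateVec α V ζ (n + 1) R)) := by
  classical
  obtain ⟨T, hT⟩ := exists_tendsto_approx (n := n + 1) (Ultrafilter.of Filter.atTop) hJ hV ζ
  refine ⟨T, isProcessTensor_of_tendsto _ hJ hV hζ hT, fun R X => ?_⟩
  exact opTrace_mul_of_inner hJ hd hα
    (fun φ φ' => inner_limit_conjOp hJ hd hα (Ultrafilter.of_le _) R (fun _ _ => hT _ _ _ _ _) φ φ') X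

end Existence

/-! ### Representations built from isometric families -/

section Intertwining

variable {H : Type*} [NormedAddCommGroup H] [InnerProductSpace ℂ H] [CompleteSpace H]
  {E : Type*} [NormedAddCommGroup E] [InnerProductSpace ℂ E] [CompleteSpace E]
  {G : Type*} [NormedAddCommGroup G] [InnerProductSpace ℂ G] [CompleteSpace G]
  {κ κ' : Type*} {J : κ → H →L[ℂ] E} {J' : κ' → E →L[ℂ] G}

omit [CompleteSpace H] in
theorem IsTotalFamily.ext_clm (hd : IsTotalFamily J) {A B : E →L[ℂ] E}
    (h : ∀ γ x, A (J γ x) = B (J γ x)) : A = B := by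
  refine ContinuousLinearMap.adjoint.injective (ContinuousLinearMap.ext fun u => hd.ext fun γ x => ?_)
  rw [ContinuousLinearMap.adjoint_inner_right, ContinuousLinearMap.adjoint_inner_right, h]

omit [CompleteSpace H] in
theorem IsTotalFamily.comp (hd' : IsTotalFamily J') (hd : IsTotalFamily J) :
    IsTotalFamily fun p : κ' × κ => J' p.1 ∘L J p.2 := fun u hu => hd' u fun γ x => by
  rw [← ContinuousLinearMap.adjoint_inner_right, hd (ContinuousLinearMap.adjoint (J' γ) u)
    (fun δ y => ?_), inner_zero_right]
  rw [ContinuousLinearMap.adjoint_inner_right]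
  exact hu (γ, δ) y

omit [CompleteSpace H] [CompleteSpace E] [CompleteSpace G] in
theorem IsometricFamily.comp (hJ' : IsometricFamily J') (hJ : IsometricFamily J) :
    IsometricFamily fun p : κ' × κ => J' p.1 ∘L J p.2 := by
  refine ⟨fun p x y => (hJ'.1 _ _ _).trans (hJ.1 _ _ _), ?_⟩
  rintro ⟨γ, i⟩ ⟨δ, j⟩ h x y
  by_cases h' : γ = δ
  · subst h'
    exact (hJ'.1 _ _ _).trans (hJ.2 i j (fun h' => h (by rw [h'])) x y)
  · exact hJ'.2 γ δ h' _ _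

/-- Operators that act through a total isometric family form a representation. -/
noncomputable def intertwiningHom (hJ : IsometricFamily J) (hd : IsTotalFamily J)
    {α : (H →L[ℂ] H) → E →L[ℂ] E} (hα : ∀ X γ x, α X (J γ x) = J γ (X x)) :
    (H →L[ℂ] H) →⋆ₐ[ℂ] (E →L[ℂ] E) where
  toFun := α
  map_one' := hd.ext_clm fun γ x => by simp [hα]
  map_mul' X Y := hd.ext_clm fun γ x => by simp [hα]
  map_zero' := hd.ext_clm fun γ x => by simp [hα]
  map_add' X Y := hd.ext_clm fun γ x => by simp [hα]
  commutes' c := hd.ext_clm fun γ x => by simp [hα, Algebra.algebraMap_eq_smul_one]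
  map_star' X := hd.ext_clm fun γ x => by
    rw [hα, ContinuousLinearMap.star_eq_adjoint, ContinuousLinearMap.star_eq_adjoint,
      adjoint_apply_of_intertwines hJ hd (hα X)]

omit [CompleteSpace H] in
theorem IsometricFamily.summable (hJ : IsometricFamily J) {x : κ → H}
    (hx : Summable fun k => ‖x k‖ ^ 2) : Summable fun k => J k (x k) := by
  have hO : OrthogonalFamily ℂ (fun _ : κ => H) fun k =>
      LinearMap.isometryOfInner (J k).toLinearMap (hJ.1 k) := fun i j h v w => hJ.2 i j h v w
  exact (hO.summable_iff_norm_sq_summable x).2 hx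

theorem IsometricFamily.adjoint_tsum [DecidableEq κ] (hJ : IsometricFamily J) {x : κ → H}
    (hx : Summable fun k => ‖x k‖ ^ 2) (k : κ) :
    ContinuousLinearMap.adjoint (J k) (∑' k, J k (x k)) = x k := by
  rw [ContinuousLinearMap.map_tsum _ (hJ.summable hx)]
  simp only [hJ.adjoint_apply]
  simp only [eq_comm (a := k)]
  exact tsum_ite_eq k x _

/-- An infinite sum of vector functionals becomes a single one on `E`: `A` acts within each copy of
`H`, and different copies are orthogonal. -/
theorem IsometricFamily.hasSum_inner_tsum (hJ : IsometricFamily J) (hd : IsTotalFamily J)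
    {x y : κ → H} (hx : Summable fun k => ‖x k‖ ^ 2) (hy : Summable fun k => ‖y k‖ ^ 2)
    {X : H →L[ℂ] H} {A : E →L[ℂ] E} (hA : ∀ γ x, A (J γ x) = J γ (X x)) :
    HasSum (fun k => inner ℂ (x k) (X (y k))) (inner ℂ (∑' k, J k (x k)) (A (∑' k, J k (y k)))) := by
  classical
  have h := ((hJ.summable hx).hasSum.mapL (innerSL ℂ (A (∑' k, J k (y k))))).star
  simp only [innerSL_apply_apply, RCLike.star_def, inner_conj_symm] at h
  refine (funext fun k => ?_ : (fun k => inner ℂ (x k) (X (y k))) = _) ▸ h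
  rw [← ContinuousLinearMap.adjoint_inner_left A, adjoint_apply_of_intertwines hJ hd hA,
    ← ContinuousLinearMap.adjoint_inner_right, hJ.adjoint_tsum hy,
    ContinuousLinearMap.adjoint_inner_left]

end Intertwining

/-! ### Amplifications and normal states -/

section Tensor

variable {H : Type*} [NormedAddCommGroup H] [InnerProductSpace ℂ H]
  {K : Type*} [NormedAddCommGroup K] [InnerProductSpace ℂ K]

theorem ampl_tensorVec (X : H →L[ℂ] H) (ψ : K) (ξ : H) :
    ampl K X (tensorVec H ψ ξ) = tensorVec H ψ (X ξ) := by
  rw [tensorVec_apply, tensorVec_apply, ampl, extendOp_coe]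
  rfl

variable {ι : Type*}

theorem isometricFamily_tensorVec {f : ι → K} (hf : Orthonormal ℂ f) :
    IsometricFamily fun i => tensorVec H (f i) := by
  classical
  have h : ∀ (u v : K) (x y : H), inner ℂ (tensorVec H u x) (tensorVec H v y) =
      inner ℂ x y * inner ℂ u v := fun u v x y => by
    rw [inner_tensorVec, mul_comm]
  refine ⟨fun i x y => ?_, fun i j hij x y => ?_⟩
  · rw [h, orthonormal_iff_ite.1 hf, if_pos rfl, mul_one]
  · rw [h, orthonormal_iff_ite.1 hf, if_neg hij, mul_zero]

theorem isTotalFamily_tensorVec [CompleteSpace K] (b : HilbertBasis ι ℂ K) :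
    IsTotalFamily fun i => tensorVec H (b i) := by
  intro u hu
  have h1 : ∀ (x : H) (y : K), inner ℂ ((x ⊗ₜ[ℂ] y : H ⊗[ℂ] K) : HTensor H K) u = 0 := by
    intro x y
    let g : K →L[ℂ] HTensor H K :=
      (UniformSpace.Completion.toComplL (𝕜 := ℂ)).comp (TensorProduct.mkL ℂ H K x)
    have h0 : ContinuousLinearMap.adjoint g u = 0 := by
      refine b.repr.injective (lp.ext (funext fun i => ?_))
      rw [HilbertBasis.repr_apply_apply, ContinuousLinearMap.adjoint_inner_right, map_zero]
      exact hu i x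
    change inner ℂ (g y) u = 0
    rw [← ContinuousLinearMap.adjoint_inner_right, h0, inner_zero_right]
  have h2 : ∀ z : HTensor H K, inner ℂ z u = 0 := by
    intro z
    induction z using UniformSpace.Completion.induction_on with
    | hp => exact isClosed_eq (by fun_prop) (by fun_prop)
    | ih t =>
      induction t using TensorProduct.induction_on with
      | zero => rw [UniformSpace.Completion.coe_zero, inner_zero_left]
      | tmul x y => exact h1 x y
      | add s t hs ht => rw [UniformSpace.Completion.coe_add, inner_add_left, hs, ht, add_zero]
  exact inner_self_eq_zero.1 (h2 u)

variable [CompleteSpace H] [CompleteSpace K]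

/-- The representation `X ↦ X ⊗ 1`. -/
noncomputable def amplHom (H : Type*) [NormedAddCommGroup H] [InnerProductSpace ℂ H]
    [CompleteSpace H] (K : Type*) [NormedAddCommGroup K] [InnerProductSpace ℂ K]
    [CompleteSpace K] : (H →L[ℂ] H) →⋆ₐ[ℂ] (HTensor H K →L[ℂ] HTensor H K) :=
  intertwiningHom (isometricFamily_tensorVec (stdBasis K).orthonormal)
    (isTotalFamily_tensorVec (stdBasis K)) (α := ampl K) fun X _ x => ampl_tensorVec X _ x

theorem amplHom_apply (X : H →L[ℂ] H) : amplHom H K X = ampl K X := rfl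

/-- A normal state is a vector state in an amplification. -/
theorem IsNormalState.exists_vector {A : VonNeumannAlgebra H} {μ : A.toStarSubalgebra →ₗ[ℂ] ℂ}
    (hμ : IsNormalState A μ) (b : HilbertBasis ℕ ℂ K) :
    ∃ z : HTensor H K, ‖z‖ = 1 ∧
      ∀ X : A.toStarSubalgebra, μ X = inner ℂ z (ampl K (X : H →L[ℂ] H) z) := by
  obtain ⟨ξ, η, hξ, hη, h⟩ := hμ.normal
  -- In the amplification, μ is given by the two vectors Σ ξ k ⊗ b k and Σ η k ⊗ b k; positivity
  -- replaces them by one.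
  obtain ⟨z, hz⟩ := exists_vector_of_nonneg
    ((amplHom H K).comp A.toStarSubalgebra.subtype) μ
    (fun a => hμ.nonneg _ (star_mul_self_nonneg (a : H →L[ℂ] H))) _ _ fun a =>
      (h a).unique ((isometricFamily_tensorVec b.orthonormal).hasSum_inner_tsum
        (isTotalFamily_tensorVec b) hξ hη fun γ x => ampl_tensorVec (a : H →L[ℂ] H) _ x)
  refine ⟨z, ?_, hz⟩
  have h1 := hz 1
  rw [hμ.unital, map_one, one_apply_eq_self, inner_self_eq_norm_sq_to_K] at h1
  have h2 : ‖z‖ ^ 2 = 1 := Complex.ofReal_injective (by push_cast; exact h1.symm)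
  exact (pow_eq_one_iff_of_nonneg (norm_nonneg z) two_ne_zero).1 h2

end Tensor

/-! ### Polarization and the stochastic process -/

section Kernel

/-- Averaging over the fourth roots of unity against their conjugates keeps only the term linear in
`y` and conjugate-linear in `x`. -/
theorem star_mul_mul_eq_sum {A : Type*} [Ring A] [StarRing A] [Algebra ℂ A] [StarModule ℂ A]
    (S x y : A) : star x * S * y = ∑ m : Fin 4, (starRingEnd ℂ (Complex.I ^ (m : ℕ)) / 4) •
      (star (x + Complex.I ^ (m : ℕ) • y) * S * (x + Complex.I ^ (m : ℕ) • y)) := by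
  simp only [Fin.sum_univ_four, star_add, star_smul, add_mul, mul_add, smul_mul_assoc,
    mul_smul_comm, smul_smul, smul_add, RCLike.star_def, map_pow, Complex.conj_I]
  have h3 : Complex.I ^ 3 = -Complex.I := by rw [pow_succ, Complex.I_sq]; ring
  have h3' : (-Complex.I) ^ 3 = Complex.I := by rw [pow_succ, neg_sq, Complex.I_sq]; ring
  have h4 : (-Complex.I) ^ 2 = -1 := by rw [neg_sq, Complex.I_sq]
  have hI := Complex.I_mul_I
  simp only [Fin.val_zero, Fin.val_one, Fin.val_two, show ((3 : Fin 4) : ℕ) = 3 from rfl, pow_zero,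
    pow_one, h3, h3', h4, Complex.I_sq]
  match_scalars <;> first | ring1 | linear_combination (1 / 2) * hI | linear_combination (-1 / 2) * hI

universe u v

variable {Hs : Type u} [NormedAddCommGroup Hs] [InnerProductSpace ℂ Hs] [CompleteSpace Hs]
  {He : Type v} [NormedAddCommGroup He] [InnerProductSpace ℂ He] [CompleteSpace He]
  {Bs : VonNeumannAlgebra Hs} {Be : VonNeumannAlgebra He} (Q : StochasticProc Bs Be)

theorem StochasticProc.coe_j (t : ℝ≥0) (X : Bs.toStarSubalgebra) :
    (Q.j t X : HTensor Hs He →L[ℂ] HTensor Hs He) =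
      star (Q.U t : HTensor Hs He →L[ℂ] HTensor Hs He) *
        amplHom Hs He (X : Hs →L[ℂ] Hs) * (Q.U t : HTensor Hs He →L[ℂ] HTensor Hs He) := rfl

theorem StochasticProc.j_add_smul (t : ℝ≥0) (c : ℂ) (X Y : Bs.toStarSubalgebra) :
    Q.j t (X + c • Y) = Q.j t X + c • Q.j t Y := by
  apply Subtype.ext
  change (Q.j t (X + c • Y)).1 = (Q.j t X).1 + c • (Q.j t Y).1
  rw [coe_j, coe_j, coe_j, ← smul_mul_assoc, ← mul_smul_comm, ← map_smul, ← add_mul, ← mul_add,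
    ← map_add]
  rfl

theorem StochasticProc.j_one (t : ℝ≥0) : Q.j t 1 = 1 := by
  apply Subtype.ext
  rw [coe_j]
  change _ * amplHom Hs He 1 * _ = 1
  rw [map_one, mul_one]
  exact Unitary.coe_star_mul_self _

theorem StochasticProc.jProd_zero (t : Fin 0 → ℝ≥0) (a : Fin 0 → Bs.toStarSubalgebra) :
    Q.jProd t a = 1 := by
  simp [jProd]

theorem StochasticProc.jProd_succ {n : ℕ} (t : Fin (n + 1) → ℝ≥0)
    (a : Fin (n + 1) → Bs.toStarSubalgebra) : Q.jProd t a =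
      Q.jProd (fun i => t i.succ) (fun i => a i.succ) * Q.j (t 0) (a 0) := by
  simp [jProd, List.ofFn_succ]

theorem StochasticProc.jProd_succ' {n : ℕ} (t : Fin (n + 1) → ℝ≥0)
    (a : Fin (n + 1) → Bs.toStarSubalgebra) : Q.jProd t a =
      Q.j (t (Fin.last n)) (a (Fin.last n)) *
        Q.jProd (fun i => t i.castSucc) (fun i => a i.castSucc) := by
  rw [jProd, List.ofFn_succ', List.concat_eq_append, List.reverse_append, List.prod_append]
  simp [jProd]

/-- Polarization of correlation kernels. -/
theorem StochasticProc.exists_kernel_eq_sum {n : ℕ} (t : Fin n → ℝ≥0) :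
    ∃ (ℓ : ℕ) (c : Fin ℓ → ℂ), 0 < ℓ ∧ ∀ a b : Fin n → Bs.toStarSubalgebra,
      ∃ R : Fin ℓ → Fin n → Bs.toStarSubalgebra, star (Q.jProd t a) * Q.jProd t b =
        ∑ k, c k • (star (Q.jProd t (R k)) * Q.jProd t (R k)) := by
  induction n with
  | zero => exact ⟨1, fun _ => 1, one_pos, fun a b => ⟨fun _ => a, by simp [jProd_zero]⟩⟩
  | succ n ih =>
    -- The earliest time is outermost in the kernel. The induction hypothesis treats the later times
    -- in the middle, and polarization at the earliest time multiplies the number of terms by four.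
    obtain ⟨ℓ, c, hℓ, h⟩ := ih fun i => t i.succ
    let f : Fin (ℓ * 4) ≃ Fin ℓ × Fin 4 := finProdFinEquiv.symm
    refine ⟨ℓ * 4, fun k => c (f k).1 * (starRingEnd ℂ (Complex.I ^ ((f k).2 : ℕ)) / 4), by omega,
      fun a b => ?_⟩
    obtain ⟨R, hR⟩ := h (fun i => a i.succ) fun i => b i.succ
    let R' : Fin ℓ × Fin 4 → Fin (n + 1) → Bs.toStarSubalgebra := fun p =>
      Fin.cons (a 0 + Complex.I ^ (p.2 : ℕ) • b 0) (R p.1)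
    refine ⟨fun k => R' (f k), ?_⟩
    rw [f.sum_comp fun p => (c p.1 * (starRingEnd ℂ (Complex.I ^ (p.2 : ℕ)) / 4)) •
      (star (Q.jProd t (R' p)) * Q.jProd t (R' p)), Fintype.sum_prod_type]
    have h1 : star (Q.jProd t a) * Q.jProd t b = star (Q.j (t 0) (a 0)) *
        (star (Q.jProd (fun i => t i.succ) fun i => a i.succ) *
          Q.jProd (fun i => t i.succ) fun i => b i.succ) * Q.j (t 0) (b 0) := by
      rw [jProd_succ, jProd_succ, star_mul]
      simp only [mul_assoc]
    rw [h1, hR, Finset.mul_sum, Finset.sum_mul]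
    refine Finset.sum_congr rfl fun k _ => ?_
    rw [mul_smul_comm, smul_mul_assoc, star_mul_mul_eq_sum, Finset.smul_sum]
    refine Finset.sum_congr rfl fun m _ => ?_
    rw [smul_smul, jProd_succ, star_mul]
    simp only [R', Fin.cons_zero, Fin.cons_succ, j_add_smul, mul_assoc]

/-- The unitaries at successive times, starting from the identity. -/
noncomputable def StochasticProc.stepUnitary (s : ℕ → ℝ≥0) :
    ℕ → unitary (HTensor Hs He →L[ℂ] HTensor Hs He)
  | 0 => 1
  | k + 1 => Q.U (s k)

variable {K : Type*} [NormedAddCommGroup K] [InnerProductSpace ℂ K] [CompleteSpace K]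

/-- The evolution from one time to the next, on the amplified space. -/
noncomputable def StochasticProc.evolution (K : Type*) [NormedAddCommGroup K]
    [InnerProductSpace ℂ K] [CompleteSpace K] (s : ℕ → ℝ≥0) (k : ℕ) :
    HTensor (HTensor Hs He) K →L[ℂ] HTensor (HTensor Hs He) K :=
  amplHom _ K ((Q.stepUnitary s (k + 1)).1 * star (Q.stepUnitary s k).1)

theorem StochasticProc.norm_evolution_le (s : ℕ → ℝ≥0) (k : ℕ) : ‖Q.evolution K s k‖ ≤ 1 := by
  set W := Q.stepUnitary s (k + 1) * star (Q.stepUnitary s k)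
  have h : star (Q.evolution K s k) * Q.evolution K s k = 1 := by
    change star (amplHom _ K W.1) * amplHom _ K W.1 = 1
    rw [← map_star, ← map_mul, Unitary.coe_star_mul_self, map_one]
  have h1 := CStarRing.norm_star_mul_self (x := Q.evolution K s k)
  rw [h] at h1
  have h2 : ‖(1 : HTensor (HTensor Hs He) K →L[ℂ] HTensor (HTensor Hs He) K)‖ ≤ 1 :=
    ContinuousLinearMap.norm_id_le
  nlinarith [norm_nonneg (Q.evolution K s k)]

/-- The evolutions telescope: the unitary left over from one time cancels against the adjoint in the
next evolution, leaving the last unitary times the Heisenberg product. -/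
theorem StochasticProc.stateVec_eq (s : ℕ → ℝ≥0) (z : HTensor (HTensor Hs He) K) (n : ℕ)
    (R : Fin n → Bs.toStarSubalgebra) :
    stateVec (fun X => amplHom _ K (amplHom Hs He X)) (Q.evolution K s) z n (fun j => (R j).1) =
      amplHom _ K ((Q.stepUnitary s n).1 * (Q.jProd (fun j : Fin n => s j) R).1) z := by
  induction n with
  | zero => simp [stateVec, jProd_zero, stepUnitary]
  | succ n ih =>
    rw [stateVec, ih, evolution, ← mul_apply_eq_comp, ← mul_apply_eq_comp, ← map_mul, ← map_mul,
      jProd_succ']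
    congr 2
    have h1 : star (Q.stepUnitary s n).1 * (Q.stepUnitary s n).1 = 1 :=
      Unitary.coe_star_mul_self _
    have h2 : (Q.U (s n)).1 * star (Q.U (s n)).1 = 1 := Unitary.coe_mul_star_self _
    change _ = (Q.U (s n)).1 * ((Q.j (s (Fin.last n)) (R (Fin.last n))).1 * _)
    rw [coe_j]
    change amplHom Hs He (R (Fin.last n)).1 * ((Q.U (s n)).1 * star (Q.stepUnitary s n).1 *
      ((Q.stepUnitary s n).1 * (Q.jProd (fun j : Fin n => s j) fun i => R i.castSucc).1)) =
      (Q.U (s n)).1 * (star (Q.U (s n)).1 * amplHom Hs He (R (Fin.last n)).1 * (Q.U (s n)).1 *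
        (Q.jProd (fun j : Fin n => s j) fun i => R i.castSucc).1)
    simp only [mul_assoc]
    rw [← mul_assoc (star (Q.stepUnitary s n).1), h1, one_mul,
      ← mul_assoc (Q.U (s n)).1 (star (Q.U (s n)).1), h2, one_mul]

/-- The reduced state after conjugations is given by the process. -/
theorem StochasticProc.inner_stateVec (s : ℕ → ℝ≥0) {z : HTensor (HTensor Hs He) K}
    (hz : ∀ X : (vnTensor Bs Be).toStarSubalgebra, Q.μ X = inner ℂ z
      (ampl K (X : HTensor Hs He →L[ℂ] HTensor Hs He) z)) (n : ℕ)
    (R : Fin (n + 1) → Bs.toStarSubalgebra) (X : Bs.toStarSubalgebra) :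
    inner ℂ (stateVec (fun X => amplHom _ K (amplHom Hs He X)) (Q.evolution K s) z (n + 1)
      (fun j => (R j).1)) (amplHom _ K (amplHom Hs He X.1)
        (stateVec (fun X => amplHom _ K (amplHom Hs He X)) (Q.evolution K s) z (n + 1)
          (fun j => (R j).1))) =
      Q.μ (star (Q.jProd (fun j : Fin (n + 1) => s j) R) * Q.j (s n) X *
        Q.jProd (fun j : Fin (n + 1) => s j) R) := by
  rw [hz, stateVec_eq, ← amplHom_apply, ← ContinuousLinearMap.adjoint_inner_right,
    ← ContinuousLinearMap.star_eq_adjoint, ← map_star, ← mul_apply_eq_comp, ← mul_apply_eq_comp,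
    ← map_mul, ← map_mul]
  congr 3
  change _ = star (Q.jProd (fun j : Fin (n + 1) => s j) R).1 * (Q.j (s n) X).1 *
    (Q.jProd (fun j : Fin (n + 1) => s j) R).1
  rw [coe_j, star_mul]
  simp only [mul_assoc]
  rfl

theorem StochasticProc.exists_processTensor (b : HilbertBasis ℕ ℂ K) {n : ℕ}
    (t : Fin (n + 1) → ℝ≥0) :
    ∃ T : ∀ m : ℕ, (Fin m ↪o Fin (n + 1)) → OpTensor Hs m →L[ℝ] (Hs →L[ℂ] Hs),
      IsProcessTensor T ∧
      ∀ (R : Fin (n + 1) → Bs.toStarSubalgebra) (X : Bs.toStarSubalgebra),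
        opTrace ((X : Hs →L[ℂ] Hs) * T (n + 1) (RelEmbedding.refl _)
          (elemTensor fun j => conjOp (R j : Hs →L[ℂ] Hs))) =
        Q.μ (star (Q.jProd t R) * Q.j (t (Fin.last n)) X * Q.jProd t R) := by
  -- The times are extended to a sequence for the inductions above; the value 0 beyond the last time
  -- is never used.
  obtain ⟨s, rfl⟩ : ∃ s : ℕ → ℝ≥0, (fun j : Fin (n + 1) => s j) = t :=
    ⟨fun k => if h : k < n + 1 then t ⟨k, h⟩ else 0, funext fun j => dif_pos j.2⟩
  obtain ⟨z, hz1, hz⟩ := Q.isNormalState.exists_vector b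
  -- The copies of the system space are indexed by pairs of a basis vector of `K` and one of the
  -- environment.
  have hJ := (isometricFamily_tensorVec (H := HTensor Hs He) b.orthonormal).comp
    (isometricFamily_tensorVec (H := Hs) (stdBasis He).orthonormal)
  have hd := (isTotalFamily_tensorVec (H := HTensor Hs He) b).comp
    (isTotalFamily_tensorVec (H := Hs) (stdBasis He))
  obtain ⟨T, hT, hconj⟩ := exists_isProcessTensor hJ hd
    (α := fun X => amplHom _ K (amplHom Hs He X))
    (fun X γ x => (ampl_tensorVec _ _ _).trans
      (congrArg (tensorVec _ (b γ.1)) (ampl_tensorVec X _ x)))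
    (Q.norm_evolution_le s) hz1 n
  exact ⟨T, hT, fun R X => (hconj _ X.1).trans (Q.inner_stateVec s hz n R X)⟩

end Kernel

end QSP

theorem mainTheorem1
    {Hs : Type*} [NormedAddCommGroup Hs] [InnerProductSpace ℂ Hs] [CompleteSpace Hs]
    {He : Type*} [NormedAddCommGroup He] [InnerProductSpace ℂ He] [CompleteSpace He]
    (Bs : VonNeumannAlgebra Hs) (Be : VonNeumannAlgebra He) (Q : QSP.StochasticProc Bs Be)
    (n : ℕ) (hn : 0 < n) (t : Fin n → ℝ≥0) (ht : StrictMono t) :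
    ∃ T : ∀ m : ℕ, (Fin m ↪o Fin n) → QSP.OpTensor Hs m →L[ℝ] (Hs →L[ℂ] Hs),
      QSP.IsProcessTensor T ∧
      (∀ (R : Fin n → Bs.toStarSubalgebra) (X : Bs.toStarSubalgebra),
        QSP.opTrace ((X : Hs →L[ℂ] Hs) *
            T n (RelEmbedding.refl _) (QSP.elemTensor fun j => QSP.conjOp (R j : Hs →L[ℂ] Hs))) =
          Q.μ (star (Q.jProd t R) * Q.j (t ⟨n - 1, Nat.sub_one_lt_of_lt hn⟩) X * Q.jProd t R)) ∧
      ∃ (ℓ : ℕ) (c : Fin ℓ → ℂ), 0 < ℓ ∧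
        ∀ a b : Fin n → Bs.toStarSubalgebra,
          ∃ R : Fin ℓ → Fin n → Bs.toStarSubalgebra,
            Q.kernel t a b = ∑ k, c k * QSP.opTrace (T n (RelEmbedding.refl _)
              (QSP.elemTensor fun j => QSP.conjOp (R k j : Hs →L[ℂ] Hs))) := by
  obtain ⟨n, rfl⟩ : ∃ k, n = k + 1 := ⟨n - 1, by omega⟩
  -- The standard basis of ℓ², with the identity as coordinate map; ℓ² is the auxiliary factor in
  -- which the normal state becomes a vector state.
  let b : HilbertBasis ℕ ℂ (lp (fun _ : ℕ => ℂ) 2) := ⟨LinearIsometryEquiv.refl ℂ _⟩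
  obtain ⟨T, hT, key⟩ := Q.exists_processTensor b t
  refine ⟨T, hT, key, ?_⟩
  obtain ⟨ℓ, c, hℓ, h⟩ := Q.exists_kernel_eq_sum t
  refine ⟨ℓ, c, hℓ, fun x y => ?_⟩
  obtain ⟨R, hR⟩ := h x y
  refine ⟨R, ?_⟩
  rw [QSP.StochasticProc.kernel, hR, map_sum]
  refine Finset.sum_congr rfl fun k _ => ?_
  -- At X = 1 the reduced-state formula is the trace identity for a diagonal term of the polarized
  -- kernel.
  have h1 := key (R k) 1
  rw [Q.j_one, mul_one] at h1
  rw [map_smul, smul_eq_mul, ← h1]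
  congr 2
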